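/- Let $K$ be an infinite field of characteristic $p\ge 0$, let $n\ge 1$, and let $I\subsetneq K[x_1,\dots,x_n]$ be a radical zero-dimensional ideal; put $D=\dim_K K[x_1,\dots,x_n]/I$. For $g\in GL(K,n)$ put $g\cdot I=\{f(g\cdot X)\mid f\in I\}$, $X=(x_1,\dots,x_n)^t$. Gröbner bases are reduced; DRL and LEX are the degree reverse lexicographical and the lexicographical order with $x_1>\dots>x_n$. Let $E(J)$ be the set of leading monomials of the DRL Gröbner basis of an ideal $J$, let $B(J)$ be the set of monomials divisible by no element of $E(J)$, and let $T_n(J)$ be the matrix of the multiplication by $x_n$ on $K[x_1,\dots,x_n]/J$ in the basis $B(J)$: its column with index $\epsilon\in B(J)$ holds the coordinates of the DRL normal form of $x_n\epsilon$. Algorithms are algebraic computation trees over $K$, chosen in terms of $K$, $n$ and the set $E$ of leading monomials only (for the second one also of $\omega$, $c$ and $D$); their input consists of the coefficients of a DRL Gröbner basis with leading monomials $E$. Each operation $+,-,\times,/$ and each zero test costs $1$; copying, constants and changes of sign are free. There is a non-empty Zariski open set $U\subset GL(K,n)$ such that for every $g\in U$ for which $$p=0,\quad\text{or}\quad \deg_{x_n}(m)\not\equiv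 0 \bmod p\ \text{ for all } m\in E(g\cdot I)\text{ that are divisible by } x_n,$$ the following hold. 1. The matrix $T_n(g\cdot I)$ is computed from the DRL Gröbner basis of $g\cdot I$ at cost $0$, that is, without arithmetic operation. 2. Suppose moreover that $K$ is perfect (for instance $p=0$), or that $I$ has $D$ distinct zeros over an algebraic closure of $K$, or that some linear change of variables brings $I$ into shape position. Then $g\cdot I$ is in shape position, that is, its LEX Gröbner basis is $\{x_1-h_1(x_n),\dots,x_{n-1}-h_{n-1}(x_n),h_n(x_n)\}$ with $\deg h_i<D$ for $i<n$ and $h_n$ monic of degree $D$. Let $\omega\ge 2$ and $c$ be such that for every $m$ two $m\times m$ matrices over $K$ can be multiplied at cost at most $c\,m^\omega$. Then the LEX Gröbner basis of $g\cdot I$ is computed from its DRL Gröbner basis at cost at most $$C\,\log_2 D\,\bigl(D^\omega+n\log_2 D\cdot D\bigr)\qquad\text{if } n\le D,$$ and at cost at most $C\,\log_2 D\,\bigl(\max(n,D)\,D^{\omega-1}+n\log_2 D\cdot D\bigr)$ for all $n$ and $D$, where $C$ depends only on $\omega$ and $c$. -/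

import Mathlib

open MvPolynomial
open scoped MatrixGroups MonomialOrder

universe u

noncomputable section

/-! ### The degree reverse lexicographical order -/

/-- Exponent vectors in `n` variables, carrying the degree reverse lexicographical order. -/
def DRLMonomial (n : ℕ) : Type := Fin n →₀ ℕ

namespace DRLMonomial

variable {n : ℕ}

instance : AddCommMonoid (DRLMonomial n) := inferInstanceAs (AddCommMonoid (Fin n →₀ ℕ))

/-- The partial sums `a₀ + ⋯ + aₖ` of an exponent vector, the longest one first. Comparing these
lexicographically is the degree reverse lexicographical comparison, see `drl_lt_iff`. -/
def key (a : DRLMonomial n) : Lex (Fin n → ℕ) :=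
  toLex fun i => ∑ j ∈ Finset.Iic (Fin.rev i), (show Fin n →₀ ℕ from a) j

theorem key_add (a b : DRLMonomial n) : key (a + b) = key a + key b := by
  apply toLex.symm.injective
  funext i
  exact Finset.sum_add_distrib

theorem sum_Iic_eq {n : ℕ} (a : Fin n → ℕ) (k : Fin n) :
    ∑ j ∈ Finset.Iic k, a j = ∑ j ∈ Finset.Iio k, a j + a k := by
  rw [← Finset.Iio_insert, Finset.sum_insert (by simp), add_comm]

theorem sum_Iio_succ {n : ℕ} (a : Fin n → ℕ) (k l : Fin n) (h : (l : ℕ) = k + 1) :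
    ∑ j ∈ Finset.Iio l, a j = ∑ j ∈ Finset.Iic k, a j := by
  apply Finset.sum_congr _ fun _ _ => rfl
  ext j
  simp only [Finset.mem_Iio, Finset.mem_Iic, Fin.lt_def, Fin.le_def]
  omega

theorem key_injective : Function.Injective (key (n := n)) := by
  intro a b h
  have h1 : ∀ k : Fin n, ∑ j ∈ Finset.Iic k, (show Fin n →₀ ℕ from a) j
      = ∑ j ∈ Finset.Iic k, (show Fin n →₀ ℕ from b) j := by
    intro k
    have := congrFun (toLex.injective h) (Fin.rev k)
    simpa using this
  refine Finsupp.ext fun k => ?_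
  have h2 := h1 k
  rw [sum_Iic_eq, sum_Iic_eq] at h2
  have h3 : ∑ j ∈ Finset.Iio k, (show Fin n →₀ ℕ from a) j
      = ∑ j ∈ Finset.Iio k, (show Fin n →₀ ℕ from b) j := by
    rcases Nat.eq_zero_or_pos (k : ℕ) with hk | hk
    · have : Finset.Iio k = ∅ := by
        ext j
        simp [Fin.lt_def, hk]
      simp [this]
    · have hl : (k : ℕ) = (⟨(k : ℕ) - 1, by omega⟩ : Fin n) + 1 := by
        simp only
        omega
      rw [sum_Iio_succ _ _ k hl, sum_Iio_succ _ _ k hl, h1]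
  exact Nat.add_left_cancel (h3 ▸ h2)

instance : LinearOrder (DRLMonomial n) := LinearOrder.lift' key key_injective

theorem le_def {a b : DRLMonomial n} : a ≤ b ↔ key a ≤ key b := Iff.rfl

theorem lt_def {a b : DRLMonomial n} : a < b ↔ key a < key b := Iff.rfl

instance : IsOrderedAddMonoid (DRLMonomial n) where
  add_le_add_left a b h c := by
    rw [le_def, key_add, key_add]
    exact add_le_add_left (le_def.1 h) _

instance : WellFoundedLT (DRLMonomial n) :=
  ⟨InvImage.wf key (wellFounded_lt (α := Lex (Fin n → ℕ)))⟩

end DRLMonomial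

/-- The degree reverse lexicographical (DRL) order on the monomials in
`x₀ > x₁ > ⋯ > xₙ₋₁`; see `drl_lt_iff` for the usual description. -/
def drl (n : ℕ) : MonomialOrder (Fin n) where
  syn := DRLMonomial n
  toSyn := { toEquiv := Equiv.refl (Fin n →₀ ℕ), map_add' := fun _ _ => rfl }
  toSyn_monotone a b h := by
    refine DRLMonomial.le_def.2 (Pi.toLex_monotone fun i => ?_)
    exact Finset.sum_le_sum fun j _ => h j

theorem DRLMonomial.lt_iff_exists {n : ℕ} {a b : Fin n →₀ ℕ} :
    a ≺[drl n] b ↔ ∃ k : Fin n, (∀ l, k < l → ∑ j ∈ Finset.Iic l, a j = ∑ j ∈ Finset.Iic l, b j) ∧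
      ∑ j ∈ Finset.Iic k, a j < ∑ j ∈ Finset.Iic k, b j := by
  constructor
  · rintro ⟨i, h1, h2⟩
    refine ⟨Fin.rev i, fun l hl => ?_, h2⟩
    have hl' : Fin.rev l < i := by
      rw [← Fin.rev_lt_rev, Fin.rev_rev]
      exact hl
    have h3 : ∑ j ∈ Finset.Iic (Fin.rev (Fin.rev l)), a j
      = ∑ j ∈ Finset.Iic (Fin.rev (Fin.rev l)), b j := h1 (Fin.rev l) hl'
    rwa [Fin.rev_rev] at h3
  · rintro ⟨k, h1, h2⟩
    refine ⟨Fin.rev k, fun l hl => h1 (Fin.rev l) ?_, ?_⟩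
    · rw [← Fin.rev_lt_rev, Fin.rev_rev]
      exact hl
    · change ∑ j ∈ Finset.Iic (Fin.rev (Fin.rev k)), a j
        < ∑ j ∈ Finset.Iic (Fin.rev (Fin.rev k)), b j
      rwa [Fin.rev_rev]

theorem DRLMonomial.degree_eq {n : ℕ} (a : Fin n →₀ ℕ) (l : Fin n) :
    a.degree = ∑ j ∈ Finset.Iic l, a j + ∑ j ∈ Finset.Ioi l, a j := by
  rw [Finsupp.degree_eq_sum, ← Finset.sum_union]
  · apply Finset.sum_congr _ fun _ _ => rfl
    ext j
    simp [le_or_gt]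
  · rw [Finset.disjoint_left]
    intro j h1 h2
    simp only [Finset.mem_Iic, Finset.mem_Ioi] at h1 h2
    exact absurd h2 (not_lt.2 h1)

theorem DRLMonomial.lt_of_degree {n : ℕ} {a b : Fin n →₀ ℕ}
    (h : a.degree < b.degree ∨
      (a.degree = b.degree ∧ ∃ i, b i < a i ∧ ∀ j, i < j → a j = b j)) : a ≺[drl n] b := by
  rw [DRLMonomial.lt_iff_exists]
  rcases h with h | ⟨h, i, h1, h2⟩
  · rcases n with _ | n
    · simp [Finsupp.degree_eq_sum] at h
    · refine ⟨Fin.last n, fun l hl => absurd hl (not_lt.2 (Fin.le_last l)), ?_⟩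
      have ha := DRLMonomial.degree_eq a (Fin.last n)
      have hb := DRLMonomial.degree_eq b (Fin.last n)
      have he : Finset.Ioi (Fin.last n) = ∅ := by
        ext j
        simp [Fin.le_last]
      rw [he, Finset.sum_empty] at ha hb
      omega
  · have hs : ∀ l, i ≤ l → ∑ j ∈ Finset.Iic l, a j = ∑ j ∈ Finset.Iic l, b j := by
      intro l hl
      have ha := DRLMonomial.degree_eq a l
      have hb := DRLMonomial.degree_eq b l
      have hc : ∑ j ∈ Finset.Ioi l, a j = ∑ j ∈ Finset.Ioi l, b j :=
        Finset.sum_congr rfl fun j hj => h2 j (lt_of_le_of_lt hl (Finset.mem_Ioi.1 hj))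
      omega
    have hi := hs i le_rfl
    rw [DRLMonomial.sum_Iic_eq, DRLMonomial.sum_Iic_eq] at hi
    have hlt : ∑ j ∈ Finset.Iio i, a j < ∑ j ∈ Finset.Iio i, b j := by omega
    have hpos : 0 < (i : ℕ) := by
      by_contra h0
      have : Finset.Iio i = ∅ := by
        ext j
        simp only [Finset.mem_Iio, Fin.lt_def, Finset.notMem_empty, iff_false]
        omega
      simp [this] at hlt
    have hk : (i : ℕ) = ((⟨(i : ℕ) - 1, by omega⟩ : Fin n) : ℕ) + 1 := by
      simp only
      omega
    rw [DRLMonomial.sum_Iio_succ _ _ i hk, DRLMonomial.sum_Iio_succ _ _ i hk] at hlt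
    refine ⟨_, fun l hl => hs l ?_, hlt⟩
    rw [Fin.lt_def] at hl
    rw [Fin.le_def]
    omega

/-- `a < b` for DRL iff `a` has smaller total degree, or the degrees agree and the last exponent in
which `a` and `b` differ is larger in `a`. -/
theorem drl_lt_iff {n : ℕ} {a b : Fin n →₀ ℕ} :
    a ≺[drl n] b ↔ a.degree < b.degree ∨
      (a.degree = b.degree ∧ ∃ i, b i < a i ∧ ∀ j, i < j → a j = b j) := by
  refine ⟨fun h => ?_, DRLMonomial.lt_of_degree⟩
  by_contra hn
  rw [not_or] at hn
  obtain ⟨hn1, hn2⟩ := hn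
  have hab : a ≠ b := fun hab => absurd h (by rw [hab]; exact lt_irrefl _)
  refine absurd (DRLMonomial.lt_of_degree (a := b) (b := a) ?_) (lt_asymm h)
  rcases (not_lt.1 hn1).lt_or_eq with hd | hd
  · exact Or.inl hd
  · refine Or.inr ⟨hd, ?_⟩
    have hne : (Finset.univ.filter fun i => a i ≠ b i).Nonempty := by
      by_contra he
      rw [Finset.not_nonempty_iff_eq_empty, Finset.filter_eq_empty_iff] at he
      exact hab (Finsupp.ext fun i => not_not.1 (he (Finset.mem_univ i)))
    obtain ⟨i, hi, hmax⟩ := Finset.exists_max_image _ id hne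
    have hi' : a i ≠ b i := (Finset.mem_filter.1 hi).2
    have heq : ∀ j, i < j → b j = a j := by
      intro j hj
      by_contra hj'
      exact absurd (hmax j (Finset.mem_filter.2 ⟨Finset.mem_univ j, fun h => hj' h.symm⟩))
        (not_le.2 hj)
    rcases lt_or_gt_of_ne hi' with hlt | hlt
    · exact ⟨i, hlt, heq⟩
    · exact absurd ⟨hd.symm, i, hlt, fun j hj => (heq j hj).symm⟩ hn2

/-! ### Reduced Gröbner bases, normal forms, multiplication matrices -/

section Groebner

variable {σ : Type} {K : Type u} [Field K]

/-- `G` is the reduced Gröbner basis of the ideal `J` for the monomial order `ord`. -/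
structure IsReducedGroebnerBasis (ord : MonomialOrder σ) (J : Ideal (MvPolynomial σ K))
    (G : Set (MvPolynomial σ K)) : Prop where
  finite : G.Finite
  subset : G ⊆ J
  span_leadingTerm : Ideal.span (ord.leadingTerm '' G) =
    Ideal.span (ord.leadingTerm '' (J : Set (MvPolynomial σ K)))
  monic : ∀ g ∈ G, ord.Monic g
  reduced : ∀ g ∈ G, ∀ h ∈ G, h ≠ g → ∀ m ∈ g.support, ¬ ord.degree h ≤ m

/-- The monomials that are divisible by none of the monomials in `S`. If `S` is the set of leading
monomials of a Gröbner basis of `J`, this is the canonical monomial basis `B` of the quotient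
by `J`. -/
def standardMonomials (S : Finset (σ →₀ ℕ)) : Set (σ →₀ ℕ) :=
  {b | ∀ e ∈ S, ¬ e ≤ b}

/-- `r` is the normal form of `f` modulo `J`, where `S` is the set of leading monomials of a
Gröbner basis of `J`. -/
def IsNormalForm (J : Ideal (MvPolynomial σ K)) (S : Finset (σ →₀ ℕ))
    (f r : MvPolynomial σ K) : Prop :=
  f - r ∈ J ∧ ∀ m ∈ r.support, m ∈ standardMonomials S

/-- `T` is the matrix of the multiplication by the variable `x i` modulo `J`, in the canonical
monomial basis: column `b` holds the coordinates of the normal form of `x i * b`. -/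
def IsMultiplicationMatrix (J : Ideal (MvPolynomial σ K)) (S : Finset (σ →₀ ℕ)) (i : σ)
    (T : Matrix (standardMonomials S) (standardMonomials S) K) : Prop :=
  ∀ b : standardMonomials S, ∃ r : MvPolynomial σ K,
    IsNormalForm J S (X i * monomial (b : σ →₀ ℕ) 1) r ∧
      ∀ b' : standardMonomials S, T b' b = coeff (b' : σ →₀ ℕ) r

end Groebner

/-! ### Linear changes of variables -/

section LinearChange

variable {K : Type u} [Field K] {n : ℕ}

/-- The ideal `g · I = {f(g · X) | f ∈ I}`. -/
def linearChange (g : GL (Fin n) K) (I : Ideal (MvPolynomial (Fin n) K)) :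
    Ideal (MvPolynomial (Fin n) K) :=
  I.map (aeval fun i => ∑ j, C (g.val i j) * X j :
    MvPolynomial (Fin n) K →ₐ[K] MvPolynomial (Fin n) K)

/-- `U` is Zariski open in `GL (K, n)`: the complement of the zero set of a family of polynomials
in the matrix entries. -/
def IsZariskiOpenGL (U : Set (GL (Fin n) K)) : Prop :=
  ∃ P : Set (MvPolynomial (Fin n × Fin n) K),
    U = {g | ∃ f ∈ P, eval (fun ij => g.val ij.1 ij.2) f ≠ 0}

/-- The polynomials `x i - hᵢ(xₙ)` for the variables `x i` other than the last one `xₙ`, together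
with `xₙ ^ D - h(xₙ)`, where the `hᵢ` and `h` have degree less than `D` and coefficients `c`. -/
def shapeBasis (D : ℕ) (c : Fin (n + 1) × Fin D → K) :
    Set (MvPolynomial (Fin (n + 1)) K) :=
  {f | (∃ i, i ≠ Fin.last n ∧
        f = X i - ∑ k : Fin D, C (c (i, k)) * X (Fin.last n) ^ (k : ℕ)) ∨
      f = X (Fin.last n) ^ D - ∑ k : Fin D, C (c (Fin.last n, k)) * X (Fin.last n) ^ (k : ℕ)}

end LinearChange

/-! ### Algebraic computation trees and arithmetic complexity -/

/-- The four arithmetic operations. -/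
inductive ArithOp : Type
  | add | sub | mul | div

/-- The value of an arithmetic operation. -/
def ArithOp.eval {K : Type u} [Field K] : ArithOp → K → K → K
  | add, a, b => a + b
  | sub, a, b => a - b
  | mul, a, b => a * b
  | div, a, b => a / b

/-- Algebraic computation trees over `K` with outputs indexed by `o`, whose available registers are
indexed by the last argument: every instruction `const`, `neg`, `arith` stores its result in one
new register `none` and goes on; `isZero a s t` goes on with `s` if register `a` holds `0` and
with `t` otherwise; `output` stops and returns the contents of the chosen registers. -/
inductive CompTree (K : Type u) (o : Type) : Type → Type (max 1 u)
  | output {r : Type} (out : o → r) : CompTree K o r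
  | const {r : Type} (c : K) (t : CompTree K o (Option r)) : CompTree K o r
  | neg {r : Type} (a : r) (t : CompTree K o (Option r)) : CompTree K o r
  | arith {r : Type} (op : ArithOp) (a b : r) (t : CompTree K o (Option r)) : CompTree K o r
  | isZero {r : Type} (a : r) (s t : CompTree K o r) : CompTree K o r

namespace CompTree

variable {K : Type u} [Field K] {o : Type}

/-- The registers `env` together with one new register holding `v`. -/
def push {r : Type} (env : r → K) (v : K) : Option r → K
  | none => v
  | some a => env a

open Classical in
/-- The output of a computation tree on the input `env`. -/
def value : {r : Type} → CompTree K o r → (r → K) → o → K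
  | _, output out, env => fun i => env (out i)
  | _, const c t, env => t.value (push env c)
  | _, neg a t, env => t.value (push env (-env a))
  | _, arith op a b t, env => t.value (push env (op.eval (env a) (env b)))
  | _, isZero a s t, env => if env a = 0 then s.value env else t.value env

open Classical in
/-- The number of arithmetic operations and zero tests on the path that a computation tree follows
on the input `env`. Copying, constants and changes of sign are not counted. -/
def cost : {r : Type} → CompTree K o r → (r → K) → ℕ
  | _, output _, _ => 0
  | _, const c t, env => t.cost (push env c)
  | _, neg a t, env => t.cost (push env (-env a))
  | _, arith op a b t, env => t.cost (push env (op.eval (env a) (env b))) + 1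
  | _, isZero a s t, env => (if env a = 0 then s.cost env else t.cost env) + 1

end CompTree

/-- Two `m × m` matrices over `K` can be multiplied in at most `c * m ^ ω` arithmetic operations,
for every `m`. -/
def MatrixMultiplicationCost (K : Type u) [Field K] (ω c : ℝ) : Prop :=
  ∀ m : ℕ, ∃ t : CompTree K (Fin m × Fin m) ((Fin m × Fin m) ⊕ (Fin m × Fin m)),
    ∀ A B : Matrix (Fin m) (Fin m) K,
      (∀ i j, t.value (Sum.elim (fun ij => A ij.1 ij.2) fun ij => B ij.1 ij.2) (i, j) =
        (A * B) i j) ∧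
      (t.cost (Sum.elim (fun ij => A ij.1 ij.2) fun ij => B ij.1 ij.2) : ℝ) ≤ c * (m : ℝ) ^ ω

/-- The coefficients of the elements `G e` of a Gröbner basis at the standard monomials, where `e`
runs through the set `S` of leading monomials. If the Gröbner basis is reduced, `G e - e` is a
combination of standard monomials, so that these are all its coefficients beside the leading
coefficients `1`. -/
def groebnerCoeffs {σ : Type} {K : Type u} [Field K] {S : Finset (σ →₀ ℕ)}
    (G : S → MvPolynomial σ K) : S × standardMonomials S → K :=
  fun eb => coeff (eb.2 : σ →₀ ℕ) (G eb.1)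

end

/-! Let `A` be the quotient by `I`, of dimension `D`, with the classes `x i` of the variables. The
ideal `g · I` is the kernel of the evaluation at the linear forms `y` in `x` with coefficient matrix
`g⁻¹` (`mem_linearChange`), so its Gröbner bases encode linear relations between monomials in `y`,
and genericity is a condition on `g⁻¹`. For indeterminate coefficients, the monomials not spanned by
DRL-smaller ones form a set `B` of `D` elements. Wherever the coordinate determinant of `B` does not
vanish, `B` is the set of standard monomials of `g · I` (`genericStandard_spec`,
`genericStandard_eq`).

The matrix is free because of an exchange property of `B`. If `m * xₙ` is not in `B`, Cramer's rule
expresses it by smaller monomials with polynomial coefficients. Adding `ε` times form `k` to the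
last form and comparing the coefficients of `ε` yields `(deg m + 1) * m * xₖ`, with `deg` the degree
in `xₙ`, as a combination of monomials below `m * xₙ` or `m * xₖ`. If the factor is nonzero in `K`,
also `m * xₖ` is not in `B` (`mem_genericStandard_exchange`); this is where the characteristic
enters. Hence for `b` in `B` the monomial `b * xₙ` is again in `B` or is itself a leading monomial
(`add_single_mem_standardMonomials_or`), and its normal form is `b * xₙ` or the negated tail of a
basis element.

For LEX, let `P` hold the coordinates of the powers `1, z, …, z ^ (D - 1)` of `z = yₙ`. Repeated
squaring of `T` yields `P` in `O(log D)` matrix products (`Computes.krylov`), and the polynomials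
`hᵢ` solve systems with matrix `P`. Block inversion needs nonzero leading principal minors, without
pivoting. This is arranged by multiplying `P` by a constant Vandermonde matrix `R`, which works
generically: rescaling `z` makes each minor a nonzero polynomial in the scaling factor
(`exists_det_scaled_ne_zero`, `krylovMinor_ne_zero`). This only requires that some linear form has
independent powers, which follows from counting points over the algebraic closure or from a given
shape position. The solved systems show that `z` generates `A`, and this gives the shape of the LEX
basis. The summand with `n log D` in the bound is not used up. -/

noncomputable section

/-! ### Cost of computable functions -/

namespace CompTree

variable {K : Type u}

/-- Rename the registers of a computation tree. -/
def rename {o : Type} : {r s : Type} → (r → s) → CompTree K o r → CompTree K o s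
  | _, _, φ, output out => output (φ ∘ out)
  | _, _, φ, const c t => const c (t.rename (Option.map φ))
  | _, _, φ, neg a t => neg (φ a) (t.rename (Option.map φ))
  | _, _, φ, arith op a b t => arith op (φ a) (φ b) (t.rename (Option.map φ))
  | _, _, φ, isZero a s t => isZero (φ a) (s.rename φ) (t.rename φ)

/-- Run a computation tree and continue with `k`, which is given the embedding of the initial
registers and the registers that hold the output. -/
def bind {o q : Type} : {r : Type} → CompTree K o r →
    (∀ r' : Type, (r → r') → (o → r') → CompTree K q r') → CompTree K q r
  | _, output out, k => k _ id out
  | _, const c t, k => const c (t.bind fun r' i out => k r' (i ∘ some) out)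
  | _, neg a t, k => neg a (t.bind fun r' i out => k r' (i ∘ some) out)
  | _, arith op a b t, k => arith op a b (t.bind fun r' i out => k r' (i ∘ some) out)
  | _, isZero a s t, k => isZero a (s.bind k) (t.bind k)

theorem push_comp_map {r s : Type} (φ : r → s) (env : s → K) (v : K) :
    push env v ∘ Option.map φ = push (env ∘ φ) v := by
  funext a
  cases a <;> rfl

variable [Field K]

theorem value_cost_rename {o : Type} : ∀ {r s : Type} (φ : r → s) (t : CompTree K o r)
    (env : s → K), (t.rename φ).value env = t.value (env ∘ φ) ∧
      (t.rename φ).cost env = t.cost (env ∘ φ)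
  | _, _, φ, output out, env => ⟨rfl, rfl⟩
  | _, _, φ, const c t, env => by
    simpa [rename, value, cost, push_comp_map] using
      value_cost_rename (Option.map φ) t (push env c)
  | _, _, φ, neg a t, env => by
    simpa [rename, value, cost, push_comp_map] using
      value_cost_rename (Option.map φ) t (push env (-env (φ a)))
  | _, _, φ, arith op a b t, env => by
    simpa [rename, value, cost, push_comp_map] using
      value_cost_rename (Option.map φ) t (push env (op.eval (env (φ a)) (env (φ b))))
  | _, _, φ, isZero a s t, env => by
    have hs := value_cost_rename φ s env
    have ht := value_cost_rename φ t env
    simp [rename, value, cost, hs, ht]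

/-- Every arithmetic instruction enlarges the register type, so the continuation `k` must be
polymorphic in it. Its specification `f` sees only the initial registers and the output of `t`; in
the induction the embedding of the initial registers is composed with `some`. -/
theorem value_cost_bind {o q : Type} (c : ℕ) : ∀ {r : Type} (t : CompTree K o r)
    (k : ∀ r' : Type, (r → r') → (o → r') → CompTree K q r') (f : (r → K) → (o → K) → q → K)
    (_ : ∀ r' i out (env : r' → K), (k r' i out).value env = f (env ∘ i) (env ∘ out) ∧
      (k r' i out).cost env ≤ c) (env : r → K),
    (t.bind k).value env = f env (t.value env) ∧ (t.bind k).cost env ≤ t.cost env + c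
  | _, output out, k, f, hk, env =>
    ⟨(hk _ id out env).1, (hk _ id out env).2.trans (Nat.le_add_left _ _)⟩
  | _, const a t, k, f, hk, env =>
    value_cost_bind c t (fun r' i out => k r' (i ∘ some) out) (fun e => f (e ∘ some))
      (fun r' i out e => hk r' (i ∘ some) out e) (push env a)
  | _, neg a t, k, f, hk, env =>
    value_cost_bind c t (fun r' i out => k r' (i ∘ some) out) (fun e => f (e ∘ some))
      (fun r' i out e => hk r' (i ∘ some) out e) (push env (-env a))
  | _, arith op a b t, k, f, hk, env => by
    have h := value_cost_bind c t (fun r' i out => k r' (i ∘ some) out) (fun e => f (e ∘ some))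
      (fun r' i out e => hk r' (i ∘ some) out e) (push env (op.eval (env a) (env b)))
    refine ⟨h.1, (Nat.succ_le_succ h.2).trans (le_of_eq ?_)⟩
    exact (Nat.succ_add _ _).symm
  | _, isZero a s t, k, f, hk, env => by
    have hs := value_cost_bind c s k f hk env
    have ht := value_cost_bind c t k f hk env
    by_cases h : env a = 0
    · simp only [bind, value, cost, h, if_true]
      exact ⟨hs.1, by omega⟩
    · simp only [bind, value, cost, h, if_false]
      exact ⟨ht.1, by omega⟩

end CompTree

/-- The function `f` is computed by a computation tree at cost at most `k` on every input. -/
def Computes {K : Type u} [Field K] {r o : Type} (k : ℝ) (f : (r → K) → o → K) : Prop :=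
  ∃ t : CompTree K o r, ∀ env, t.value env = f env ∧ (t.cost env : ℝ) ≤ k

namespace Computes

variable {K : Type u} [Field K] {r o q : Type} {a b : ℝ}

theorem congr {f g : (r → K) → o → K} (h : Computes a f) (hfg : ∀ e, f e = g e) (hab : a ≤ b) :
    Computes b g := by
  obtain ⟨t, ht⟩ := h
  exact ⟨t, fun e => ⟨(ht e).1.trans (hfg e), (ht e).2.trans hab⟩⟩

theorem output (out : o → r) : Computes 0 fun (e : r → K) => e ∘ out :=
  ⟨.output out, fun _ => ⟨rfl, by simp [CompTree.cost]⟩⟩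

theorem rename {s : Type} {f : (r → K) → o → K} (h : Computes a f) (φ : r → s) :
    Computes a fun e : s → K => f (e ∘ φ) := by
  obtain ⟨t, ht⟩ := h
  refine ⟨t.rename φ, fun e => ?_⟩
  rw [(CompTree.value_cost_rename φ t e).1, (CompTree.value_cost_rename φ t e).2]
  exact ht _

theorem bind {f : (r → K) → o → K} {g : (r ⊕ o → K) → q → K} (hf : Computes a f)
    (hg : Computes b g) : Computes (a + b) fun e => g (Sum.elim e (f e)) := by
  obtain ⟨t, ht⟩ := hf
  obtain ⟨s, hs⟩ := hg
  -- The continuation needs a uniform bound in `ℕ`. Costs are natural numbers, so the floor of `b`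
  -- serves.
  have hb : ∃ c : ℕ, (∀ e, s.cost e ≤ c) ∧ (c : ℝ) ≤ b := by
    refine ⟨⌊b⌋₊, fun e => Nat.le_floor (hs e).2, Nat.floor_le ?_⟩
    exact (Nat.cast_nonneg _).trans (hs 0).2
  obtain ⟨c, hc, hcb⟩ := hb
  refine ⟨t.bind fun r' i out => s.rename (Sum.elim i out), fun e => ?_⟩
  have h := CompTree.value_cost_bind c t (fun r' i out => s.rename (Sum.elim i out))
    (fun e e' => g (Sum.elim e e')) (fun r' i out env => by
      rw [(CompTree.value_cost_rename _ s env).1, (CompTree.value_cost_rename _ s env).2]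
      refine ⟨?_, hc _⟩
      rw [(hs _).1, Sum.comp_elim]) e
  refine ⟨by rw [h.1, (ht e).1], ?_⟩
  have h2 : ((t.bind fun r' i out => s.rename (Sum.elim i out)).cost e : ℝ) ≤ t.cost e + c := by
    exact_mod_cast h.2
  linarith [(ht e).2]

theorem comp {f : (r → K) → o → K} {g : (o → K) → q → K} (hf : Computes a f)
    (hg : Computes b g) : Computes (a + b) fun e => g (f e) :=
  hf.bind (hg.rename Sum.inr)

theorem pair {f : (r → K) → o → K} {g : (r → K) → q → K} (hf : Computes a f)
    (hg : Computes b g) : Computes (a + b) fun e => Sum.elim (f e) (g e) := by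
  refine (hf.bind ((hg.rename Sum.inl).bind
    (output (Sum.elim (Sum.inl ∘ Sum.inr) Sum.inr)))).congr (fun e => ?_) (by linarith)
  funext x
  rcases x with x | x <;> rfl

/-- Extend the state `F` by the result of a computation on the state. -/
theorem extend {f : (r → K) → o → K} {g : (o → K) → q → K} (hf : Computes a f)
    (hg : Computes b g) : Computes (a + b) fun e => Sum.elim (f e) (g (f e)) := by
  refine (hf.comp ((output (K := K) (id : o → o)).pair hg)).congr (fun e => rfl) (by linarith)

theorem const (c : K) : Computes 0 fun (_ : r → K) (_ : Unit) => c :=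
  ⟨.const c (.output fun _ => none), fun _ => ⟨rfl, by simp [CompTree.cost]⟩⟩

theorem neg (i : r) : Computes 0 fun (e : r → K) (_ : Unit) => -e i :=
  ⟨.neg i (.output fun _ => none), fun _ => ⟨rfl, by simp [CompTree.cost]⟩⟩

theorem var (i : r) : Computes 0 fun (e : r → K) (_ : Unit) => e i :=
  output fun _ => i

theorem arith (op : ArithOp) (i j : r) :
    Computes 1 fun (e : r → K) (_ : Unit) => op.eval (e i) (e j) :=
  ⟨.arith op i j (.output fun _ => none), fun _ => ⟨rfl, by simp [CompTree.cost]⟩⟩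

theorem pi {ι : Type} [Finite ι] {F : ι → (r → K) → o → K} (h : ∀ i, Computes a (F i)) :
    Computes (Nat.card ι * a) fun e (p : ι × o) => F p.1 e p.2 := by
  induction ι using Finite.induction_empty_option with
  | of_equiv φ ih =>
    refine ((ih fun i => h (φ i)).comp (output fun p => (φ.symm p.1, p.2))).congr
      (fun e => ?_) ?_
    · funext p
      simp
    · rw [Nat.card_congr φ, add_zero]
  | h_empty =>
    exact (output fun p : PEmpty × o => p.1.elim).congr (fun e => funext fun p => p.1.elim)
      (by simp)
  | @h_option ι _ ih =>
    refine (((h none).pair (ih fun i => h (some i))).comp (output fun p =>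
      match p with
      | (none, x) => Sum.inl x
      | (some i, x) => Sum.inr (i, x))).congr (fun e => ?_) ?_
    · funext p
      rcases p with ⟨_ | i, x⟩ <;> rfl
    · have : Nat.card (Option ι) = Nat.card ι + 1 := by
        rw [Finite.card_option]
      rw [this]
      push_cast
      linarith

theorem pi_unit [Finite o] {f : (r → K) → o → K}
    (h : ∀ i, Computes a fun e (_ : Unit) => f e i) : Computes (Nat.card o * a) f :=
  ((pi (F := fun i e _ => f e i) h).comp (output fun i => (i, ()))).congr (fun _ => rfl)
    (by simp)

/-- Assembling any finite array from registers, negated registers and constants is free, since the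
number of outputs multiplies the cost `0`. All block rearrangements and paddings below rest on this.
-/
theorem pi_free [Finite o] {f : (r → K) → o → K}
    (h : ∀ i, Computes 0 fun e (_ : Unit) => f e i) : Computes 0 f :=
  (pi_unit h).congr (fun _ => rfl) (by simp)

end Computes

/-! ### Inversion of strongly nonsingular matrices -/

section MatrixComputations

open Matrix

variable {K : Type u} [Field K]

/-- The product of two matrices with rows and columns indexed by `Fin m` is computed at cost at
most `k`. -/
def MulCost (K : Type u) [Field K] (m : ℕ) (k : ℝ) : Prop :=
  Computes k fun (e : (Fin m × Fin m) ⊕ (Fin m × Fin m) → K) (ij : Fin m × Fin m) =>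
    ((of fun i j => e (Sum.inl (i, j))) * (of fun i j => e (Sum.inr (i, j))) :
      Matrix (Fin m) (Fin m) K) ij.1 ij.2

theorem MatrixMultiplicationCost.mulCost {ω c : ℝ} (h : MatrixMultiplicationCost K ω c) (m : ℕ) :
    MulCost K m (c * (m : ℝ) ^ ω) := by
  obtain ⟨t, ht⟩ := h m
  refine ⟨t, fun e => ?_⟩
  have he : e = Sum.elim (fun ij : Fin m × Fin m => (of fun i j => e (Sum.inl (i, j))) ij.1 ij.2)
      fun ij => (of fun i j => e (Sum.inr (i, j))) ij.1 ij.2 := by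
    funext x
    rcases x with x | x <;> rfl
  have h2 := ht (of fun i j => e (Sum.inl (i, j))) (of fun i j => e (Sum.inr (i, j)))
  rw [← he] at h2
  exact ⟨funext fun ij => h2.1 ij.1 ij.2, h2.2⟩

theorem MatrixMultiplicationCost.nonneg {ω c : ℝ} (h : MatrixMultiplicationCost K ω c) :
    0 ≤ c := by
  obtain ⟨t, ht⟩ := h 1
  have h2 := (Nat.cast_nonneg _).trans (ht 0 0).2
  simpa using h2

namespace Computes

variable {r o : Type} {a k : ℝ} {m : ℕ}

theorem matrixMul (hm : MulCost K m k) {f : (r → K) → o → K} (hf : Computes a f)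
    (φ ψ : Fin m → Fin m → o) :
    Computes (a + k) fun e => Sum.elim (f e) fun ij : Fin m × Fin m =>
      ((of fun i j => f e (φ i j)) * (of fun i j => f e (ψ i j)) :
        Matrix (Fin m) (Fin m) K) ij.1 ij.2 := by
  refine (hf.extend ((output (K := K) (Sum.elim (fun ij : Fin m × Fin m => φ ij.1 ij.2)
    fun ij : Fin m × Fin m => ψ ij.1 ij.2)).comp hm)).congr (fun e => rfl) (by linarith)

theorem matrixArith (op : ArithOp) {f : (r → K) → o → K} (hf : Computes a f)
    (φ ψ : Fin m → Fin m → o) :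
    Computes (a + m ^ 2) fun e => Sum.elim (f e) fun ij : Fin m × Fin m =>
      op.eval (f e (φ ij.1 ij.2)) (f e (ψ ij.1 ij.2)) := by
  refine (hf.extend (pi_unit (a := 1) (f := fun (e : o → K) (ij : Fin m × Fin m) =>
    op.eval (e (φ ij.1 ij.2)) (e (ψ ij.1 ij.2))) fun ij => arith op _ _)).congr
    (fun e => rfl) (le_of_eq ?_)
  simp [sq]

end Computes

/-- The inverse of a block matrix, from the inverse `A'` of the upper left block and the inverse
`S'` of its Schur complement. -/
theorem fromBlocks_mul_schur_inverse {m : Type*} [Fintype m] [DecidableEq m]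
    {A B C D A' S' : Matrix m m K} (hA : A * A' = 1) (hS : (D - C * (A' * B)) * S' = 1) :
    fromBlocks A B C D * fromBlocks (A' + A' * B * S' * (C * A')) (-(A' * B * S'))
      (-(S' * (C * A'))) S' = 1 := by
  have hD : D * S' = 1 + C * (A' * B) * S' := by
    rw [← hS, sub_mul, sub_add_cancel]
  have hB : A * (A' * B * S') = B * S' := by
    rw [← mul_assoc, ← mul_assoc, hA, one_mul]
  rw [fromBlocks_multiply, ← fromBlocks_one]
  congr 1
  · rw [mul_add, hA, ← mul_assoc A, hB, mul_neg, mul_assoc B, add_assoc]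
    simp
  · rw [mul_neg, hB]
    simp
  · rw [mul_add, mul_neg, ← mul_assoc D, hD, add_mul, one_mul]
    simp only [mul_assoc]
    abel
  · rw [mul_neg, hD]
    simp only [mul_assoc]
    abel

/-- All leading principal minors of the matrix are nonzero. -/
def StronglyNonsingular {m : ℕ} (M : Matrix (Fin m) (Fin m) K) : Prop :=
  ∀ k (hk : k ≤ m), (M.submatrix (Fin.castLE hk) (Fin.castLE hk)).det ≠ 0

theorem StronglyNonsingular.upperLeft {m l : ℕ} {M : Matrix (Fin (m + l)) (Fin (m + l)) K}
    (h : StronglyNonsingular M) :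
    StronglyNonsingular (M.submatrix (Fin.castAdd l) (Fin.castAdd l)) := by
  intro k hk
  exact h k (hk.trans (Nat.le_add_right _ _))

/-- The leading principal minor of `M` of size `m + k` is the determinant of the upper left block
times the leading principal minor of size `k` of the Schur complement. Strong nonsingularity
therefore passes to both matrices that the block recursion inverts. -/
theorem StronglyNonsingular.schur {m l : ℕ} {M : Matrix (Fin (m + l)) (Fin (m + l)) K}
    (h : StronglyNonsingular M) {A' : Matrix (Fin m) (Fin m) K}
    (hA : M.submatrix (Fin.castAdd l) (Fin.castAdd l) * A' = 1) :
    StronglyNonsingular (M.submatrix (Fin.natAdd m) (Fin.natAdd m) -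
      M.submatrix (Fin.natAdd m) (Fin.castAdd l) *
        (A' * M.submatrix (Fin.castAdd l) (Fin.natAdd m))) := by
  intro k hk hdet
  refine h (m + k) (Nat.add_le_add_left hk m) ?_
  let : Invertible (M.submatrix (Fin.castAdd l) (Fin.castAdd l)) :=
    invertibleOfRightInverse _ _ hA
  have hinv : ⅟(M.submatrix (Fin.castAdd l) (Fin.castAdd l)) = A' := rfl
  rw [← det_submatrix_equiv_self finSumFinEquiv, submatrix_submatrix]
  have hsub : M.submatrix (Fin.castLE (Nat.add_le_add_left hk m) ∘ finSumFinEquiv)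
      (Fin.castLE (Nat.add_le_add_left hk m) ∘ finSumFinEquiv) =
      fromBlocks (M.submatrix (Fin.castAdd l) (Fin.castAdd l))
        (M.submatrix (Fin.castAdd l) (Fin.natAdd m ∘ Fin.castLE hk))
        (M.submatrix (Fin.natAdd m ∘ Fin.castLE hk) (Fin.castAdd l))
        (M.submatrix (Fin.natAdd m ∘ Fin.castLE hk) (Fin.natAdd m ∘ Fin.castLE hk)) := by
    ext i j
    rcases i with i | i <;> rcases j with j | j <;> rfl
  rw [hsub, det_fromBlocks₁₁, hinv, Matrix.mul_assoc]
  exact mul_eq_zero_of_right _ hdet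

/-- Strongly nonsingular matrices of size `2 ^ l` are inverted by recursion on blocks. -/
theorem exists_computes_inverse {ω c : ℝ} (hω : 2 ≤ ω) (hc : MatrixMultiplicationCost K ω c)
    (l : ℕ) : ∀ m : ℕ, m = 2 ^ l →
    ∃ inv : Matrix (Fin m) (Fin m) K → Matrix (Fin m) (Fin m) K,
      (∀ M, StronglyNonsingular M → M * inv M = 1) ∧
      Computes ((3 * c + 1) * (m : ℝ) ^ ω) fun (e : Fin m × Fin m → K) (ij : Fin m × Fin m) =>
        inv (of fun i j => e (i, j)) ij.1 ij.2 := by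
  have hc0 := hc.nonneg
  induction l with
  | zero =>
    intro m hm
    obtain rfl : m = 1 := hm
    refine ⟨fun M => of fun _ _ => 1 / M 0 0, fun M hM => ?_, ?_⟩
    · have h1 := hM 1 le_rfl
      rw [det_fin_one] at h1
      ext i j
      obtain rfl : i = 0 := Subsingleton.elim _ _
      obtain rfl : j = 0 := Subsingleton.elim _ _
      have h2 : M 0 0 ≠ 0 := h1
      simp [mul_apply, h2]
    · refine (((Computes.output (K := K) (id : Fin 1 × Fin 1 → _)).pair
        (Computes.const 1)).comp ((Computes.arith .div (Sum.inr ()) (Sum.inl (0, 0))).comp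
          (Computes.output fun _ => ()))).congr (fun e => ?_) ?_
      · funext ij
        rfl
      · simp
        linarith
  | succ l ih =>
    intro m' hm'
    obtain ⟨m, hm⟩ : ∃ m : ℕ, m = 2 ^ l := ⟨_, rfl⟩
    obtain rfl : m' = m + m := by
      rw [hm', hm]
      ring
    obtain ⟨inv, hinv, hcost⟩ := ih m hm
    have hmul := hc.mulCost m
    let A (M : Matrix (Fin (m + m)) (Fin (m + m)) K) := M.submatrix (Fin.castAdd m) (Fin.castAdd m)
    let B (M : Matrix (Fin (m + m)) (Fin (m + m)) K) := M.submatrix (Fin.castAdd m) (Fin.natAdd m)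
    let C (M : Matrix (Fin (m + m)) (Fin (m + m)) K) := M.submatrix (Fin.natAdd m) (Fin.castAdd m)
    let D (M : Matrix (Fin (m + m)) (Fin (m + m)) K) := M.submatrix (Fin.natAdd m) (Fin.natAdd m)
    let S (M : Matrix (Fin (m + m)) (Fin (m + m)) K) := D M - C M * (inv (A M) * B M)
    refine ⟨fun M => (fromBlocks
        (inv (A M) + inv (A M) * B M * inv (S M) * (C M * inv (A M)))
        (-(inv (A M) * B M * inv (S M))) (-(inv (S M) * (C M * inv (A M)))) (inv (S M))).submatrix
        finSumFinEquiv.symm finSumFinEquiv.symm, fun M hM => ?_, ?_⟩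
    · have hA : A M * inv (A M) = 1 := hinv _ hM.upperLeft
      have hS : S M * inv (S M) = 1 := hinv _ (hM.schur hA)
      have h := fromBlocks_mul_schur_inverse hA hS
      have hM' : M = (fromBlocks (A M) (B M) (C M) (D M)).submatrix
          finSumFinEquiv.symm finSumFinEquiv.symm := by
        ext i j
        obtain ⟨i, rfl⟩ := finSumFinEquiv.surjective i
        obtain ⟨j, rfl⟩ := finSumFinEquiv.surjective j
        simp only [submatrix_apply, Equiv.symm_apply_apply]
        rcases i with i | i <;> rcases j with j | j <;> rfl
      conv_lhs => enter [1]; rw [hM']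
      rw [submatrix_mul_equiv, h, submatrix_one_equiv]
    -- With `A'` and `S'` the inverses of the upper left block and of the Schur complement `S`, the
    -- state is extended in turn by `A'`, `A'B`, `CA'`, `CA'B`, `S`, `S'`, `A'BS'`, `S'CA'`,
    -- `A'BS'CA'` and the upper left block of the result.
    · have h1 := (Computes.output (K := K) (id : Fin (m + m) × Fin (m + m) → _)).extend
        ((Computes.output fun ij : Fin m × Fin m =>
          (Fin.castAdd m ij.1, Fin.castAdd m ij.2)).comp hcost)
      have h2 := h1.matrixMul hmul (fun i j => Sum.inr (i, j))
        (fun i j => Sum.inl (Fin.castAdd m i, Fin.natAdd m j))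
      have h3 := h2.matrixMul hmul (fun i j => Sum.inl (Sum.inl (Fin.natAdd m i, Fin.castAdd m j)))
        (fun i j => Sum.inl (Sum.inr (i, j)))
      have h4 := h3.matrixMul hmul
        (fun i j => Sum.inl (Sum.inl (Sum.inl (Fin.natAdd m i, Fin.castAdd m j))))
        (fun i j => Sum.inl (Sum.inr (i, j)))
      have h5 := h4.matrixArith .sub
        (fun i j => Sum.inl (Sum.inl (Sum.inl (Sum.inl (Fin.natAdd m i, Fin.natAdd m j)))))
        (fun i j => Sum.inr (i, j))
      have h6 := h5.extend ((Computes.output fun ij : Fin m × Fin m => Sum.inr ij).comp hcost)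
      have h7 := h6.matrixMul hmul
        (fun i j => Sum.inl (Sum.inl (Sum.inl (Sum.inl (Sum.inr (i, j))))))
        (fun i j => Sum.inr (i, j))
      have h8 := h7.matrixMul hmul (fun i j => Sum.inl (Sum.inr (i, j)))
        (fun i j => Sum.inl (Sum.inl (Sum.inl (Sum.inl (Sum.inr (i, j))))))
      have h9 := h8.matrixMul hmul (fun i j => Sum.inl (Sum.inr (i, j)))
        (fun i j => Sum.inl (Sum.inl (Sum.inl (Sum.inl (Sum.inl (Sum.inr (i, j)))))))
      have h10 := h9.matrixArith .add
        (fun i j => Sum.inl (Sum.inl (Sum.inl (Sum.inl (Sum.inl (Sum.inl (Sum.inl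
          (Sum.inl (Sum.inr (i, j))))))))))
        (fun i j => Sum.inr (i, j))
      have h11 := h10.comp (Computes.pi_free (f := fun e (ij : Fin (m + m) × Fin (m + m)) =>
        (fromBlocks (of fun i j : Fin m => e (Sum.inr (i, j)))
          (of fun i j : Fin m => -e (Sum.inl (Sum.inl (Sum.inl (Sum.inr (i, j))))))
          (of fun i j : Fin m => -e (Sum.inl (Sum.inl (Sum.inr (i, j)))))
          (of fun i j : Fin m => e (Sum.inl (Sum.inl (Sum.inl (Sum.inl (Sum.inr (i, j))))))))
          (finSumFinEquiv.symm ij.1) (finSumFinEquiv.symm ij.2)) (by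
            rintro ⟨i, j⟩
            obtain ⟨i, rfl⟩ := finSumFinEquiv.surjective i
            obtain ⟨j, rfl⟩ := finSumFinEquiv.surjective j
            simp only [Equiv.symm_apply_apply]
            rcases i with i | i <;> rcases j with j | j
            · exact Computes.var _
            · exact Computes.neg _
            · exact Computes.neg _
            · exact Computes.var _))
      refine h11.congr (fun e => rfl) ?_
      have hm2 : ((m : ℝ)) ^ 2 ≤ (m : ℝ) ^ ω := by
        rw [← Real.rpow_natCast]
        refine Real.rpow_le_rpow_of_exponent_le ?_ (by simpa using hω)
        rw [hm]
        exact_mod_cast Nat.one_le_two_pow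
      have h2w : (4 : ℝ) ≤ 2 ^ ω := by
        have := Real.rpow_le_rpow_of_exponent_le (x := 2) (by norm_num) hω
        norm_num at this
        exact this
      have hmm : ((m + m : ℕ) : ℝ) ^ ω = 2 ^ ω * (m : ℝ) ^ ω := by
        rw [← Real.mul_rpow (by norm_num) (Nat.cast_nonneg m)]
        push_cast
        ring_nf
      rw [hmm]
      have hx : 0 ≤ (m : ℝ) ^ ω := by positivity
      -- Two inversions, six products and two additive operations of size `m` cost at most `(2 (3 c
      -- + 1) + 6 c + 2) m ^ ω = 4 (3 c + 1) m ^ ω`, and `4 ≤ 2 ^ ω`. This is where the constant `3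
      -- c + 1` comes from.
      have hp : 4 * ((3 * c + 1) * (m : ℝ) ^ ω) ≤ 2 ^ ω * ((3 * c + 1) * (m : ℝ) ^ ω) :=
        mul_le_mul_of_nonneg_right h2w (by positivity)
      nlinarith

end MatrixComputations

/-! ### Solving Krylov systems -/

section Krylov

open Matrix

variable {K : Type u} [Field K]

namespace Computes

variable {r o : Type} {a k : ℝ} {m : ℕ}

theorem matrixMulFree (hm : MulCost K m k) {f : (r → K) → o → K} (hf : Computes a f)
    (A B : (o → K) → Matrix (Fin m) (Fin m) K)
    (hA : ∀ i j, Computes 0 fun e (_ : Unit) => A e i j)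
    (hB : ∀ i j, Computes 0 fun e (_ : Unit) => B e i j) :
    Computes (a + k) fun e => Sum.elim (f e) fun ij : Fin m × Fin m =>
      (A (f e) * B (f e)) ij.1 ij.2 := by
  refine (hf.extend (((pi_free (f := fun e (ij : Fin m × Fin m) => A e ij.1 ij.2)
    fun ij => hA ij.1 ij.2).pair (pi_free (f := fun e (ij : Fin m × Fin m) => B e ij.1 ij.2)
    fun ij => hB ij.1 ij.2)).comp hm)).congr (fun e => rfl) (by linarith)

/-- A product with a rectangular matrix is computed by square blocks. -/
theorem matrixMulBlocks (hm : MulCost K m k) (hpos : 0 < m) {n : ℕ}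
    (A : (r → K) → Matrix (Fin m) (Fin m) K) (B : (r → K) → Matrix (Fin m) (Fin n) K)
    (hA : ∀ i j, Computes 0 fun e (_ : Unit) => A e i j)
    (hB : ∀ i j, Computes 0 fun e (_ : Unit) => B e i j) :
    Computes ((n / m + 1 : ℕ) * k) fun e (ij : Fin m × Fin n) => (A e * B e) ij.1 ij.2 := by
  let Bβ (β : Fin (n / m + 1)) (e : r → K) : Matrix (Fin m) (Fin m) K :=
    of fun i j => if h : (β : ℕ) * m + (j : ℕ) < n then B e i ⟨(β : ℕ) * m + (j : ℕ), h⟩ else 0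
  have h1 : ∀ β, Computes k fun (e : r → K) (ij : Fin m × Fin m) =>
      (A e * Bβ β e) ij.1 ij.2 := fun β =>
    (((output (K := K) id).matrixMulFree hm A (Bβ β) hA (fun i j => by
      simp only [Bβ, of_apply]
      split_ifs
      · exact hB _ _
      · exact const _)).comp (output Sum.inr)).congr (fun e => rfl) (by simp)
  refine ((pi h1).comp (output (K := K) fun ij : Fin m × Fin n =>
    ((⟨ij.2 / m, Nat.lt_succ_of_le (Nat.div_le_div_right ij.2.2.le)⟩ : Fin (n / m + 1)),
      ((ij.1, ⟨ij.2 % m, Nat.mod_lt _ hpos⟩) : Fin m × Fin m)))).congr (fun e => ?_) ?_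
  · funext ⟨i, j⟩
    have hj : (j : ℕ) / m * m + (j : ℕ) % m = j := Nat.div_add_mod' _ _
    simp only [Function.comp_apply, mul_apply, Bβ, of_apply, hj, Fin.eta, Fin.is_lt, dif_pos]
  · rw [Nat.card_eq_fintype_card, Fintype.card_fin, add_zero]

/-- The Keller-Gehrig algorithm: the vectors `T ^ j v` with `j < 2 ^ l` are computed by `2 l`
matrix products. -/
theorem krylov (hm : MulCost K m k) (T : (r → K) → Matrix (Fin m) (Fin m) K)
    (hT : ∀ i j, Computes 0 fun e (_ : Unit) => T e i j) (v : Fin m → K) (l : ℕ) :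
    Computes (l * (2 * k)) fun e => Sum.elim
      (fun ij : Fin m × Fin m => (T e ^ 2 ^ l) ij.1 ij.2)
      (fun ij : Fin m × Fin m => (T e ^ ((ij.2 : ℕ) % 2 ^ l) *ᵥ v) ij.1) := by
  induction l with
  | zero =>
    have h0 : Computes 0 fun (e : r → K) (ij : Fin m × Fin m) => v ij.1 :=
      pi_free fun ij => const _
    refine ((pi_free (f := fun e (ij : Fin m × Fin m) => T e ij.1 ij.2)
      fun ij => hT ij.1 ij.2).pair h0).congr (fun e => ?_) (by simp)
    simp [Nat.mod_one]
  | succ l ih =>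
    have h1 := (ih.matrixMul hm (fun i j => Sum.inl (i, j)) (fun i j => Sum.inl (i, j))).matrixMul
      hm (fun i j => Sum.inl (Sum.inl (i, j))) (fun i j => Sum.inl (Sum.inr (i, j)))
    -- Modulo `2 ^ (l + 1)`, the index `j` exceeds its residue modulo `2 ^ l` by `2 ^ l` exactly
    -- when bit `l` of `j` is set. So column `j` is taken from the new product in that case and is
    -- kept otherwise.
    refine (h1.comp (output (K := K) (Sum.elim (fun ij => Sum.inl (Sum.inr ij))
      fun ij : Fin m × Fin m => if (ij.2 : ℕ).testBit l then Sum.inr ij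
        else Sum.inl (Sum.inl (Sum.inr ij))))).congr (fun e => ?_) ?_
    · funext x
      rcases x with ⟨i, j⟩ | ⟨i, j⟩
      · change (of (fun i j => (T e ^ 2 ^ l) i j) * of fun i j => (T e ^ 2 ^ l) i j) i j = _
        rw [Sum.elim_inl, pow_succ, pow_mul, sq]
        rfl
      · simp only [Function.comp_apply, Sum.elim_inr]
        rw [Nat.mod_pow_succ, ← Nat.toNat_testBit]
        by_cases hj : (j : ℕ).testBit l
        · simp only [hj, if_true, Sum.elim_inr, Bool.toNat_true, mul_one]
          rw [add_comm, pow_add, ← mulVec_mulVec]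
          rfl
        · simp [hj]
    · push_cast
      linarith

end Computes

/-- The coordinates of the columns of `W`, and of `T ^ D v`, with respect to the vectors `T ^ j v`,
`j < D`, computed from an inverse of the product of the Krylov matrix with a constant matrix `R`.
All matrices are padded to size `m ≥ D`. -/
def krylovSolution {m n D : ℕ} (inv : Matrix (Fin m) (Fin m) K → Matrix (Fin m) (Fin m) K)
    (hD : D ≤ m) (v : Fin m → K) (R T : Matrix (Fin m) (Fin m) K)
    (W : Matrix (Fin m) (Fin (n + 1)) K) : Matrix (Fin m) (Fin (n + 1)) K :=
  R * inv (of fun a b => if (a : ℕ) < D ∧ (b : ℕ) < D then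
      ((of fun i (j : Fin m) => (T ^ (j : ℕ) *ᵥ v) i) * R) a b else if a = b then 1 else 0) *
    of fun a i => if i = Fin.last n then
      (if h : 0 < D then
        (T * of fun i (j : Fin m) => (T ^ (j : ℕ) *ᵥ v) i) a ⟨D - 1, by omega⟩ else 0) else W a i

/-- With `P` the Krylov matrix, the count is `2 l` products for the powers, three for `T P`, `P R`
and `R` times the inverse, one for each square block of the right-hand sides, and one inversion. -/
theorem exists_computes_krylovSolution {ω c : ℝ} (hω : 2 ≤ ω)
    (hc : MatrixMultiplicationCost K ω c) {l m n D : ℕ} {r : Type} (hm : m = 2 ^ l) (hD : D ≤ m)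
    (v : Fin m → K) (R : Matrix (Fin m) (Fin m) K)
    (T : (r → K) → Matrix (Fin m) (Fin m) K)
    (hT : ∀ i j, Computes 0 fun e (_ : Unit) => T e i j)
    (W : (r → K) → Matrix (Fin m) (Fin (n + 1)) K)
    (hW : ∀ i j, Computes 0 fun e (_ : Unit) => W e i j) :
    ∃ inv : Matrix (Fin m) (Fin m) K → Matrix (Fin m) (Fin m) K,
      (∀ M, StronglyNonsingular M → M * inv M = 1) ∧
      Computes ((2 * l + 3 + ((n + 1) / m + 1 : ℕ)) * (c * (m : ℝ) ^ ω) +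
          (3 * c + 1) * (m : ℝ) ^ ω)
        fun (e : r → K) (ik : Fin (n + 1) × Fin D) =>
          krylovSolution inv hD v R (T e) (W e) (Fin.castLE hD ik.2) ik.1 := by
  obtain ⟨inv, hinv, hcost⟩ := exists_computes_inverse hω hc l m hm
  refine ⟨inv, hinv, ?_⟩
  have hkry := Computes.krylov (hc.mulCost m) T hT v l
  -- As `m = 2 ^ l`, the reduction of the exponents modulo `2 ^ l` is void: column `j` is `T ^ j v`.
  have hml : ∀ j : Fin m, (j : ℕ) % 2 ^ l = j := fun j => Nat.mod_eq_of_lt (hm ▸ j.2)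
  simp only [hml] at hkry
  have hmpos : 0 < m := by rw [hm]; positivity
  have hmul := hc.mulCost m
  generalize hkdef : c * (m : ℝ) ^ ω = k at *
  -- the state after each step is the initial state, extended by the results of the steps
  have h0 := (Computes.output (K := K) (id : r → r)).pair
    (Computes.pi_free (f := fun e (ij : Fin m × Fin m) => T e ij.1 ij.2) fun ij => hT ij.1 ij.2)
  have h1 := h0.extend ((hkry.comp (Computes.output Sum.inr)).rename Sum.inl)
  have h2 := h1.matrixMul hmul (fun i j => Sum.inl (Sum.inr (i, j))) (fun i j => Sum.inr (i, j))
  have h3 := h2.matrixMulFree hmul (fun e => of fun i j => e (Sum.inl (Sum.inr (i, j))))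
    (fun _ => R) (fun _ _ => Computes.var _) (fun _ _ => Computes.const _)
  have h4 := h3.extend ((Computes.pi_free (K := K)
    (f := fun e (ij : Fin m × Fin m) => if (ij.1 : ℕ) < D ∧ (ij.2 : ℕ) < D then e (Sum.inr ij)
      else if ij.1 = ij.2 then (1 : K) else 0) (fun ij => by
        split_ifs
        · exact Computes.var (K := K) _
        · exact Computes.const (K := K) _
        · exact Computes.const _)).comp hcost)
  have h5 := h4.matrixMulFree hmul (fun _ => R) (fun e => of fun i j => e (Sum.inr (i, j)))
    (fun _ _ => Computes.const _) (fun _ _ => Computes.var _)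
  have h6 := h5.comp (Computes.output (K := K) (Sum.elim
    (fun x => Sum.inl (Sum.inl (Sum.inl (Sum.inl (Sum.inl (Sum.inl x))))))
    (Sum.elim (fun x => Sum.inl (Sum.inl (Sum.inl (Sum.inr x)))) fun x => Sum.inr x)))
  have h7 := h6.congr (g := fun e => Sum.elim e (Sum.elim
      (fun ij => (T e * of fun i (j : Fin m) => (T e ^ (j : ℕ) *ᵥ v) i) ij.1 ij.2)
      fun ij => (R * inv (of fun a b => if (a : ℕ) < D ∧ (b : ℕ) < D then
        ((of fun i (j : Fin m) => (T e ^ (j : ℕ) *ᵥ v) i) * R) a b else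
          if a = b then 1 else 0)) ij.1 ij.2)) (fun e => by
    funext x
    rcases x with x | x | x <;> rfl) le_rfl
  have h8 := h7.comp (Computes.matrixMulBlocks hmul hmpos (n := n + 1)
    (fun e => of fun i j => e (Sum.inr (Sum.inr (i, j))))
    (fun (e : r ⊕ (Fin m × Fin m ⊕ Fin m × Fin m) → K) => of fun a i => if i = Fin.last n then
      (if h : 0 < D then e (Sum.inr (Sum.inl (a, ⟨D - 1, by omega⟩))) else 0)
      else W (fun x => e (Sum.inl x)) a i) (fun _ _ => Computes.var _) (fun a i => by
        simp only [of_apply]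
        split_ifs
        · exact Computes.var (K := K) _
        · exact Computes.const (K := K) _
        · exact (hW _ _).rename _))
  have h9 := h8.comp (Computes.output (K := K) fun ik : Fin (n + 1) × Fin D =>
    (Fin.castLE hD ik.2, ik.1))
  refine h9.congr (fun e => rfl) ?_
  push_cast
  linarith

/-- Padding to the next power of two gives size at most `2 D`, whence the factor `2 ^ ω`, and at
most `log D + 1` squarings. The number of products is absorbed by `2 log D + 10 ≤ 12 log D`, which
needs `log D ≥ 1`, that is, `D ≥ 2`. -/
theorem exists_computes_krylovSolution_le {ω c : ℝ} (hω : 2 ≤ ω)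
    (hc : MatrixMultiplicationCost K ω c) {n D : ℕ} {r : Type} (hD : 2 ≤ D)
    (hl : D ≤ 2 ^ Nat.clog 2 D)
    (v : Fin (2 ^ Nat.clog 2 D) → K)
    (R : Matrix (Fin (2 ^ Nat.clog 2 D)) (Fin (2 ^ Nat.clog 2 D)) K)
    (T : (r → K) → Matrix (Fin (2 ^ Nat.clog 2 D)) (Fin (2 ^ Nat.clog 2 D)) K)
    (hT : ∀ i j, Computes 0 fun e (_ : Unit) => T e i j)
    (W : (r → K) → Matrix (Fin (2 ^ Nat.clog 2 D)) (Fin (n + 1)) K)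
    (hW : ∀ i j, Computes 0 fun e (_ : Unit) => W e i j) :
    ∃ inv : Matrix (Fin (2 ^ Nat.clog 2 D)) (Fin (2 ^ Nat.clog 2 D)) K →
        Matrix (Fin (2 ^ Nat.clog 2 D)) (Fin (2 ^ Nat.clog 2 D)) K,
      (∀ M, StronglyNonsingular M → M * inv M = 1) ∧
      Computes (2 ^ ω * (12 * c + 1) * (Real.logb 2 D * (max (n + 1 : ℝ) D * (D : ℝ) ^ (ω - 1))))
        fun (e : r → K) (ik : Fin (n + 1) × Fin D) =>
          krylovSolution inv hl v R (T e) (W e) (Fin.castLE hl ik.2) ik.1 := by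
  obtain ⟨inv, hinv, h⟩ := exists_computes_krylovSolution hω hc rfl hl v R T hT W hW
  refine ⟨inv, hinv, h.congr (fun _ => rfl) ?_⟩
  have hc0 := hc.nonneg
  set L := Nat.clog 2 D with hL
  have hD0 : (0 : ℝ) < D := by exact_mod_cast (by omega : 0 < D)
  have hL1 : 1 ≤ L := Nat.clog_pos (by norm_num) hD
  have hlt : 2 ^ (L - 1) < D := Nat.pow_pred_clog_lt_self (by norm_num) (by omega)
  have hltR : (2 : ℝ) ^ (L - 1) < D := by exact_mod_cast hlt
  have hlog : (L : ℝ) - 1 ≤ Real.logb 2 D := by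
    rw [Real.le_logb_iff_rpow_le (by norm_num) hD0]
    have : ((L : ℝ) - 1) = ((L - 1 : ℕ) : ℝ) := by
      rw [Nat.cast_sub hL1]
      simp
    rw [this, Real.rpow_natCast]
    exact hltR.le
  have hlog1 : 1 ≤ Real.logb 2 D := by
    rw [Real.le_logb_iff_rpow_le (by norm_num) hD0]
    simpa using (by exact_mod_cast hD : (2 : ℝ) ≤ D)
  have hN : ((2 ^ L : ℕ) : ℝ) ≤ 2 * D := by
    have : 2 ^ L = 2 * 2 ^ (L - 1) := by
      rw [← pow_succ', Nat.sub_add_cancel hL1]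
    rw [this]
    push_cast
    linarith
  have hNw : ((2 ^ L : ℕ) : ℝ) ^ ω ≤ 2 ^ ω * (D : ℝ) ^ ω := by
    rw [← Real.mul_rpow (by norm_num) hD0.le]
    exact Real.rpow_le_rpow (Nat.cast_nonneg _) hN (by linarith)
  have hDw : (D : ℝ) ^ ω = D * (D : ℝ) ^ (ω - 1) := by
    rw [Real.rpow_sub_one hD0.ne']
    field_simp
  have hq : (((n + 1) / 2 ^ L + 1 : ℕ) : ℝ) ≤ (n + 1 : ℝ) / D + 1 := by
    push_cast
    gcongr
    refine (Nat.cast_div_le).trans ?_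
    push_cast
    gcongr
    exact_mod_cast hl
  have hx : 0 ≤ (D : ℝ) ^ (ω - 1) := by positivity
  set x := (D : ℝ) ^ (ω - 1)
  set M := max (n + 1 : ℝ) D
  have hM1 : (n + 1 : ℝ) ≤ M := le_max_left _ _
  have hM2 : (D : ℝ) ≤ M := le_max_right _ _
  have hM0 : 0 ≤ M := hD0.le.trans hM2
  set ℓ := Real.logb 2 D
  have h2w : (0 : ℝ) < 2 ^ ω := by positivity
  have hNx : ((2 ^ L : ℕ) : ℝ) ^ ω ≤ 2 ^ ω * (M * x) := by
    refine hNw.trans ?_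
    rw [hDw]
    gcongr
  have hqN : (((n + 1) / 2 ^ L + 1 : ℕ) : ℝ) * ((2 ^ L : ℕ) : ℝ) ^ ω ≤ 2 ^ ω * (2 * (M * x)) := by
    calc _ ≤ ((n + 1 : ℝ) / D + 1) * (2 ^ ω * (D : ℝ) ^ ω) := by gcongr
      _ = 2 ^ ω * ((n + 1) * x + D * x) := by
        rw [hDw]
        field_simp
      _ ≤ 2 ^ ω * (2 * (M * x)) := by
        rw [two_mul]
        gcongr
  have hMx : 0 ≤ M * x := by positivity
  calc _ = c * ((2 * L + 6) * ((2 ^ L : ℕ) : ℝ) ^ ω +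
        (((n + 1) / 2 ^ L + 1 : ℕ) : ℝ) * ((2 ^ L : ℕ) : ℝ) ^ ω) + ((2 ^ L : ℕ) : ℝ) ^ ω := by
        ring
    _ ≤ c * ((2 * (ℓ + 1) + 6) * (2 ^ ω * (M * x)) + 2 ^ ω * (2 * (M * x))) +
        2 ^ ω * (M * x) := by
        gcongr
        linarith
    _ = 2 ^ ω * (c * (2 * ℓ + 10) + 1) * (M * x) := by ring
    _ ≤ 2 ^ ω * ((12 * c + 1) * ℓ) * (M * x) := by
        gcongr
        nlinarith
    _ = _ := by ring

end Krylov

/-! ### Generic position of a Vandermonde matrix -/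

section VandermondeScaling

open Matrix

variable {K : Type u} [Field K]

/-- A subspace of `K ^ D` has vectors whose last nonzero entries are at distinct positions, as many
as its dimension. -/
theorem exists_distinct_leading_positions {k D : ℕ} (P : Matrix (Fin k) (Fin D) K)
    (hP : LinearIndependent K P.row) :
    ∃ (Q : Matrix (Fin k) (Fin k) K) (d : Fin k → Fin D), Function.Injective d ∧
      ∀ i, (Q * P) i (d i) ≠ 0 ∧ ∀ j, d i < j → (Q * P) i j = 0 := by
  classical
  let W : Submodule K (Fin D → K) := Submodule.span K (Set.range P.row)
  have hW : Module.finrank K W = k := by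
    rw [finrank_span_eq_card hP, Fintype.card_fin]
  -- `J` is the set of positions of last nonzero entries of vectors of `W`. A vector vanishing on
  -- `J` has no last nonzero entry, so restriction to `J` is injective on `W` and `J` has at least
  -- `k` elements.
  let J : Set (Fin D) := {d | ∃ w ∈ W, w d ≠ 0 ∧ ∀ j, d < j → w j = 0}
  let f : W →ₗ[K] (J → K) := (LinearMap.funLeft K K (Subtype.val : J → Fin D)).comp W.subtype
  have hf : Function.Injective f := by
    rw [injective_iff_map_eq_zero]
    intro w hw
    by_contra hne
    have hne' : (Finset.univ.filter fun j => (w : Fin D → K) j ≠ 0).Nonempty := by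
      by_contra he
      rw [Finset.not_nonempty_iff_eq_empty, Finset.filter_eq_empty_iff] at he
      exact hne (Subtype.ext (funext fun j => not_not.1 (he (Finset.mem_univ j))))
    have hmem := Finset.max'_mem _ hne'
    set d := Finset.max' _ hne'
    have hd : (w : Fin D → K) d ≠ 0 := (Finset.mem_filter.1 hmem).2
    refine hd (congrFun hw ⟨d, w, w.2, hd, fun j hj => ?_⟩)
    by_contra hj'
    exact absurd (Finset.le_max' _ j (Finset.mem_filter.2 ⟨Finset.mem_univ _, hj'⟩))
      (not_le.2 hj)
  have hcard : k ≤ Fintype.card J := by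
    have h := LinearMap.finrank_le_finrank_of_injective hf
    rwa [hW, Module.finrank_fintype_fun_eq_card] at h
  obtain ⟨φ⟩ : Nonempty (Fin k ↪ J) :=
    Function.Embedding.nonempty_of_card_le (by simpa using hcard)
  choose w hwW hw using fun i => (φ i).2
  choose Q hQ using fun i => (Submodule.mem_span_range_iff_exists_fun K).1 (hwW i)
  refine ⟨of Q, fun i => φ i, Subtype.val_injective.comp φ.injective, fun i => ?_⟩
  have h : ∀ j, (of Q * P) i j = w i j := by
    intro j
    rw [← hQ i]
    simp [mul_apply, Matrix.row]
  simpa only [h] using hw i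

/-- After row operations the last nonzero entries lie in distinct columns `d i`. With `s` replaced
by its inverse and row `i` multiplied by the power `d i` of the new parameter, the determinant
becomes a polynomial whose value at `0` is the product of these entries with a Vandermonde
determinant in the nodes `t (d i)`. It is nonzero, so over an infinite field it has a nonzero value
at some nonzero parameter. -/
theorem exists_det_scaled_ne_zero [Infinite K] {k D : ℕ} (P : Matrix (Fin k) (Fin D) K)
    (hP : LinearIndependent K P.row) {t : Fin D → K} (ht : Function.Injective t) :
    ∃ s : K, s ≠ 0 ∧
      (of fun i l : Fin k => ∑ j, P i j * s ^ (j : ℕ) * t j ^ (l : ℕ)).det ≠ 0 := by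
  obtain ⟨Q, d, hd, hQ⟩ := exists_distinct_leading_positions P hP
  -- The truncated difference in the exponent is harmless: for `j` beyond `d i` the coefficient
  -- vanishes.
  let M : Matrix (Fin k) (Fin k) (Polynomial K) := of fun i l =>
    ∑ j, Polynomial.C ((Q * P) i j * t j ^ (l : ℕ)) * Polynomial.X ^ ((d i : ℕ) - (j : ℕ))
  have hM0 : M.det.eval 0 ≠ 0 := by
    have h : (Polynomial.evalRingHom 0).mapMatrix M =
        diagonal (fun i => (Q * P) i (d i)) * vandermonde (t ∘ d) := by
      ext i l
      rw [diagonal_mul, RingHom.mapMatrix_apply, map_apply]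
      simp only [M, of_apply, Polynomial.coe_evalRingHom, Polynomial.eval_finsetSum,
        Polynomial.eval_mul, Polynomial.eval_C, Polynomial.eval_pow, Polynomial.eval_X]
      rw [Finset.sum_eq_single (d i)]
      · simp [vandermonde]
      · intro j _ hj
        rcases lt_or_gt_of_ne hj with h | h
        · rw [zero_pow, mul_zero]
          exact (Nat.sub_pos_of_lt h).ne'
        · rw [(hQ i).2 j h, zero_mul, zero_mul]
      · exact fun h => absurd (Finset.mem_univ _) h
    rw [← Polynomial.coe_evalRingHom, RingHom.map_det, h, det_mul, det_diagonal]
    refine mul_ne_zero (Finset.prod_ne_zero_iff.2 fun i _ => (hQ i).1) ?_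
    exact det_vandermonde_ne_zero_iff.2 (ht.comp hd)
  -- The additional factor `X` forces the chosen parameter to be nonzero.
  have hX : M.det * Polynomial.X ≠ 0 := mul_ne_zero (fun h => hM0 (by simp [h])) Polynomial.X_ne_zero
  obtain ⟨s, hs⟩ : ∃ s, (M.det * Polynomial.X).eval s ≠ 0 := by
    by_contra! h
    exact hX (Polynomial.funext fun s => by simpa using h s)
  rw [Polynomial.eval_mul, Polynomial.eval_X] at hs
  have hs0 : s ≠ 0 := right_ne_zero_of_mul hs
  refine ⟨s⁻¹, inv_ne_zero hs0, fun hdet => left_ne_zero_of_mul hs ?_⟩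
  have h : (Polynomial.evalRingHom s).mapMatrix M = diagonal (fun i => s ^ (d i : ℕ)) *
      (Q * of fun i l : Fin k => ∑ j, P i j * s⁻¹ ^ (j : ℕ) * t j ^ (l : ℕ)) := by
    ext i l
    rw [diagonal_mul, RingHom.mapMatrix_apply, map_apply]
    simp only [M, of_apply, Polynomial.coe_evalRingHom, Polynomial.eval_finsetSum,
      Polynomial.eval_mul, Polynomial.eval_C, Polynomial.eval_pow, Polynomial.eval_X]
    have h2 : ∀ j, (Q * P) i j * t j ^ (l : ℕ) * s ^ ((d i : ℕ) - (j : ℕ)) =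
        s ^ (d i : ℕ) * ((Q * P) i j * (s⁻¹ ^ (j : ℕ) * t j ^ (l : ℕ))) := by
      intro j
      rcases le_or_gt j (d i) with h | h
      · rw [pow_sub₀ s hs0 h, inv_pow]
        ring
      · rw [(hQ i).2 j h]
        ring
    simp only [h2, ← Finset.mul_sum]
    congr 1
    simp only [mul_apply, Finset.sum_mul, Finset.mul_sum, of_apply]
    rw [Finset.sum_comm]
    exact Finset.sum_congr rfl fun _ _ => Finset.sum_congr rfl fun _ _ => by ring
  rw [← Polynomial.coe_evalRingHom, RingHom.map_det, h, det_mul, det_mul, hdet, mul_zero, mul_zero]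

end VandermondeScaling

/-! ### Elements that are not spanned by smaller ones -/

section Minimal

variable {F V α : Type*} [Field F] [AddCommGroup V] [Module F V] [LinearOrder α]

/-- The indices of the elements of a family that are not spanned by elements with smaller index. -/
def minimalIndices (F : Type*) {V α : Type*} [Field F] [AddCommGroup V] [Module F V]
    [LinearOrder α] (v : α → V) : Set α :=
  {a | v a ∉ Submodule.span F (v '' Set.Iio a)}

/-- In a nontrivial relation, the element with the largest occurring index would be spanned by
smaller ones. -/
theorem linearIndependent_minimalIndices (v : α → V) :
    LinearIndependent F fun a : minimalIndices F v => v a := by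
  classical
  rw [linearIndependent_iff']
  intro s g hg
  by_contra! h
  have hne : (s.filter fun i => g i ≠ 0).Nonempty := by
    obtain ⟨i, hi, hgi⟩ := h
    exact ⟨i, Finset.mem_filter.2 ⟨hi, hgi⟩⟩
  have hmem := Finset.max'_mem _ hne
  set i := Finset.max' _ hne with hi
  obtain ⟨his, hgi⟩ := Finset.mem_filter.1 hmem
  refine i.2 ?_
  rw [← Finset.add_sum_erase _ _ his, add_eq_zero_iff_eq_neg] at hg
  have h2 : v i = (g i)⁻¹ • -∑ j ∈ s.erase i, g j • v j := by
    rw [← hg, smul_smul, inv_mul_cancel₀ hgi, one_smul]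
  rw [h2]
  refine Submodule.smul_mem _ _ (Submodule.neg_mem _ (Submodule.sum_mem _ fun j hj => ?_))
  obtain ⟨hji, hjs⟩ := Finset.mem_erase.1 hj
  by_cases hgj : g j = 0
  · rw [hgj, zero_smul]
    exact Submodule.zero_mem _
  · refine Submodule.smul_mem _ _ (Submodule.subset_span ⟨j, ?_, rfl⟩)
    exact lt_of_le_of_ne (Finset.le_max' _ j (Finset.mem_filter.2 ⟨hjs, hgj⟩))
      fun h => hji (Subtype.ext h)

theorem mem_span_minimalIndices [WellFoundedLT α] (v : α → V) (a : α) :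
    v a ∈ Submodule.span F (v '' (minimalIndices F v ∩ Set.Iic a)) := by
  induction a using WellFoundedLT.induction with
  | ind a ih =>
    by_cases ha : a ∈ minimalIndices F v
    · exact Submodule.subset_span ⟨a, ⟨ha, le_rfl⟩, rfl⟩
    · refine Submodule.span_le.2 ?_ (not_not.1 ha)
      rintro _ ⟨b, hb, rfl⟩
      refine Submodule.span_mono (Set.image_mono ?_) (ih b hb)
      exact Set.inter_subset_inter_right _ fun c hc => (le_trans hc (le_of_lt hb) : c ≤ a)

theorem mem_span_minimalIndices_of_notMem [WellFoundedLT α] (v : α → V) {a : α}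
    (ha : a ∉ minimalIndices F v) :
    v a ∈ Submodule.span F (v '' (minimalIndices F v ∩ Set.Iio a)) := by
  refine Submodule.span_mono (Set.image_mono ?_) (mem_span_minimalIndices v a)
  rintro b ⟨hb, hba⟩
  exact ⟨hb, lt_of_le_of_ne hba fun h => ha (h ▸ hb)⟩

/-- A set `B` of indices is the set of minimal indices if the family is linearly independent on `B`
and the other elements are spanned by smaller elements with index in `B`. -/
theorem eq_minimalIndices (v : α → V) {B : Set α}
    (hB : LinearIndependent F fun b : B => v b)
    (hspan : ∀ a, a ∉ B → v a ∈ Submodule.span F (v '' (B ∩ Set.Iio a))) :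
    B = minimalIndices F v := by
  ext a
  constructor
  · intro ha hmem
    have h : v a ∈ Submodule.span F (v '' (B ∩ Set.Iio a)) := by
      refine Submodule.span_le.2 ?_ hmem
      rintro _ ⟨b, hb, rfl⟩
      by_cases hbB : b ∈ B
      · exact Submodule.subset_span ⟨b, ⟨hbB, hb⟩, rfl⟩
      · refine Submodule.span_mono (Set.image_mono ?_) (hspan b hbB)
        exact Set.inter_subset_inter_right _ fun c hc => lt_trans hc hb
    have h2 := hB.notMem_span_image (s := {b : B | (b : α) < a}) (x := ⟨a, ha⟩)
      (lt_irrefl a)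
    refine h2 ?_
    convert h using 2
    ext w
    constructor
    · rintro ⟨b, hb, rfl⟩
      exact ⟨b, ⟨b.2, hb⟩, rfl⟩
    · rintro ⟨b, ⟨hbB, hb⟩, rfl⟩
      exact ⟨⟨b, hbB⟩, hb, rfl⟩
  · intro ha
    by_contra haB
    exact ha (Submodule.span_mono (Set.image_mono Set.inter_subset_right) (hspan a haB))

end Minimal

/-! ### Generic linear forms in a finite algebra -/

section Generic

open TensorProduct Matrix

variable {σ : Type} {K : Type u} [Field K] {A : Type u} [CommRing A] [Algebra K A]

/-- The value of a monomial. -/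
def evalMonomial {σ : Type} {R : Type*} [CommSemiring R] (y : σ → R) (m : σ →₀ ℕ) : R :=
  m.prod fun i k => y i ^ k

theorem aeval_monomial_one {R : Type*} [CommRing R] [Algebra K R] (y : σ → R) (m : σ →₀ ℕ) :
    aeval y (monomial m (1 : K)) = evalMonomial y m := by
  rw [aeval_monomial, map_one, one_mul, evalMonomial]

variable [Fintype σ]

/-- The linear forms with coefficient matrix `h` in the elements `x`. -/
def linearForms (x : σ → A) (h : Matrix σ σ K) (i : σ) : A := ∑ j, h i j • x j

/-- The linear forms in `x` with indeterminate coefficients. -/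
def genericForms (K : Type u) [Field K] {A : Type u} [CommRing A] [Algebra K A] (x : σ → A)
    (i : σ) : MvPolynomial (σ × σ) K ⊗[K] A := ∑ j, X (i, j) ⊗ₜ x j

/-- Evaluation of the indeterminate coefficients at the entries of a matrix. -/
def specialize (A : Type u) [CommRing A] [Algebra K A] (h : Matrix σ σ K) :
    MvPolynomial (σ × σ) K ⊗[K] A →ₐ[K] A :=
  Algebra.TensorProduct.lift (aeval fun ij => algebraMap K A (h ij.1 ij.2)) (AlgHom.id K A)
    fun _ _ => Commute.all _ _

omit [Fintype σ] in
theorem aeval_algebraMap_eq (h : Matrix σ σ K) (p : MvPolynomial (σ × σ) K) :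
    aeval (fun ij => algebraMap K A (h ij.1 ij.2)) p =
      algebraMap K A (eval (fun ij => h ij.1 ij.2) p) :=
  (aeval_algebraMap_apply A (fun ij : σ × σ => h ij.1 ij.2) p).trans
    (congrArg _ (DFunLike.congr_fun (coe_aeval_eq_eval fun ij : σ × σ => h ij.1 ij.2) p))

theorem specialize_genericForms (x : σ → A) (h : Matrix σ σ K) (i : σ) :
    specialize A h (genericForms K x i) = linearForms x h i := by
  simp [specialize, genericForms, linearForms, Algebra.smul_def]

omit [Fintype σ] in
theorem map_evalMonomial {R S : Type*} [CommSemiring R] [CommSemiring S] {T : Type*}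
    [FunLike T R S] [MonoidHomClass T R S] (f : T) (y : σ → R) (m : σ →₀ ℕ) :
    f (evalMonomial y m) = evalMonomial (fun i => f (y i)) m := by
  simp [evalMonomial, map_finsuppProd]

variable {ι : Type} [Fintype ι] [DecidableEq ι] (β : Module.Basis ι K A) (x : σ → A)

/-- The coordinates of a monomial in generic linear forms. -/
def genericCoords (m : σ →₀ ℕ) (i : ι) : MvPolynomial (σ × σ) K :=
  (Algebra.TensorProduct.basis (MvPolynomial (σ × σ) K) β).repr
    (evalMonomial (genericForms K x) m) i

omit [DecidableEq ι] in
theorem sum_genericCoords (m : σ →₀ ℕ) :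
    ∑ i, genericCoords β x m i ⊗ₜ[K] β i = evalMonomial (genericForms K x) m := by
  conv_rhs => rw [← (Algebra.TensorProduct.basis (MvPolynomial (σ × σ) K) β).sum_repr
    (evalMonomial (genericForms K x) m)]
  refine Finset.sum_congr rfl fun i _ => ?_
  rw [Algebra.TensorProduct.basis_apply, TensorProduct.smul_tmul', smul_eq_mul, mul_one]
  rfl

omit [DecidableEq ι] in
theorem eval_genericCoords (h : Matrix σ σ K) (m : σ →₀ ℕ) (i : ι) :
    eval (fun ij => h ij.1 ij.2) (genericCoords β x m i) =
      β.repr (evalMonomial (linearForms x h) m) i := by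
  have h1 := congrArg (specialize A h) (sum_genericCoords β x m)
  rw [map_sum, map_evalMonomial] at h1
  simp only [specialize_genericForms] at h1
  rw [← h1]
  have h2 : ∀ i, specialize A h (genericCoords β x m i ⊗ₜ[K] β i) =
      eval (fun ij => h ij.1 ij.2) (genericCoords β x m i) • β i := by
    intro i
    rw [specialize, Algebra.TensorProduct.lift_tmul, aeval_algebraMap_eq, Algebra.smul_def]
    rfl
  simp only [h2]
  rw [β.repr_sum_self]

/-- The matrix whose columns are the coordinates of monomials in generic linear forms. -/
def genericMatrix (e : ι → σ →₀ ℕ) : Matrix ι ι (MvPolynomial (σ × σ) K) :=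
  of fun i j => genericCoords β x (e j) i

theorem eval_det_genericMatrix (h : Matrix σ σ K) (e : ι → σ →₀ ℕ) :
    eval (fun ij => h ij.1 ij.2) (genericMatrix β x e).det =
      (β.toMatrix fun j => evalMonomial (linearForms x h) (e j)).det := by
  rw [RingHom.map_det]
  congr 1
  ext i j
  simp [genericMatrix, eval_genericCoords, Module.Basis.toMatrix_apply]

theorem linearIndependent_of_eval_det_ne_zero {h : Matrix σ σ K} {e : ι → σ →₀ ℕ}
    (hdet : eval (fun ij => h ij.1 ij.2) (genericMatrix β x e).det ≠ 0) :
    LinearIndependent K fun j => evalMonomial (linearForms x h) (e j) := by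
  rw [eval_det_genericMatrix] at hdet
  have h1 := Matrix.linearIndependent_cols_of_det_ne_zero hdet
  exact LinearIndependent.of_comp β.equivFun.toLinearMap h1

/-- The monomials in generic linear forms that are not spanned by smaller monomials. -/
def genericStandard (ord : MonomialOrder σ) : Set (σ →₀ ℕ) :=
  {m | ord.toSyn m ∈ minimalIndices (FractionRing (MvPolynomial (σ × σ) K))
    fun s i => algebraMap (MvPolynomial (σ × σ) K) (FractionRing (MvPolynomial (σ × σ) K))
      (genericCoords β x (ord.toSyn.symm s) i)}

theorem linearForms_one [DecidableEq σ] : linearForms x (1 : Matrix σ σ K) = x := by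
  funext i
  simp [linearForms, Matrix.one_apply]

/-- At the identity matrix the generic forms specialize to `x`, whose monomials span the algebra.
For a basis extracted from them, the determinant is already nonzero at this point. -/
theorem exists_genericMatrix_det_ne_zero [DecidableEq σ]
    (hx : Algebra.adjoin K (Set.range x) = ⊤) :
    ∃ e : ι → σ →₀ ℕ, (genericMatrix β x e).det ≠ 0 := by
  have hspan : ⊤ ≤ Submodule.span K (Set.range (evalMonomial x)) := by
    rintro a -
    have ha : a ∈ Algebra.adjoin K (Set.range x) := hx ▸ Algebra.mem_top
    rw [Algebra.adjoin_range_eq_range_aeval] at ha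
    obtain ⟨f, rfl⟩ := ha
    change aeval x f ∈ _
    rw [f.as_sum, map_sum]
    refine Submodule.sum_mem _ fun m _ => ?_
    rw [aeval_monomial, ← Algebra.smul_def]
    exact Submodule.smul_mem _ _ (Submodule.subset_span ⟨m, rfl⟩)
  obtain ⟨κ, a, -, hκ, hli⟩ := exists_linearIndependent' K (evalMonomial x)
  let b : Module.Basis κ K A := Module.Basis.mk hli (by rw [hκ]; exact hspan)
  have φ := β.indexEquiv b
  refine ⟨fun i => a (φ i), fun h0 => ?_⟩
  have h1 := eval_det_genericMatrix β x (1 : Matrix σ σ K) (fun i => a (φ i))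
  rw [h0, map_zero, linearForms_one] at h1
  have h2 : (fun j => evalMonomial x (a (φ j))) = b.reindex φ.symm := by
    funext j
    simp [b]
  rw [h2] at h1
  have h3 := β.isUnit_det (b.reindex φ.symm)
  rw [Module.Basis.det_apply, ← h1] at h3
  exact not_isUnit_zero h3

/-- Over the fraction field the coordinate vectors of the monomials span, so the minimal ones form a
basis. Cramer's rule clears the denominators of all reductions by one and the same determinant, so
that the reductions specialize wherever this single polynomial does not vanish. -/
theorem genericStandard_spec [DecidableEq σ] (ord : MonomialOrder σ)
    (hx : Algebra.adjoin K (Set.range x) = ⊤) :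
    Nonempty (ι ≃ genericStandard β x ord) ∧ ∀ e : ι ≃ genericStandard β x ord,
      (genericMatrix β x fun j => e j).det ≠ 0 ∧ ∀ m, m ∉ genericStandard β x ord →
        ∃ p : ι → MvPolynomial (σ × σ) K, (∀ j, ¬ (e j : σ →₀ ℕ) ≺[ord] m → p j = 0) ∧
          (genericMatrix β x fun j => e j).det • evalMonomial (genericForms K x) m =
            ∑ j, p j • evalMonomial (genericForms K x) (e j) := by
  set F := FractionRing (MvPolynomial (σ × σ) K)
  set v : ord.syn → ι → F := fun s i => algebraMap (MvPolynomial (σ × σ) K) F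
    (genericCoords β x (ord.toSyn.symm s) i) with hv
  have hvm : ∀ m i, v (ord.toSyn m) i = algebraMap _ F (genericCoords β x m i) := by
    intro m i
    simp [hv]
  have hmin := linearIndependent_minimalIndices (F := F) v
  have hmap : ∀ e : ι → σ →₀ ℕ, (algebraMap (MvPolynomial (σ × σ) K) F).mapMatrix
      (genericMatrix β x e) = of fun i j => v (ord.toSyn (e j)) i := by
    intro e
    ext i j
    rw [RingHom.mapMatrix_apply, map_apply, of_apply, hvm]
    rfl
  have hspan : ⊤ ≤ Submodule.span F (Set.range fun a : minimalIndices F v => v a) := by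
    obtain ⟨e, he⟩ := exists_genericMatrix_det_ne_zero β x hx
    have h1 : (of fun i j => v (ord.toSyn (e j)) i : Matrix ι ι F).det ≠ 0 := by
      rw [← hmap, ← RingHom.map_det]
      exact fun h => he ((IsFractionRing.injective (MvPolynomial (σ × σ) K) F)
        (h.trans (map_zero _).symm))
    have h2 := Matrix.linearIndependent_cols_of_det_ne_zero h1
    rw [← h2.span_eq_top_of_card_eq_finrank' (by simp)]
    refine Submodule.span_le.2 ?_
    rintro _ ⟨j, rfl⟩
    refine Submodule.span_mono ?_ (mem_span_minimalIndices v (ord.toSyn (e j)))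
    rintro _ ⟨b, hb, rfl⟩
    exact ⟨⟨b, hb.1⟩, rfl⟩
  let b : Module.Basis (minimalIndices F v) F (ι → F) := Module.Basis.mk hmin hspan
  let φ : genericStandard β x ord ≃ minimalIndices F v :=
    ord.toSyn.toEquiv.subtypeEquiv fun m => Iff.rfl
  refine ⟨⟨((Pi.basisFun F ι).indexEquiv b).trans φ.symm⟩, fun e => ?_⟩
  set V := genericMatrix β x fun j => (e j : σ →₀ ℕ) with hV
  have hb : ∀ j, b (φ (e j)) = v (ord.toSyn (e j)) := by
    intro j
    simp [b, φ]
  have hVdet : V.det ≠ 0 := by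
    intro h0
    have h1 := (Pi.basisFun F ι).isUnit_det (b.reindex (e.trans φ).symm)
    have h2 : (Pi.basisFun F ι).toMatrix (b.reindex (e.trans φ).symm) =
        (algebraMap (MvPolynomial (σ × σ) K) F).mapMatrix V := by
      rw [hmap]
      ext i j
      simp [Module.Basis.toMatrix_apply, hb]
    rw [Module.Basis.det_apply, h2, ← RingHom.map_det, h0, map_zero] at h1
    exact not_isUnit_zero h1
  -- Over the fraction field the Cramer coefficients are the determinant times the unique
  -- coefficients `c` of the expansion, and minimality puts the support of `c` below `m`.
  refine ⟨hVdet, fun m hm => ⟨V.adjugate *ᵥ genericCoords β x m, fun j hj => ?_, ?_⟩⟩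
  · have hmem := mem_span_minimalIndices_of_notMem (F := F) v (a := ord.toSyn m) hm
    have h1 : ∃ c : ι → F, (∀ j, ¬ (e j : σ →₀ ℕ) ≺[ord] m → c j = 0) ∧
        (of fun i j => v (ord.toSyn (e j)) i) *ᵥ c = v (ord.toSyn m) := by
      refine Submodule.span_induction (p := fun w _ => ∃ c : ι → F,
        (∀ j, ¬ (e j : σ →₀ ℕ) ≺[ord] m → c j = 0) ∧
        (of fun i j => v (ord.toSyn (e j)) i) *ᵥ c = w) ?_ ?_ ?_ ?_ hmem
      · rintro _ ⟨s, ⟨hs, hsm⟩, rfl⟩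
        obtain ⟨j, hj⟩ := (e.trans φ).surjective ⟨s, hs⟩
        have hj' : ord.toSyn (e j) = s := congrArg Subtype.val hj
        refine ⟨Pi.single j 1, fun i hi => ?_, ?_⟩
        · rw [Pi.single_apply, if_neg]
          rintro rfl
          exact hi (hj' ▸ hsm)
        · rw [mulVec_single_one]
          funext i
          simp [hj', Matrix.col]
      · exact ⟨0, fun _ _ => rfl, mulVec_zero _⟩
      · rintro _ _ _ _ ⟨c, hc, rfl⟩ ⟨c', hc', rfl⟩
        exact ⟨c + c', fun j hj => by simp [hc j hj, hc' j hj], mulVec_add _ _ _⟩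
      · rintro a _ _ ⟨c, hc, rfl⟩
        exact ⟨a • c, fun j hj => by simp [hc j hj], mulVec_smul _ _ _⟩
    obtain ⟨c, hc, hcm⟩ := h1
    apply IsFractionRing.injective (MvPolynomial (σ × σ) K) F
    have h2 : ∀ j, algebraMap (MvPolynomial (σ × σ) K) F ((V.adjugate *ᵥ genericCoords β x m) j) =
        algebraMap _ F V.det * c j := by
      intro j
      have h3 := congrFun (congrArg (fun w => ((algebraMap (MvPolynomial (σ × σ) K) F).mapMatrix
        V.adjugate) *ᵥ w) hcm) j
      rw [← hmap, ← hV, mulVec_mulVec, ← map_mul, adjugate_mul] at h3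
      have h4 : (algebraMap (MvPolynomial (σ × σ) K) F).mapMatrix (V.det • 1) =
          algebraMap _ F V.det • (1 : Matrix ι ι F) := by
        ext i j
        by_cases hij : i = j <;> simp [hij]
      rw [h4, smul_mulVec, one_mulVec] at h3
      rw [← smul_eq_mul, ← Pi.smul_apply, h3, RingHom.map_mulVec]
      congr 1
      ext i
      simp [hvm]
    rw [h2, hc j hj, mul_zero, map_zero]
  · apply (Algebra.TensorProduct.basis (MvPolynomial (σ × σ) K) β).ext_elem
    intro i
    have h1 : V *ᵥ (V.adjugate *ᵥ genericCoords β x m) = V.det • genericCoords β x m := by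
      rw [mulVec_mulVec, mul_adjugate, smul_mulVec, one_mulVec]
    have h2 := congrFun h1 i
    simp only [map_smul, map_sum, Finsupp.smul_apply, Finsupp.finsetSum_apply]
    refine h2.symm.trans ?_
    rw [mulVec, dotProduct]
    exact Finset.sum_congr rfl fun j _ => mul_comm _ _

omit [Fintype σ] in
theorem polynomial_smul_eq_mul (q : MvPolynomial (σ × σ) K) (z : MvPolynomial (σ × σ) K ⊗[K] A) :
    q • z = (q ⊗ₜ[K] (1 : A)) * z :=
  Algebra.smul_def q z

/-- A nonzero determinant keeps the monomials of the generic set independent after specialization,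
and the specialized Cramer relations still express every other monomial by smaller ones of the set.
By `eq_minimalIndices` these two facts determine the set. -/
theorem genericStandard_eq [DecidableEq σ] (ord : MonomialOrder σ)
    (hx : Algebra.adjoin K (Set.range x) = ⊤) (e : ι ≃ genericStandard β x ord)
    {h : Matrix σ σ K}
    (hdet : eval (fun ij => h ij.1 ij.2) (genericMatrix β x fun j => e j).det ≠ 0) :
    genericStandard β x ord = {m | ord.toSyn m ∈ minimalIndices K
      fun s => evalMonomial (linearForms x h) (ord.toSyn.symm s)} := by
  set v := fun s : ord.syn => evalMonomial (linearForms x h) (ord.toSyn.symm s) with hv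
  have hvm : ∀ m, v (ord.toSyn m) = evalMonomial (linearForms x h) m := fun m => by simp [hv]
  have h1 : {s | ord.toSyn.symm s ∈ genericStandard β x ord} = minimalIndices K v := by
    apply eq_minimalIndices
    · have h2 := linearIndependent_of_eval_det_ne_zero β x hdet
      let φ : {s : ord.syn | ord.toSyn.symm s ∈ genericStandard β x ord} ≃ genericStandard β x ord :=
        ord.toSyn.symm.toEquiv.subtypeEquiv fun m => Iff.rfl
      exact (linearIndependent_equiv' (φ.trans e.symm) (by
        funext a
        simp [φ, hv])).2 h2
    · intro s hs
      obtain ⟨p, hp0, hp⟩ := ((genericStandard_spec β x ord hx).2 e).2 (ord.toSyn.symm s) hs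
      have h3 := congrArg (specialize A h) hp
      rw [map_sum] at h3
      have h4 : ∀ (q : MvPolynomial (σ × σ) K) m, specialize A h
          (q • evalMonomial (genericForms K x) m) =
          eval (fun ij => h ij.1 ij.2) q • evalMonomial (linearForms x h) m := by
        intro q m
        rw [polynomial_smul_eq_mul, map_mul, map_evalMonomial, Algebra.smul_def]
        simp only [specialize_genericForms]
        congr 1
        rw [specialize, Algebra.TensorProduct.lift_tmul, map_one, mul_one, aeval_algebraMap_eq]
      simp only [h4] at h3
      have h5 : v s = (eval (fun ij => h ij.1 ij.2) (genericMatrix β x fun j => e j).det)⁻¹ •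
          ∑ j, eval (fun ij => h ij.1 ij.2) (p j) • evalMonomial (linearForms x h) (e j) := by
        rw [← h3, smul_smul, inv_mul_cancel₀ hdet, one_smul]
      rw [h5]
      refine Submodule.smul_mem _ _ (Submodule.sum_mem _ fun j _ => ?_)
      by_cases hj : (e j : σ →₀ ℕ) ≺[ord] ord.toSyn.symm s
      · refine Submodule.smul_mem _ _ (Submodule.subset_span ⟨ord.toSyn (e j), ⟨?_, ?_⟩, hvm _⟩)
        · simp
        · simpa using hj
      · rw [hp0 j hj, map_zero, zero_smul]
        exact Submodule.zero_mem _
  ext m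
  rw [Set.mem_ofPred_eq, ← h1]
  simp

/-! ### Exchange of variables in the generic initial ideal -/

/-- The first-order deformation of the coefficient matrix `h` that adds a multiple of row `k` to
row `n`. -/
def deform (A : Type u) [CommRing A] [Algebra K A] [DecidableEq σ] (h : Matrix σ σ K) (n k : σ) :
    MvPolynomial (σ × σ) K →ₐ[K] DualNumber A :=
  aeval fun ij => TrivSqZeroExt.inl (algebraMap K A (h ij.1 ij.2)) +
    TrivSqZeroExt.inr (if ij.1 = n then algebraMap K A (h k ij.2) else 0)

-- The coefficient of `ε` is a scalar. Deforming a polynomial coefficient of a monomial thus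
-- contributes only a scalar multiple of that same monomial.
omit [Fintype σ] in
theorem deform_spec [DecidableEq σ] (h : Matrix σ σ K) (n k : σ) (p : MvPolynomial (σ × σ) K) :
    (deform A h n k p).fst = algebraMap K A (eval (fun ij => h ij.1 ij.2) p) ∧
      ∃ c : K, (deform A h n k p).snd = algebraMap K A c := by
  induction p using MvPolynomial.induction_on with
  | C a =>
    rw [deform, algHom_C]
    exact ⟨by simp [TrivSqZeroExt.algebraMap_eq_inl'], 0, by
      simp [TrivSqZeroExt.algebraMap_eq_inl']⟩
  | add p q hp hq =>
    obtain ⟨hp, c, hc⟩ := hp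
    obtain ⟨hq, d, hd⟩ := hq
    rw [map_add]
    exact ⟨by rw [TrivSqZeroExt.fst_add, hp, hq, map_add, map_add],
      c + d, by rw [TrivSqZeroExt.snd_add, hc, hd, map_add]⟩
  | mul_X p ij hp =>
    obtain ⟨hp, c, hc⟩ := hp
    have h1 : (deform A h n k (X ij)).fst = algebraMap K A (h ij.1 ij.2) := by
      simp [deform, -DualNumber.inr_eq_smul_eps]
    have h2 : (deform A h n k (X ij)).snd =
        algebraMap K A (if ij.1 = n then h k ij.2 else 0) := by
      simp [deform, -DualNumber.inr_eq_smul_eps, apply_ite (algebraMap K A)]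
    rw [map_mul]
    refine ⟨by rw [TrivSqZeroExt.fst_mul, hp, h1, map_mul, eval_X, map_mul],
      eval (fun ij => h ij.1 ij.2) p * (if ij.1 = n then h k ij.2 else 0) + h ij.1 ij.2 * c, ?_⟩
    rw [TrivSqZeroExt.snd_mul, hp, h1, h2, hc, map_add, map_mul, map_mul]
    simp [mul_comm]

omit [Fintype σ] in
/-- First-order expansion of a polynomial when `w` is added to the variable `n`. -/
theorem aeval_dualNumber [DecidableEq σ] (y : σ → A) (w : A) (n : σ) (f : MvPolynomial σ K) :
    (aeval (fun i => (TrivSqZeroExt.inl (y i) + TrivSqZeroExt.inr (if i = n then w else 0) :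
      DualNumber A)) f).fst = aeval y f ∧
    (aeval (fun i => (TrivSqZeroExt.inl (y i) + TrivSqZeroExt.inr (if i = n then w else 0) :
      DualNumber A)) f).snd = w * aeval y (pderiv n f) := by
  induction f using MvPolynomial.induction_on with
  | C a => simp [algHom_C, TrivSqZeroExt.algebraMap_eq_inl']
  | add p q hp hq =>
    simp only [map_add, TrivSqZeroExt.fst_add, TrivSqZeroExt.snd_add, hp, hq, mul_add, and_self]
  | mul_X p i hp =>
    rw [map_mul, TrivSqZeroExt.fst_mul, TrivSqZeroExt.snd_mul, hp.1, hp.2, aeval_X]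
    refine ⟨by simp [-DualNumber.inr_eq_smul_eps], ?_⟩
    rw [Derivation.leibniz, pderiv_X]
    by_cases hi : i = n
    · subst hi
      simp
      ring
    · simp [hi]
      ring

/-- The Cramer relation for `m + single n 1` is an identity in the coefficients of the forms, so it
may be differentiated along the deformation of form `n` by form `k`. Its left side contributes `m n
+ 1` times the monomial `m + single k 1`, up to a nonzero factor and a smaller monomial. On the
right, replacing one `n` by one `k` in a monomial below `m + single n 1` gives a monomial below `m +
single k 1`. -/
theorem mem_genericStandard_exchange [DecidableEq σ] (ord : MonomialOrder σ)
    (hx : Algebra.adjoin K (Set.range x) = ⊤) (e : ι ≃ genericStandard β x ord)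
    {h : Matrix σ σ K}
    (hdet : eval (fun ij => h ij.1 ij.2) (genericMatrix β x fun j => e j).det ≠ 0)
    {n k : σ} (hnk : Finsupp.single n 1 ≺[ord] Finsupp.single k 1) {m : σ →₀ ℕ}
    (hm : ((m n + 1 : ℕ) : K) ≠ 0) (hmB : m + Finsupp.single n 1 ∉ genericStandard β x ord) :
    m + Finsupp.single k 1 ∉ genericStandard β x ord := by
  set y := linearForms x h with hy
  obtain ⟨p, hp0, hp⟩ := ((genericStandard_spec β x ord hx).2 e).2 _ hmB
  -- `Φ` sends the generic form `i` to `y i`, with `ε * y k` added for `i = n`; the coefficient of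
  -- `ε` of an image is the derivative in question.
  let Φ : MvPolynomial (σ × σ) K ⊗[K] A →ₐ[K] DualNumber A :=
    Algebra.TensorProduct.lift (deform A h n k) (TrivSqZeroExt.inlAlgHom K A A)
      fun _ _ => Commute.all _ _
  have hΦY : ∀ i, Φ (genericForms K x i) =
      TrivSqZeroExt.inl (y i) + TrivSqZeroExt.inr (if i = n then y k else 0) := by
    intro i
    have hη : ∀ j, deform A h n k (X (i, j)) = TrivSqZeroExt.inl (algebraMap K A (h i j)) +
        TrivSqZeroExt.inr (if i = n then algebraMap K A (h k j) else 0) := fun j => aeval_X _ _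
    simp only [Φ, genericForms, map_sum, Algebra.TensorProduct.lift_tmul, hη,
      TrivSqZeroExt.inlAlgHom_apply]
    ext
    · simp [-DualNumber.inr_eq_smul_eps, hy, linearForms,
        Algebra.smul_def, TrivSqZeroExt.fst_sum]
    · by_cases hi : i = n
      · simp [-DualNumber.inr_eq_smul_eps, hy, linearForms, Algebra.smul_def,
          TrivSqZeroExt.snd_sum, hi, mul_comm]
      · simp [-DualNumber.inr_eq_smul_eps, hy, linearForms, Algebra.smul_def,
          TrivSqZeroExt.snd_sum, hi]
  have hΦ : ∀ (q : MvPolynomial (σ × σ) K) b, ∃ c : K,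
      (Φ (q • evalMonomial (genericForms K x) b)).snd =
        eval (fun ij => h ij.1 ij.2) q • (y k * ((b n : K) •
          evalMonomial y (b - Finsupp.single n 1))) + c • evalMonomial y b := by
    intro q b
    obtain ⟨h1, c, hc⟩ := deform_spec (A := A) h n k q
    obtain ⟨h2, h3⟩ := aeval_dualNumber (K := K) y (y k) n (monomial b 1)
    refine ⟨c, ?_⟩
    rw [polynomial_smul_eq_mul, map_mul, map_evalMonomial]
    simp only [hΦY]
    rw [← aeval_monomial_one (K := K), TrivSqZeroExt.snd_mul, h2, h3]
    have h4 : Φ (q ⊗ₜ[K] 1) =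
        deform A h n k q := by
      simp [Φ]
    rw [h4, h1, hc, aeval_monomial_one, pderiv_monomial, one_mul, aeval_monomial]
    simp only [evalMonomial, Algebra.smul_def, MulOpposite.smul_eq_mul_unop,
      MulOpposite.unop_op, Algebra.algebraMap_self, RingHom.id_apply]
  -- the monomials below `m + single k 1` span the deformations of the monomials below
  -- `m + single n 1`
  set v := fun s : ord.syn => evalMonomial y (ord.toSyn.symm s) with hv
  set W := Submodule.span K (v '' Set.Iio (ord.toSyn (m + Finsupp.single k 1))) with hW
  have hmem : ∀ b : σ →₀ ℕ, b ≺[ord] m + Finsupp.single k 1 → evalMonomial y b ∈ W := by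
    intro b hb
    exact Submodule.subset_span ⟨ord.toSyn b, hb, by simp [hv]⟩
  have hadd : ∀ b : σ →₀ ℕ, y k * evalMonomial y b = evalMonomial y (b + Finsupp.single k 1) := by
    intro b
    have h1 : (monomial (b + Finsupp.single k 1) 1 : MvPolynomial σ K) = monomial b 1 * X k := by
      rw [X, monomial_mul, mul_one]
    rw [← aeval_monomial_one (K := K), ← aeval_monomial_one (K := K), h1, map_mul, aeval_X, mul_comm]
  have hlt : m + Finsupp.single n 1 ≺[ord] m + Finsupp.single k 1 := by
    rw [map_add, map_add]
    exact add_lt_add_right hnk _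
  have hshift : ∀ b : σ →₀ ℕ, b ≺[ord] m + Finsupp.single n 1 →
      (y k * ((b n : K) • evalMonomial y (b - Finsupp.single n 1))) ∈ W := by
    intro b hb
    rw [mul_smul_comm, hadd]
    rcases Nat.eq_zero_or_pos (b n) with h0 | h0
    · rw [h0, Nat.cast_zero, zero_smul]
      exact Submodule.zero_mem _
    · refine Submodule.smul_mem _ _ (hmem _ ?_)
      have h1 : b - Finsupp.single n 1 + Finsupp.single n 1 = b := by
        apply tsub_add_cancel_of_le
        rwa [Finsupp.single_le_iff]
      rw [← h1, map_add, map_add] at hb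
      rw [map_add, map_add]
      exact add_lt_add_left (lt_of_add_lt_add_right hb) _
  rw [genericStandard_eq β x ord hx e hdet]
  intro hnot
  refine hnot ?_
  have h1 := congrArg TrivSqZeroExt.snd (congrArg Φ hp)
  rw [map_sum, TrivSqZeroExt.snd_sum] at h1
  obtain ⟨c, hc⟩ := hΦ (genericMatrix β x fun j => (e j : σ →₀ ℕ)).det (m + Finsupp.single n 1)
  have h2 : ∑ j, (Φ (p j • evalMonomial (genericForms K x) (e j))).snd ∈ W := by
    refine Submodule.sum_mem _ fun j _ => ?_
    by_cases hj : (e j : σ →₀ ℕ) ≺[ord] m + Finsupp.single n 1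
    · obtain ⟨d, hd⟩ := hΦ (p j) (e j)
      rw [hd]
      exact Submodule.add_mem _ (Submodule.smul_mem _ _ (hshift _ hj))
        (Submodule.smul_mem _ _ (hmem _ (lt_trans hj hlt)))
    · rw [hp0 j hj, zero_smul, map_zero]
      exact Submodule.zero_mem _
  rw [← h1, hc] at h2
  have h3 := (Submodule.add_mem_iff_left _ (Submodule.smul_mem _ c (hmem _ hlt))).1 h2
  have h4 : (m + Finsupp.single n 1) - Finsupp.single n 1 = m := add_tsub_cancel_right _ _
  rw [h4, mul_smul_comm, hadd, smul_smul] at h3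
  have h5 : (((m + Finsupp.single n 1 : σ →₀ ℕ) n : ℕ) : K) = ((m n + 1 : ℕ) : K) := by simp
  have h6 := (Submodule.smul_mem_iff _ (mul_ne_zero hdet (h5 ▸ hm))).1 h3
  simpa only [Equiv.symm_apply_apply, AddEquiv.symm_apply_apply] using h6

end Generic

/-! ### Krylov matrices in generic coordinates -/

section GenericKrylov

open TensorProduct Matrix

variable {σ : Type} [Fintype σ] [DecidableEq σ] {K : Type u} [Field K] {A : Type u} [CommRing A]
  [Algebra K A] {D : ℕ} (β : Module.Basis (Fin D) K A) (x : σ → A)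

theorem top_le_span_of_linearIndependent (β : Module.Basis (Fin D) K A) {v : Fin D → A}
    (hv : LinearIndependent K v) : ⊤ ≤ Submodule.span K (Set.range v) := by
  have := Module.Finite.of_basis β
  rw [hv.span_eq_top_of_card_eq_finrank' (Module.finrank_eq_card_basis β).symm]

/-- The leading principal minor of size `k` of the product of the adjugate of the generic matrix of
a monomial basis, the matrix of the powers of a generic linear form, and a Vandermonde matrix. -/
def krylovMinor (e : Fin D → σ →₀ ℕ) (l : σ) (t : Fin D → K) {k : ℕ} (hk : k ≤ D) :
    MvPolynomial (σ × σ) K :=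
  (((genericMatrix β x e).adjugate * (genericMatrix β x fun j => Finsupp.single l (j : ℕ)) *
    (vandermonde t).map C).submatrix (Fin.castLE hk) (Fin.castLE hk)).det

omit [Fintype σ] [DecidableEq σ] in
theorem evalMonomial_single {R : Type*} [CommSemiring R] (y : σ → R) (l : σ) (k : ℕ) :
    evalMonomial y (Finsupp.single l k) = y l ^ k := by
  simp [evalMonomial]

omit [DecidableEq σ] in
theorem map_eval_genericMatrix (h : Matrix σ σ K) (e : Fin D → σ →₀ ℕ) :
    (eval fun ij : σ × σ => h ij.1 ij.2).mapMatrix (genericMatrix β x e) =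
      β.toMatrix fun j => evalMonomial (linearForms x h) (e j) := by
  ext i j
  simp [genericMatrix, eval_genericCoords, Module.Basis.toMatrix_apply]

omit [DecidableEq σ] in
/-- Expressing powers of a linear form in a monomial basis. -/
theorem eval_krylovMinor (e : Fin D → σ →₀ ℕ) (l : σ) (t : Fin D → K) {k : ℕ} (hk : k ≤ D)
    (h : Matrix σ σ K) (P : Matrix (Fin D) (Fin D) K)
    (hP : ∀ j : Fin D, linearForms x h l ^ (j : ℕ) =
      ∑ i, P i j • evalMonomial (linearForms x h) (e i)) :
    eval (fun ij => h ij.1 ij.2) (krylovMinor β x e l t hk) =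
      eval (fun ij => h ij.1 ij.2) (genericMatrix β x e).det ^ k *
        ((P * vandermonde t).submatrix (Fin.castLE hk) (Fin.castLE hk)).det := by
  classical
  set ev := eval fun ij : σ × σ => h ij.1 ij.2 with hev
  set V := β.toMatrix fun j => evalMonomial (linearForms x h) (e j) with hV
  have hX : ev.mapMatrix (genericMatrix β x fun j => Finsupp.single l (j : ℕ)) = V * P := by
    rw [hev, map_eval_genericMatrix]
    ext i j
    rw [Module.Basis.toMatrix_apply, evalMonomial_single, hP]
    simp [mul_apply, hV, Module.Basis.toMatrix_apply, mul_comm]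
  have hC : ev.mapMatrix ((vandermonde t).map C) = vandermonde t := by
    ext i j
    simp [hev]
  have h1 : ev.mapMatrix ((genericMatrix β x e).adjugate *
      (genericMatrix β x fun j => Finsupp.single l (j : ℕ)) * (vandermonde t).map C) =
      ev (genericMatrix β x e).det • (P * vandermonde t) := by
    rw [map_mul, map_mul, hX, hC, RingHom.map_adjugate, RingHom.map_det, hev,
      map_eval_genericMatrix, ← hV, ← Matrix.mul_assoc, adjugate_mul, smul_mul, one_mul, smul_mul]
  rw [krylovMinor, RingHom.map_det, RingHom.mapMatrix_apply, ← submatrix_map,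
    ← RingHom.mapMatrix_apply, h1]
  change (ev (genericMatrix β x e).det • (P * vandermonde t).submatrix (Fin.castLE hk)
    (Fin.castLE hk)).det = _
  rw [det_smul, Fintype.card_fin]

/-- Independent powers for one matrix make the determinant of the powers a nonzero polynomial, so
there is a point where it and the determinant of the monomials `e` are both nonzero. There the first
`k` rows of the coordinate matrix `P` are independent, and scaling the form `l` turns the minor into
the determinant of `exists_det_scaled_ne_zero`. -/
theorem krylovMinor_ne_zero [Infinite K] (e : Fin D → σ →₀ ℕ)
    (he : (genericMatrix β x e).det ≠ 0) (l : σ) {t : Fin D → K} (ht : Function.Injective t)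
    {h₁ : Matrix σ σ K} (h₁l : LinearIndependent K fun j : Fin D => linearForms x h₁ l ^ (j : ℕ))
    {k : ℕ} (hk : k ≤ D) : krylovMinor β x e l t hk ≠ 0 := by
  classical
  have hX : (genericMatrix β x fun j : Fin D => Finsupp.single l (j : ℕ)).det ≠ 0 := by
    intro h0
    have h1 := eval_det_genericMatrix β x h₁ (fun j : Fin D => Finsupp.single l (j : ℕ))
    rw [h0, map_zero] at h1
    simp only [evalMonomial_single] at h1
    have h2 := β.isUnit_det (Module.Basis.mk h₁l (top_le_span_of_linearIndependent β h₁l))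
    rw [Module.Basis.det_apply, Module.Basis.coe_mk, ← h1] at h2
    exact not_isUnit_zero h2
  obtain ⟨h₀, hh₀⟩ : ∃ h₀ : σ × σ → K, eval h₀ ((genericMatrix β x e).det *
      (genericMatrix β x fun j : Fin D => Finsupp.single l (j : ℕ)).det) ≠ 0 := by
    by_contra! hall
    exact mul_ne_zero he hX (MvPolynomial.funext fun a => by rw [hall a, map_zero])
  set h : Matrix σ σ K := of fun i j => h₀ (i, j) with hh
  have hh' : h₀ = fun ij => h ij.1 ij.2 := rfl
  rw [map_mul, hh'] at hh₀
  have hV0 := left_ne_zero_of_mul hh₀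
  have hX0 := right_ne_zero_of_mul hh₀
  set y := linearForms x h with hy
  have hli := linearIndependent_of_eval_det_ne_zero β x hV0
  let b : Module.Basis (Fin D) K A :=
    Module.Basis.mk hli (top_le_span_of_linearIndependent β hli)
  let P : Matrix (Fin D) (Fin D) K := b.toMatrix fun j : Fin D => y l ^ (j : ℕ)
  have hP : ∀ j : Fin D, y l ^ (j : ℕ) = ∑ i, P i j • evalMonomial y (e i) := by
    intro j
    conv_lhs => rw [← b.sum_repr (y l ^ (j : ℕ))]
    simp [P, b, hy, Module.Basis.toMatrix_apply]
  have hli2 := linearIndependent_of_eval_det_ne_zero β x hX0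
  simp only [evalMonomial_single] at hli2
  have hPdet : P.det ≠ 0 := by
    have h2 := b.isUnit_det (Module.Basis.mk hli2 (top_le_span_of_linearIndependent β hli2))
    rw [Module.Basis.det_apply, Module.Basis.coe_mk] at h2
    exact h2.ne_zero
  have hrows : LinearIndependent K (P.submatrix (Fin.castLE hk) id).row :=
    (Matrix.linearIndependent_rows_of_det_ne_zero hPdet).comp _ (Fin.castLE_injective hk)
  obtain ⟨s, hs0, hs⟩ := exists_det_scaled_ne_zero _ hrows ht
  -- scale the linear form `y l` by `s`
  let hsc : Matrix σ σ K := of fun i j => (if i = l then s else 1) * h i j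
  have hysc : ∀ i, linearForms x hsc i = (if i = l then s else 1) • y i := by
    intro i
    simp [linearForms, hsc, hy, Finset.smul_sum, mul_smul]
  have hmon : ∀ m : σ →₀ ℕ, evalMonomial (linearForms x hsc) m =
      s ^ m l • evalMonomial y m := by
    intro m
    have h1 : m.prod (fun i k => (if i = l then s else 1) ^ k) = s ^ m l := by
      rw [Finsupp.prod_fintype _ _ (fun i => pow_zero _)]
      rw [Finset.prod_eq_single l]
      · simp
      · intro i _ hi
        simp [hi]
      · exact fun h => absurd (Finset.mem_univ _) h
    rw [← h1]
    simp only [evalMonomial, hysc, Algebra.smul_def, mul_pow, Finsupp.prod_mul]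
    congr 1
    rw [map_finsuppProd]
    simp only [map_pow]
  intro h0
  -- Scaling the form `l` by `s` multiplies its power `j` by `s ^ j` and the monomial `e i` by `s ^
  -- e i l`; the coordinates change by the quotient.
  have hval := eval_krylovMinor β x e l t hk hsc
    (of fun i j => (s ^ e i l)⁻¹ * (P i j * s ^ (j : ℕ))) (fun j => by
      rw [hysc, if_pos rfl, smul_pow, hP, Finset.smul_sum]
      refine Finset.sum_congr rfl fun i _ => ?_
      rw [hmon, smul_smul, smul_smul, of_apply]
      congr 1
      field_simp)
  rw [h0, map_zero] at hval
  have hdet : eval (fun ij => hsc ij.1 ij.2) (genericMatrix β x e).det ≠ 0 := by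
    rw [eval_det_genericMatrix]
    have h1 : (β.toMatrix fun j => evalMonomial (linearForms x hsc) (e j)) =
        (β.toMatrix fun j => evalMonomial y (e j)) * diagonal fun j => s ^ e j l := by
      ext i j
      rw [mul_diagonal, Module.Basis.toMatrix_apply, Module.Basis.toMatrix_apply, hmon]
      simp [mul_comm]
    rw [h1, det_mul, det_diagonal, ← eval_det_genericMatrix]
    exact mul_ne_zero hV0 (Finset.prod_ne_zero_iff.2 fun j _ => pow_ne_zero _ hs0)
  have hminor : (((of fun i j => (s ^ e i l)⁻¹ * (P i j * s ^ (j : ℕ)) : Matrix (Fin D) (Fin D) K) *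
      vandermonde t).submatrix (Fin.castLE hk) (Fin.castLE hk)) =
      diagonal (fun i => (s ^ e (Fin.castLE hk i) l)⁻¹) *
        of fun i l : Fin k => ∑ j, P.submatrix (Fin.castLE hk) id i j * s ^ (j : ℕ) *
          t j ^ (l : ℕ) := by
    ext i j
    rw [diagonal_mul]
    simp [mul_apply, vandermonde, Finset.mul_sum, mul_assoc]
  rw [hminor, det_mul, det_diagonal] at hval
  refine mul_ne_zero (pow_ne_zero k hdet) (mul_ne_zero ?_ hs) hval.symm
  exact Finset.prod_ne_zero_iff.2 fun j _ => inv_ne_zero (pow_ne_zero _ hs0)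

end GenericKrylov

/-! ### Zariski open conditions on the inverse matrix -/

section InverseMatrix

open Matrix

variable {σ : Type} [Fintype σ] [DecidableEq σ] {K : Type u} [Field K]

/-- The entries of `g⁻¹` are those of the adjugate divided by the determinant. A power of the
determinant clears the denominators, and being nonzero on the group it does not affect vanishing. -/
theorem exists_eval_inv (f : MvPolynomial (σ × σ) K) :
    ∃ (N : ℕ) (f' : MvPolynomial (σ × σ) K), ∀ g : GL σ K,
      eval (fun ij => g.val ij.1 ij.2) f' =
        g.val.det ^ N * eval (fun ij => (g⁻¹).val ij.1 ij.2) f := by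
  let d : MvPolynomial (σ × σ) K := (of fun i j => X (i, j) : Matrix σ σ _).det
  have hd : ∀ g : Matrix σ σ K, eval (fun ij => g ij.1 ij.2) d = g.det := by
    intro g
    rw [RingHom.map_det]
    congr 1
    ext i j
    simp
  induction f using MvPolynomial.induction_on with
  | C a => exact ⟨0, C a, fun g => by simp⟩
  | add p q hp hq =>
    obtain ⟨N, p', hp⟩ := hp
    obtain ⟨M, q', hq⟩ := hq
    refine ⟨N + M, d ^ M * p' + d ^ N * q', fun g => ?_⟩
    rw [map_add, map_mul, map_mul, map_pow, map_pow, hd, hp, hq, map_add]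
    ring
  | mul_X p ij hp =>
    obtain ⟨N, p', hp⟩ := hp
    refine ⟨N + 1, p' * (of fun i j => X (i, j) : Matrix σ σ (MvPolynomial (σ × σ) K)).adjugate
      ij.1 ij.2, fun g => ?_⟩
    have h1 : eval (fun ij => g.val ij.1 ij.2)
        ((of fun i j => X (i, j) : Matrix σ σ (MvPolynomial (σ × σ) K)).adjugate ij.1 ij.2) =
        g.val.adjugate ij.1 ij.2 := by
      have h2 : (eval fun ij : σ × σ => g.val ij.1 ij.2).mapMatrix
          (of fun i j => X (i, j) : Matrix σ σ (MvPolynomial (σ × σ) K)) = g.val := by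
        ext i j
        simp
      rw [← h2, ← RingHom.map_adjugate, h2]
      rfl
    have hg : g.val.det ≠ 0 := ((isUnit_iff_isUnit_det _).1 g.isUnit).ne_zero
    have h3 : (g⁻¹).val = g.val.det⁻¹ • g.val.adjugate := by
      rw [coe_units_inv, inv_def, Ring.inverse_eq_inv']
    have h4 : (g⁻¹).val ij.1 ij.2 = g.val.det⁻¹ * g.val.adjugate ij.1 ij.2 := by
      rw [h3, Matrix.smul_apply, smul_eq_mul]
    rw [map_mul, hp, h1, map_mul, eval_X, h4]
    field_simp
    ring

/-- The condition that a nonzero polynomial does not vanish at the inverse of a matrix defines a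
non-empty Zariski open set. -/
theorem zariskiOpen_inv [Infinite K] {n : ℕ} (f : MvPolynomial (Fin n × Fin n) K) (hf : f ≠ 0) :
    {g : GL (Fin n) K | eval (fun ij => (g⁻¹).val ij.1 ij.2) f ≠ 0}.Nonempty ∧
      IsZariskiOpenGL {g : GL (Fin n) K | eval (fun ij => (g⁻¹).val ij.1 ij.2) f ≠ 0} := by
  constructor
  · let d : MvPolynomial (Fin n × Fin n) K := (of fun i j => X (i, j) : Matrix _ _ _).det
    have hd : ∀ g : Matrix (Fin n) (Fin n) K, eval (fun ij => g ij.1 ij.2) d = g.det := by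
      intro g
      rw [RingHom.map_det]
      congr 1
      ext i j
      simp
    have hd0 : d ≠ 0 := by
      intro h0
      have h1 := hd 1
      rw [h0, map_zero, det_one] at h1
      exact zero_ne_one h1
    -- The factor `d` makes the matrix at which `f` is nonzero invertible, so that it is the inverse
    -- of an element of the group.
    obtain ⟨h, hh⟩ : ∃ h, eval h (f * d) ≠ 0 := by
      by_contra! hall
      exact mul_ne_zero hf hd0 (MvPolynomial.funext fun a => by rw [hall a, map_zero])
    rw [map_mul] at hh
    let M : Matrix (Fin n) (Fin n) K := of fun i j => h (i, j)
    have hM : M.det ≠ 0 := by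
      rw [← hd]
      exact right_ne_zero_of_mul hh
    refine ⟨(GeneralLinearGroup.mkOfDetNeZero M hM)⁻¹, ?_⟩
    rw [Set.mem_ofPred_eq, inv_inv]
    exact left_ne_zero_of_mul hh
  · obtain ⟨N, f', hf'⟩ := exists_eval_inv f
    refine ⟨{f'}, ?_⟩
    ext g
    have hg : g.val.det ≠ 0 := ((isUnit_iff_isUnit_det _).1 g.isUnit).ne_zero
    simp only [Set.mem_ofPred_eq, Set.mem_singleton_iff, exists_eq_left, hf']
    exact (mul_ne_zero_iff_left (pow_ne_zero N hg)).symm.trans (by rw [mul_comm])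

end InverseMatrix

/-! ### Linear forms that generate a geometrically reduced algebra -/

section ShapeExistence

open TensorProduct

variable {K : Type u} [Field K] {A : Type u} [CommRing A] [Algebra K A] [Module.Finite K A]

/-- A reduced finite algebra is the product of its residue fields, and these are separable over a
perfect field. -/
theorem formallyEtale_of_perfectField [PerfectField K] [IsReduced A] :
    Algebra.FormallyEtale K A := by
  have : IsArtinianRing A := .of_finite K A
  have (I : MaximalSpectrum A) : Algebra.FormallyEtale K (A ⧸ I.asIdeal) := by
    let : Field (A ⧸ I.asIdeal) := Ideal.Quotient.field I.asIdeal
    exact Algebra.FormallyEtale.of_isSeparable K (A ⧸ I.asIdeal)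
  exact .of_equiv ((IsArtinianRing.equivPi A).restrictScalars K).symm

/-- A finite algebra that is geometrically reduced has as many points over the algebraic closure as
its dimension. -/
theorem exists_algHom_injective
    (h : (PerfectField K ∧ IsReduced A) ∨ Algebra.IsGeometricallyReduced K A) :
    ∃ φ : Fin (Module.finrank K A) → A →ₐ[K] AlgebraicClosure K, Function.Injective φ := by
  set L := AlgebraicClosure K
  have hB : Algebra.FormallyEtale L (L ⊗[K] A) := by
    rcases h with ⟨_, _⟩ | h
    · have := formallyEtale_of_perfectField (K := K) (A := A)
      infer_instance
    · exact formallyEtale_of_perfectField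
  -- An étale algebra over `L` is a product of copies of `L`, one for each prime. The projections
  -- are distinct, and restricting them along `A` gives as many points as the dimension.
  let ε := Algebra.FormallyEtale.equivPiOfIsSepClosed L (L ⊗[K] A)
  have hfin : Finite (PrimeSpectrum (L ⊗[K] A)) := by
    have : IsArtinianRing (L ⊗[K] A) := .of_finite L _
    infer_instance
  have := Fintype.ofFinite (PrimeSpectrum (L ⊗[K] A))
  have hcard : Fintype.card (PrimeSpectrum (L ⊗[K] A)) = Module.finrank K A := by
    rw [← Module.finrank_baseChange (R := L) (S := K), ε.toLinearEquiv.finrank_eq,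
      Module.finrank_fintype_fun_eq_card]
  let ψ (p : PrimeSpectrum (L ⊗[K] A)) : L ⊗[K] A →ₐ[L] L := (Pi.evalAlgHom L (fun _ => L) p).comp ε.toAlgHom
  let φ (p : PrimeSpectrum (L ⊗[K] A)) : A →ₐ[K] L :=
    ((ψ p).restrictScalars K).comp Algebra.TensorProduct.includeRight
  have hφ : Function.Injective φ := by
    intro p q hpq
    have h1 : ψ p = ψ q := by
      apply Algebra.TensorProduct.ext
      · ext
      · exact hpq
    by_contra hne
    classical
    have h2 := DFunLike.congr_fun h1 (ε.symm (Pi.single p 1))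
    simp [ψ, hne] at h2
  exact ⟨φ ∘ (Fintype.equivFinOfCardEq hcard).symm,
    hφ.comp (Fintype.equivFinOfCardEq hcard).symm.injective⟩

/-- A linear form with distinct values at as many points as the dimension has independent powers,
because a relation would lie in the kernel of a Vandermonde matrix. -/
theorem exists_linearIndependent_powers [Infinite K] {σ : Type} [Fintype σ] {x : σ → A}
    (hx : Algebra.adjoin K (Set.range x) = ⊤)
    (h : (PerfectField K ∧ IsReduced A) ∨ Algebra.IsGeometricallyReduced K A) :
    ∃ a : σ → K, LinearIndependent K fun j : Fin (Module.finrank K A) =>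
      (∑ i, a i • x i) ^ (j : ℕ) := by
  obtain ⟨φ, hφ⟩ := exists_algHom_injective h
  -- a linear form whose values at the points are distinct
  obtain ⟨a, ha⟩ : ∃ a : σ → K, Function.Injective fun p => φ p (∑ i, a i • x i) := by
    classical
    -- `N (p, q)` consists of the forms that do not separate the points `p` and `q`. It is a proper
    -- subspace, since distinct homomorphisms differ on the generators `x`, and finitely many proper
    -- subspaces do not cover a space over an infinite field.
    let N (pq : Fin (Module.finrank K A) × Fin (Module.finrank K A)) : Submodule K (σ → K) :=
      LinearMap.ker (((φ pq.1).toLinearMap - (φ pq.2).toLinearMap).comp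
        (Fintype.linearCombination K x))
    let s : Finset (Submodule K (σ → K)) := (Finset.univ.filter fun pq => pq.1 ≠ pq.2).image N
    have htop : ⊤ ∉ s := by
      intro hmem
      obtain ⟨pq, hpq, hN⟩ := Finset.mem_image.1 hmem
      refine (Finset.mem_filter.1 hpq).2 (hφ ?_)
      apply AlgHom.ext_of_adjoin_eq_top hx
      rintro _ ⟨i, rfl⟩
      have h1 : (Pi.single i 1 : σ → K) ∈ N pq := hN ▸ Submodule.mem_top
      have h2 := LinearMap.mem_ker.1 h1
      simpa [Fintype.linearCombination_apply, sub_eq_zero, Pi.single_apply] using h2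
    have hne := Subspace.biUnion_ne_univ_of_top_notMem htop
    obtain ⟨a, ha⟩ := (Set.ne_univ_iff_exists_notMem _).1 hne
    refine ⟨a, fun p q hpq => ?_⟩
    by_contra hne
    refine ha (Set.mem_biUnion (x := N (p, q)) (Finset.mem_image_of_mem _
      (Finset.mem_filter.2 ⟨Finset.mem_univ _, hne⟩)) ?_)
    refine LinearMap.mem_ker.2 ?_
    rw [LinearMap.comp_apply, LinearMap.sub_apply, sub_eq_zero]
    exact hpq
  refine ⟨a, ?_⟩
  set y := ∑ i, a i • x i
  rw [Fintype.linearIndependent_iff]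
  intro c hc
  have h1 : Matrix.mulVec (Matrix.vandermonde fun p => φ p y)
      (fun j => algebraMap K (AlgebraicClosure K) (c j)) = 0 := by
    funext p
    have h2 := congrArg (φ p) hc
    simp only [map_sum, map_zero, Algebra.smul_def] at h2
    simpa [Matrix.mulVec, dotProduct, Matrix.vandermonde, mul_comm] using h2
  have h3 := Matrix.eq_zero_of_mulVec_eq_zero (Matrix.det_vandermonde_ne_zero_iff.2 ha) h1
  intro j
  simpa using congrFun h3 j

end ShapeExistence

/-! ### Gröbner bases and normal forms -/

section GroebnerCoordinates

variable {σ : Type} {K : Type u} [Field K] {A : Type u} [CommRing A] [Algebra K A]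

theorem standardMonomials_of_le {S : Finset (σ →₀ ℕ)} {a b : σ →₀ ℕ}
    (hb : b ∈ standardMonomials S) (hab : a ≤ b) : a ∈ standardMonomials S :=
  fun e he h => hb e he (h.trans hab)

theorem aeval_eq_sum_evalMonomial (y : σ → A) (f : MvPolynomial σ K) :
    aeval y f = ∑ m ∈ f.support, coeff m f • evalMonomial y m := by
  conv_lhs => rw [f.as_sum, map_sum]
  refine Finset.sum_congr rfl fun m _ => ?_
  rw [aeval_monomial, ← Algebra.smul_def, evalMonomial]

section

variable {ord : MonomialOrder σ} {J : Ideal (MvPolynomial σ K)} {S : Finset (σ →₀ ℕ)}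
  {G : S → MvPolynomial σ K}

theorem IsReducedGroebnerBasis.mem_standardMonomials
    (hG : IsReducedGroebnerBasis ord J (Set.range G)) (hdeg : ∀ e : S, ord.degree (G e) = e)
    (e : S) {m : σ →₀ ℕ} (hm : m ∈ (G e).support) (hme : m ≠ e) : m ∈ standardMonomials S := by
  intro e' he' hle
  by_cases h : G ⟨e', he'⟩ = G e
  · have h1 : e' = e := by rw [← hdeg e, ← h, hdeg]
    have h2 : m ≼[ord] (e : σ →₀ ℕ) := hdeg e ▸ ord.le_degree hm
    rw [h1] at hle
    exact hme (ord.toSyn.injective (le_antisymm h2 (ord.toSyn_monotone hle)))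
  · refine hG.reduced (G e) ⟨e, rfl⟩ _ ⟨⟨e', he'⟩, rfl⟩ h m hm ?_
    rwa [hdeg]

theorem IsReducedGroebnerBasis.coeff_self
    (hG : IsReducedGroebnerBasis ord J (Set.range G)) (hdeg : ∀ e : S, ord.degree (G e) = e)
    (e : S) : coeff (e : σ →₀ ℕ) (G e) = 1 := by
  have h := (hG.monic (G e) ⟨e, rfl⟩).coeff_degree
  rwa [hdeg] at h

/-- The standard monomials are those that are not spanned by smaller ones in the quotient. -/
theorem IsReducedGroebnerBasis.standardMonomials_eq
    (hG : IsReducedGroebnerBasis ord J (Set.range G)) (hdeg : ∀ e : S, ord.degree (G e) = e)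
    {y : σ → A} (hy : ∀ f : MvPolynomial σ K, f ∈ J ↔ aeval y f = 0) :
    standardMonomials S = {m | ord.toSyn m ∈ minimalIndices K
      fun s => evalMonomial y (ord.toSyn.symm s)} := by
  classical
  set v := fun s : ord.syn => evalMonomial y (ord.toSyn.symm s) with hv
  ext m
  constructor
  · intro hm hmem
    have h1 : ∃ r : MvPolynomial σ K, (∀ a ∈ r.support, a ≺[ord] m) ∧ aeval y r = v (ord.toSyn m) := by
      refine Submodule.span_induction (p := fun w _ => ∃ r : MvPolynomial σ K,
        (∀ a ∈ r.support, a ≺[ord] m) ∧ aeval y r = w) ?_ ?_ ?_ ?_ hmem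
      · rintro _ ⟨s, hs, rfl⟩
        refine ⟨monomial (ord.toSyn.symm s) 1, fun a ha => ?_, aeval_monomial_one _ _⟩
        rw [Finset.mem_singleton.1 (support_monomial_subset ha)]
        simpa using hs
      · exact ⟨0, by simp, map_zero _⟩
      · rintro _ _ _ _ ⟨r, hr, rfl⟩ ⟨r', hr', rfl⟩
        refine ⟨r + r', fun a ha => ?_, map_add _ _ _⟩
        rcases Finset.mem_union.1 (support_add ha) with h | h
        · exact hr a h
        · exact hr' a h
      · rintro c _ _ ⟨r, hr, rfl⟩
        exact ⟨c • r, fun a ha => hr a (support_smul ha), map_smul _ _ _⟩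
    obtain ⟨r, hr, hrm⟩ := h1
    -- If `m` were spanned by smaller monomials, this element of `J` would have leading monomial
    -- `m`, which would then be divisible by an element of `S`.
    set f := monomial m 1 - r with hf
    have hfJ : f ∈ J := by
      rw [hy, hf, map_sub, hrm, aeval_monomial_one, hv]
      simp
    have hfm : coeff m f = 1 := by
      have h0 : coeff m r = 0 := by
        by_contra h0
        exact lt_irrefl _ (hr m (mem_support_iff.2 h0))
      rw [hf, coeff_sub, coeff_monomial, if_pos rfl, h0, sub_zero]
    have hdegf : ord.degree f = m := by
      apply ord.toSyn.injective
      apply le_antisymm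
      · rw [ord.degree_le_iff]
        intro a ha
        by_contra hlt
        have ham : ¬ a ≺[ord] m := fun h => hlt h.le
        have h0 : coeff a r = 0 := by
          by_contra h0
          exact ham (hr a (mem_support_iff.2 h0))
        rw [mem_support_iff, hf, coeff_sub, h0, sub_zero, coeff_monomial] at ha
        exact hlt (le_of_eq (congrArg _ (by by_contra hne; exact ha (if_neg fun h => hne h.symm))))
      · exact ord.le_degree (mem_support_iff.2 (by rw [hfm]; exact one_ne_zero))
    have h2 : ord.leadingTerm f ∈ Ideal.span (ord.leadingTerm '' Set.range G) := by
      rw [hG.span_leadingTerm]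
      exact Ideal.subset_span ⟨f, hfJ, rfl⟩
    have h3 : ord.leadingTerm '' Set.range G =
        (fun s => monomial s (1 : K)) '' (S : Set (σ →₀ ℕ)) := by
      ext p
      simp only [Set.mem_image, Set.mem_range, exists_exists_eq_and, Finset.mem_coe]
      have h4 : ∀ e : S, ord.leadingTerm (G e) = monomial (e : σ →₀ ℕ) 1 := by
        intro e
        rw [MonomialOrder.leadingTerm, hdeg, (hG.monic (G e) ⟨e, rfl⟩).leadingCoeff_eq_one]
      constructor
      · rintro ⟨e, rfl⟩
        exact ⟨e, e.2, (h4 e).symm⟩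
      · rintro ⟨e, he, rfl⟩
        exact ⟨⟨e, he⟩, h4 _⟩
    rw [h3, mem_ideal_span_monomial_image] at h2
    obtain ⟨e, he, hem⟩ := h2 m (by
      rw [MonomialOrder.leadingTerm, hdegf, MonomialOrder.leadingCoeff, hdegf, hfm,
        support_monomial, if_neg one_ne_zero]
      exact Finset.mem_singleton_self m)
    exact hm e he hem
  · intro hm e he hem
    refine hm ?_
    set f := monomial (m - e) 1 * G ⟨e, he⟩ with hf
    have hfJ : f ∈ J := J.mul_mem_left _ (hG.subset ⟨_, rfl⟩)
    have hGm := hG.monic (G ⟨e, he⟩) ⟨_, rfl⟩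
    have hfmonic : ord.Monic f := MonomialOrder.monic_monomial_one.mul hGm
    have hdegf : ord.degree f = m := by
      rw [hf, ord.degree_mul (by simp) hGm.ne_zero, hdeg]
      rw [MonomialOrder.degree_monomial, if_neg one_ne_zero]
      exact tsub_add_cancel_of_le hem
    have h1 := (hy f).1 hfJ
    have hmf : m ∈ f.support := hdegf ▸ ord.degree_mem_support hfmonic.ne_zero
    rw [aeval_eq_sum_evalMonomial, ← Finset.add_sum_erase _ _ hmf, ← hdegf,
      hfmonic.coeff_degree, one_smul, hdegf, add_eq_zero_iff_eq_neg] at h1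
    have h2 : v (ord.toSyn m) = evalMonomial y m := by simp [hv]
    rw [h2, h1]
    refine Submodule.neg_mem _ (Submodule.sum_mem _ fun a ha => Submodule.smul_mem _ _ ?_)
    obtain ⟨ham, haf⟩ := Finset.mem_erase.1 ha
    refine Submodule.subset_span ⟨ord.toSyn a, ?_, by simp [hv]⟩
    exact lt_of_le_of_ne (hdegf ▸ ord.le_degree haf) fun h => ham (ord.toSyn.injective h)

open Classical in
/-- The coordinates of the normal form of a monomial that is standard or a leading monomial, in
terms of the coefficients of a reduced Gröbner basis. -/
def normalFormCoord (S : Finset (σ →₀ ℕ)) (m : σ →₀ ℕ) (b : standardMonomials S)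
    (c : S × standardMonomials S → K) : K :=
  if m ∈ standardMonomials S then (if m = b then 1 else 0)
  else if h : m ∈ S then -c (⟨m, h⟩, b) else 0

theorem computes_normalFormCoord (m : σ →₀ ℕ) (b : standardMonomials S) :
    Computes (K := K) 0 fun c (_ : Unit) => normalFormCoord S m b c := by
  unfold normalFormCoord
  split_ifs
  · exact Computes.const _
  · exact Computes.const _
  · exact Computes.neg _
  · exact Computes.const _

/-- A standard monomial is its own normal form. A leading monomial `e` has the normal form `e - G
e`, because the tail of a reduced basis element is standard; up to sign its coordinates are input
coefficients. -/
theorem IsReducedGroebnerBasis.exists_normalForm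
    (hG : IsReducedGroebnerBasis ord J (Set.range G)) (hdeg : ∀ e : S, ord.degree (G e) = e)
    {m : σ →₀ ℕ} (hm : m ∈ standardMonomials S ∨ m ∈ S) :
    ∃ r : MvPolynomial σ K, IsNormalForm J S (monomial m 1) r ∧
      ∀ b : standardMonomials S,
        normalFormCoord S m b (groebnerCoeffs G) = coeff (b : σ →₀ ℕ) r := by
  classical
  by_cases hmB : m ∈ standardMonomials S
  · refine ⟨monomial m 1, ⟨by simp, fun a ha => ?_⟩, fun b => ?_⟩
    · rwa [Finset.mem_singleton.1 (support_monomial_subset ha)]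
    · rw [normalFormCoord, if_pos hmB, coeff_monomial]
  · have hmS := hm.resolve_left hmB
    refine ⟨monomial m 1 - G ⟨m, hmS⟩, ⟨?_, fun a ha => ?_⟩, fun b => ?_⟩
    · rw [sub_sub_cancel]
      exact hG.subset ⟨_, rfl⟩
    · have ham : a ≠ m := by
        rintro rfl
        refine mem_support_iff.1 ha ?_
        rw [coeff_sub, coeff_monomial, if_pos rfl, hG.coeff_self hdeg ⟨a, hmS⟩, sub_self]
      refine hG.mem_standardMonomials hdeg ⟨m, hmS⟩ ?_ ham
      rw [mem_support_iff] at ha ⊢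
      intro h0
      refine ha ?_
      rw [coeff_sub, coeff_monomial, if_neg ham.symm, h0, sub_zero]
    · have hbm : m ≠ b := fun h => hmB (h ▸ b.2)
      rw [normalFormCoord, if_neg hmB, dif_pos hmS, coeff_sub, coeff_monomial, if_neg hbm,
        zero_sub]
      rfl

theorem IsReducedGroebnerBasis.evalMonomial_eq_sum
    (hG : IsReducedGroebnerBasis ord J (Set.range G)) (hdeg : ∀ e : S, ord.degree (G e) = e)
    {y : σ → A} (hy : ∀ f : MvPolynomial σ K, f ∈ J ↔ aeval y f = 0)
    {m : σ →₀ ℕ} (hm : m ∈ standardMonomials S ∨ m ∈ S) {ι : Type} [Fintype ι]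
    (ε : ι ≃ standardMonomials S) :
    evalMonomial y m = ∑ i, normalFormCoord S m (ε i) (groebnerCoeffs G) •
      evalMonomial y (ε i : σ →₀ ℕ) := by
  obtain ⟨r, ⟨hr, hrB⟩, hrc⟩ := hG.exists_normalForm hdeg hm
  have h1 := (hy _).1 hr
  rw [map_sub, aeval_monomial_one, sub_eq_zero] at h1
  rw [h1, aeval_eq_sum_evalMonomial]
  simp only [hrc]
  symm
  have h2 : ∀ i, coeff (ε i : σ →₀ ℕ) r • evalMonomial y (ε i : σ →₀ ℕ) ≠ 0 →
      (ε i : σ →₀ ℕ) ∈ r.support := by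
    intro i hi
    rw [mem_support_iff]
    rintro h0
    exact hi (by rw [h0, zero_smul])
  refine Finset.sum_bij_ne_zero (fun i _ _ => (ε i : σ →₀ ℕ)) (fun i _ hi => h2 i hi)
    (fun i _ _ j _ _ h => ε.injective (Subtype.ext h)) (fun a ha ha0 => ?_) (fun i _ _ => rfl)
  refine ⟨ε.symm ⟨a, hrB a ha⟩, Finset.mem_univ _, ?_, ?_⟩
  · simpa using ha0
  · simp

end

end GroebnerCoordinates

/-! ### Membership in the transformed ideal -/

section LinearChangeMembership

variable {K : Type u} [Field K] {n : ℕ}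

theorem adjoin_mk_X (I : Ideal (MvPolynomial (Fin n) K)) :
    Algebra.adjoin K (Set.range fun i => Ideal.Quotient.mk I (X i)) = ⊤ := by
  have h : (aeval fun i => Ideal.Quotient.mk I (X i) : MvPolynomial (Fin n) K →ₐ[K] _) =
      Ideal.Quotient.mkₐ K I := by
    ext i
    simp
  rw [Algebra.adjoin_range_eq_range_aeval, h, AlgHom.range_eq_top]
  exact Ideal.Quotient.mkₐ_surjective K I

theorem linearChange_hom_comp (g h : Matrix (Fin n) (Fin n) K) (hgh : h * g = 1) :
    (aeval fun i => ∑ j, C (g i j) * X j :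
      MvPolynomial (Fin n) K →ₐ[K] MvPolynomial (Fin n) K).comp
      (aeval fun i => ∑ j, C (h i j) * X j) = AlgHom.id K _ := by
  ext1 i
  simp only [AlgHom.comp_apply, aeval_X, map_sum, map_mul, algHom_C, algebraMap_eq, Finset.mul_sum]
  rw [Finset.sum_comm]
  have h1 : ∀ k, ∑ j, C (h i j) * (C (g j k) * X k) =
      (C ((h * g) i k) * X k : MvPolynomial (Fin n) K) := by
    intro k
    rw [Matrix.mul_apply, map_sum, Finset.sum_mul]
    exact Finset.sum_congr rfl fun j _ => by rw [map_mul, mul_assoc]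
  simp only [h1, hgh]
  simp [Matrix.one_apply]

/-- The substitution by `g⁻¹` inverts the one by `g`, so `f` is in `g · I` iff `f(g⁻¹ · X)` is in
`I`. This is why the open conditions are imposed on `g⁻¹`. -/
theorem mem_linearChange (g : GL (Fin n) K) (I : Ideal (MvPolynomial (Fin n) K))
    (f : MvPolynomial (Fin n) K) :
    f ∈ linearChange g I ↔
      aeval (linearForms (fun i => Ideal.Quotient.mk I (X i)) (g⁻¹).val) f = 0 := by
  set φ : MvPolynomial (Fin n) K →ₐ[K] MvPolynomial (Fin n) K :=
    aeval fun i => ∑ j, C (g.val i j) * X j with hφ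
  set ψ : MvPolynomial (Fin n) K →ₐ[K] MvPolynomial (Fin n) K :=
    aeval fun i => ∑ j, C ((g⁻¹).val i j) * X j with hψ
  have hφψ : ∀ a, φ (ψ a) = a := fun a => DFunLike.congr_fun (linearChange_hom_comp g.val (g⁻¹).val
    (by rw [← Units.val_mul, inv_mul_cancel, Units.val_one])) a
  have hψφ : ∀ a, ψ (φ a) = a := fun a => DFunLike.congr_fun (linearChange_hom_comp (g⁻¹).val g.val
    (by rw [← Units.val_mul, mul_inv_cancel, Units.val_one])) a
  have h1 : f ∈ linearChange g I ↔ ψ f ∈ I := by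
    constructor
    · intro h
      have h2 : I.map φ ≤ I.comap ψ := Ideal.map_le_iff_le_comap.2 fun a ha => by
        rw [Ideal.mem_comap, Ideal.mem_comap, hψφ]
        exact ha
      exact h2 h
    · intro h
      rw [← hφψ f]
      exact Ideal.mem_map_of_mem φ h
  rw [h1, ← Ideal.Quotient.eq_zero_iff_mem]
  have h2 : (Ideal.Quotient.mkₐ K I).comp ψ =
      aeval (linearForms (fun i => Ideal.Quotient.mk I (X i)) (g⁻¹).val) := by
    ext1 i
    rw [AlgHom.comp_apply, aeval_X, map_sum, aeval_X, linearForms]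
    refine Finset.sum_congr rfl fun j _ => ?_
    rw [← smul_eq_C_mul, map_smul]
    rfl
  rw [← h2]
  rfl

end LinearChangeMembership

/-! ### Correctness of the solution of Krylov systems -/

section KrylovCorrectness

open Matrix

variable {K : Type u} [Field K] {D N : ℕ}

theorem sum_castLE {M : Type*} [AddCommMonoid M] (hD : D ≤ N) (f : Fin N → M)
    (hf : ∀ b : Fin N, D ≤ (b : ℕ) → f b = 0) : ∑ b, f b = ∑ b : Fin D, f (Fin.castLE hD b) := by
  obtain ⟨r, rfl⟩ := Nat.exists_eq_add_of_le hD
  rw [Fin.sum_univ_add, Finset.sum_eq_zero fun i _ => hf (Fin.natAdd D i) (by simp), add_zero]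
  rfl

/-- The matrix bordered with zeros. -/
def padMatrix (N : ℕ) (M : Matrix (Fin D) (Fin D) K) : Matrix (Fin N) (Fin N) K :=
  of fun a b => if h : (a : ℕ) < D ∧ (b : ℕ) < D then M ⟨a, h.1⟩ ⟨b, h.2⟩ else 0

/-- The matrix with additional zero rows. -/
def padRows (N : ℕ) {κ : Type} (W : Matrix (Fin D) κ K) : Matrix (Fin N) κ K :=
  of fun a i => if h : (a : ℕ) < D then W ⟨a, h⟩ i else 0

theorem padMatrix_castLE (hD : D ≤ N) (M : Matrix (Fin D) (Fin D) K) (a b : Fin D) :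
    padMatrix N M (Fin.castLE hD a) (Fin.castLE hD b) = M a b := by
  simp [padMatrix]

theorem padMatrix_of_le_left (M : Matrix (Fin D) (Fin D) K) {a : Fin N} (ha : D ≤ (a : ℕ))
    (b : Fin N) : padMatrix N M a b = 0 := by
  simp [padMatrix, not_lt.2 ha]

theorem padMatrix_of_le_right (M : Matrix (Fin D) (Fin D) K) (a : Fin N) {b : Fin N}
    (hb : D ≤ (b : ℕ)) : padMatrix N M a b = 0 := by
  simp [padMatrix, not_lt.2 hb]

/-- A matrix bordered with an identity matrix is strongly nonsingular if its leading principal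
minors do not vanish. -/
theorem stronglyNonsingular_border (hD : D ≤ N) (Q : Matrix (Fin N) (Fin N) K)
    (hQ : ∀ k (hk : k ≤ D), (Q.submatrix (Fin.castLE (hk.trans hD))
      (Fin.castLE (hk.trans hD))).det ≠ 0) :
    StronglyNonsingular (of fun a b : Fin N => if (a : ℕ) < D ∧ (b : ℕ) < D then Q a b
      else if a = b then 1 else 0) := by
  intro k hk
  rcases le_total k D with hkD | hkD
  · have h1 := hQ k hkD
    convert h1 using 2
    ext a b
    simp [lt_of_lt_of_le a.2 hkD, lt_of_lt_of_le b.2 hkD]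
  · obtain ⟨r, rfl⟩ := Nat.exists_eq_add_of_le hkD
    rw [← det_submatrix_equiv_self finSumFinEquiv]
    have h1 : (((of fun a b : Fin N => if (a : ℕ) < D ∧ (b : ℕ) < D then Q a b
        else if a = b then 1 else 0).submatrix (Fin.castLE hk) (Fin.castLE hk)).submatrix
          finSumFinEquiv finSumFinEquiv) =
        fromBlocks (Q.submatrix (Fin.castLE hD) (Fin.castLE hD)) 0 0
          (1 : Matrix (Fin r) (Fin r) K) := by
      ext a b
      rcases a with a | a <;> rcases b with b | b
      · simp
        rfl
      · simp [Fin.ext_iff]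
        omega
      · simp [Fin.ext_iff]
        omega
      · simp [Fin.ext_iff, one_apply]
    rw [h1, det_fromBlocks_zero₂₁, det_one, mul_one]
    exact hQ D le_rfl

variable {A : Type u} [CommRing A] [Algebra K A]

theorem sum_padMatrix_mulVec (hD : D ≤ N) {T : Matrix (Fin D) (Fin D) K} {u : Fin D → A} {z : A}
    (hT : ∀ b, z * u b = ∑ a, T a b • u a) (w : Fin N → K) :
    ∑ a : Fin D, (padMatrix N T *ᵥ w) (Fin.castLE hD a) • u a =
      z * ∑ a : Fin D, w (Fin.castLE hD a) • u a := by
  rw [Finset.mul_sum]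
  simp only [mul_smul_comm, hT, Finset.smul_sum]
  rw [Finset.sum_comm]
  refine Finset.sum_congr rfl fun a _ => ?_
  rw [mulVec, dotProduct, sum_castLE hD _ fun b hb => by rw [padMatrix_of_le_right _ _ hb, zero_mul],
    Finset.sum_smul]
  refine Finset.sum_congr rfl fun b _ => ?_
  rw [padMatrix_castLE, smul_smul, mul_comm]

theorem sum_padMatrix_pow_mulVec (hD : D ≤ N) {T : Matrix (Fin D) (Fin D) K} {u : Fin D → A} {z : A}
    (hT : ∀ b, z * u b = ∑ a, T a b • u a) {i₀ : Fin D} (hi₀ : u i₀ = 1) (j : ℕ) :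
    ∑ a : Fin D, (padMatrix N T ^ j *ᵥ fun a => if (a : ℕ) = i₀ then 1 else 0) (Fin.castLE hD a) •
      u a = z ^ j := by
  induction j with
  | zero =>
    simp only [pow_zero, one_mulVec]
    rw [Finset.sum_eq_single i₀ (fun b _ hb => by simp [Fin.val_inj, hb]) (by simp)]
    simp [hi₀]
  | succ j ih => rw [pow_succ', ← mulVec_mulVec, sum_padMatrix_mulVec hD hT, ih, pow_succ']

theorem padMatrix_pow_mulVec_of_le {T : Matrix (Fin D) (Fin D) K} {i₀ : Fin D} (j : ℕ) {a : Fin N}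
    (ha : D ≤ (a : ℕ)) :
    (padMatrix N T ^ j *ᵥ fun a => if (a : ℕ) = i₀ then 1 else 0) a = 0 := by
  cases j with
  | zero =>
    have : (a : ℕ) ≠ i₀ := fun h => absurd i₀.2 (by omega)
    simp [this]
  | succ j =>
    rw [pow_succ', ← mulVec_mulVec]
    simp [mulVec, dotProduct, padMatrix_of_le_left _ ha]

/-- With `u` as basis, `T` represents multiplication by `z`, and the start vector represents `1`. So
column `j` of the Krylov matrix `P` holds coordinates of `z ^ j`, and a solution of `P s' = w` gives
coefficients of the element `w` in powers of `z`. As `P R` is invertible by its minors, `s' = R (P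
R)⁻¹ w`; bordering by an identity keeps padded entries out of play. -/
theorem krylovSolution_spec (hD : D ≤ N) {n : ℕ} {T R : Matrix (Fin D) (Fin D) K} {u : Fin D → A}
    {z : A} (hT : ∀ b, z * u b = ∑ a, T a b • u a) {i₀ : Fin D} (hi₀ : u i₀ = 1)
    (hminor : ∀ P : Matrix (Fin D) (Fin D) K, (∀ j : Fin D, z ^ (j : ℕ) = ∑ a, P a j • u a) →
      ∀ k (hk : k ≤ D), ((P * R).submatrix (Fin.castLE hk) (Fin.castLE hk)).det ≠ 0)
    {inv : Matrix (Fin N) (Fin N) K → Matrix (Fin N) (Fin N) K}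
    (hinv : ∀ M, StronglyNonsingular M → M * inv M = 1)
    (W : Matrix (Fin D) (Fin (n + 1)) K) (i : Fin (n + 1)) :
    ∑ k : Fin D, krylovSolution inv hD (fun a => if (a : ℕ) = i₀ then 1 else 0) (padMatrix N R)
      (padMatrix N T) (padRows N W) (Fin.castLE hD k) i • z ^ (k : ℕ) =
      if i = Fin.last n then z ^ D else ∑ a, W a i • u a := by
  have hD0 : 0 < D := lt_of_le_of_lt (Nat.zero_le _) i₀.2
  set v : Fin N → K := fun a => if (a : ℕ) = i₀ then 1 else 0 with hv
  set P : Matrix (Fin N) (Fin N) K := of fun i (j : Fin N) => (padMatrix N T ^ (j : ℕ) *ᵥ v) i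
    with hP
  set M : Matrix (Fin N) (Fin N) K := of fun a b => if (a : ℕ) < D ∧ (b : ℕ) < D then
      (P * padMatrix N R) a b else if a = b then 1 else 0 with hM
  set w : Fin N → K := fun a => if i = Fin.last n then
    (padMatrix N T * P) a ⟨D - 1, by omega⟩ else padRows N W a i with hw
  have hPz : ∀ j : Fin N, ∑ a : Fin D, P (Fin.castLE hD a) j • u a = z ^ (j : ℕ) := fun j =>
    sum_padMatrix_pow_mulVec hD hT hi₀ j
  have hP0 : ∀ (a : Fin N) (_ : D ≤ (a : ℕ)) (j : Fin N), P a j = 0 := fun a ha j =>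
    padMatrix_pow_mulVec_of_le j ha
  have hPR0 : ∀ (a : Fin N) (_ : D ≤ (a : ℕ)) (j : Fin N), (P * padMatrix N R) a j = 0 :=
    fun a ha j => by simp [mul_apply, hP0 a ha]
  have hPR0' : ∀ (a b : Fin N) (_ : D ≤ (b : ℕ)), (P * padMatrix N R) a b = 0 :=
    fun a b hb => by simp [mul_apply, padMatrix_of_le_right _ _ hb]
  have hM1 : M * inv M = 1 := hinv M (stronglyNonsingular_border hD _ fun k hk => by
    have h1 := hminor (P.submatrix (Fin.castLE hD) (Fin.castLE hD))
      (fun j => (hPz (Fin.castLE hD j)).symm) k hk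
    convert h1 using 2
    ext a b
    rw [submatrix_apply, submatrix_apply, mul_apply, mul_apply, sum_castLE hD _ fun c hc => by
      rw [padMatrix_of_le_left _ hc, mul_zero]]
    refine Finset.sum_congr rfl fun c _ => ?_
    rw [submatrix_apply, ← padMatrix_castLE hD R]
    rfl)
  have hw0 : ∀ a : Fin N, D ≤ (a : ℕ) → w a = 0 := by
    intro a ha
    simp only [hw]
    split_ifs
    · simp [mul_apply, padMatrix_of_le_left _ ha]
    · simp [padRows, not_lt.2 ha]
  set s := inv M *ᵥ w with hs
  have hMs : M *ᵥ s = w := by rw [hs, mulVec_mulVec, hM1, one_mulVec]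
  -- Beyond index `D` the rows of `M` are those of the identity, so `s` inherits the zeros of `w`.
  have hs0 : ∀ a : Fin N, D ≤ (a : ℕ) → s a = 0 := by
    intro a ha
    have h1 := congrFun hMs a
    rw [hw0 a ha] at h1
    simpa [mulVec, dotProduct, hM, not_lt.2 ha] using h1
  have hPs : P *ᵥ (padMatrix N R *ᵥ s) = w := by
    rw [mulVec_mulVec]
    funext a
    by_cases ha : (a : ℕ) < D
    · rw [← congrFun hMs a, mulVec, mulVec, dotProduct, dotProduct]
      refine Finset.sum_congr rfl fun b _ => ?_
      by_cases hb : (b : ℕ) < D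
      · simp [hM, ha, hb]
      · rw [hs0 b (not_lt.1 hb), mul_zero, mul_zero]
    · rw [hw0 a (not_lt.1 ha)]
      simp [mulVec, dotProduct, hPR0 a (not_lt.1 ha)]
  have hsol : ∀ a, krylovSolution inv hD v (padMatrix N R) (padMatrix N T) (padRows N W) a i =
      (padMatrix N R *ᵥ s) a := by
    intro a
    have h1 : (fun a => w a) = (of fun a i => if i = Fin.last n then
      (if h : 0 < D then (padMatrix N T * P) a ⟨D - 1, by omega⟩ else 0)
        else padRows N W a i : Matrix (Fin N) (Fin (n + 1)) K).col i := by
      funext a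
      simp [hw, hD0]
    rw [hs, mulVec_mulVec]
    change _ = ((padMatrix N R * inv M) *ᵥ fun a => w a) a
    rw [h1]
    rfl
  simp only [hsol]
  have h1 : ∀ a : Fin D, ∑ k : Fin D, P (Fin.castLE hD a) (Fin.castLE hD k) *
      (padMatrix N R *ᵥ s) (Fin.castLE hD k) = w (Fin.castLE hD a) := by
    intro a
    rw [← congrFun hPs (Fin.castLE hD a), mulVec, dotProduct, sum_castLE hD]
    intro b hb
    rw [mulVec, dotProduct, Finset.sum_eq_zero fun c _ => by
      rw [padMatrix_of_le_left _ hb, zero_mul], mul_zero]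
  have h2 : ∑ k : Fin D, (padMatrix N R *ᵥ s) (Fin.castLE hD k) • z ^ (k : ℕ) =
      ∑ a : Fin D, w (Fin.castLE hD a) • u a := by
    simp only [← h1, Finset.sum_smul]
    rw [Finset.sum_comm]
    refine Finset.sum_congr rfl fun k _ => ?_
    have h3 := hPz (Fin.castLE hD k)
    rw [Fin.val_castLE] at h3
    rw [← h3, Finset.smul_sum]
    refine Finset.sum_congr rfl fun a _ => ?_
    rw [smul_smul, mul_comm]
  rw [h2]
  split_ifs with hi
  -- Column `D - 1` of `T P` is `T ^ D v`, the coordinate vector of `z ^ D`.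
  · rw [← sum_padMatrix_pow_mulVec hD hT hi₀ D]
    refine Finset.sum_congr rfl fun a _ => ?_
    congr 1
    simp only [hw, if_pos hi]
    obtain ⟨d, rfl⟩ : ∃ d, D = d + 1 := ⟨D - 1, by omega⟩
    rw [pow_succ', ← mulVec_mulVec]
    rfl
  · refine Finset.sum_congr rfl fun a _ => ?_
    simp [hw, hi, padRows]

end KrylovCorrectness

/-! ### The computation trees -/

section Trees

open Matrix

variable {K : Type u} [Field K] {n : ℕ}

/-- An enumeration of a set of monomials. -/
def enumeration {σ : Type} (B : Set (σ →₀ ℕ)) {D : ℕ} (hD : 0 < D) (hB : Nat.card B = D) :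
    Fin D ≃ B :=
  haveI : Finite B := Nat.finite_of_card_ne_zero (by omega)
  (Finite.equivFinOfCardEq hB).symm

theorem evalMonomial_add {σ : Type} {R : Type*} [CommSemiring R] (y : σ → R) (a b : σ →₀ ℕ) :
    evalMonomial y (a + b) = evalMonomial y a * evalMonomial y b := by
  classical
  exact Finsupp.prod_add_index' (fun _ => pow_zero _) fun _ _ _ => pow_add _ _ _

/-- The multiplication matrix of a variable is read off the coefficients of the Gröbner basis. -/
theorem exists_readT {σ : Type} (i : σ) (S : Finset (σ →₀ ℕ)) :
    ∃ t : CompTree K (standardMonomials S × standardMonomials S) (S × standardMonomials S),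
      Finite (standardMonomials S) → ∀ c, t.cost c = 0 ∧ ∀ b' b : standardMonomials S,
        t.value c (b', b) = normalFormCoord S ((b : σ →₀ ℕ) + Finsupp.single i 1) b' c := by
  by_cases hS : Finite (standardMonomials S)
  · obtain ⟨t, ht⟩ := Computes.pi_free (K := K)
      (f := fun c (p : standardMonomials S × standardMonomials S) =>
        normalFormCoord S ((p.2 : σ →₀ ℕ) + Finsupp.single i 1) p.1 c)
      fun p => computes_normalFormCoord _ _
    refine ⟨t, fun _ c => ⟨?_, fun b' b => congrFun (ht c).1 (b', b)⟩⟩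
    exact_mod_cast le_antisymm (ht c).2 (Nat.cast_nonneg _)
  · exact ⟨.const 0 (.output fun _ => none), fun h => absurd h hS⟩

theorem computes_padMatrix {r : Type} {D N : ℕ} {T : (r → K) → Matrix (Fin D) (Fin D) K}
    (hT : ∀ i j, Computes 0 fun e (_ : Unit) => T e i j) (i j : Fin N) :
    Computes 0 fun e (_ : Unit) => padMatrix N (T e) i j := by
  simp only [padMatrix, of_apply]
  split_ifs
  · exact hT _ _
  · exact Computes.const _

theorem computes_padRows {r κ : Type} {D N : ℕ} {W : (r → K) → Matrix (Fin D) κ K}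
    (hW : ∀ i j, Computes 0 fun e (_ : Unit) => W e i j) (i : Fin N) (j : κ) :
    Computes 0 fun e (_ : Unit) => padRows N (W e) i j := by
  simp only [padRows, of_apply]
  split_ifs
  · exact hW _ _
  · exact Computes.const _

/-- The coefficients that express the variables, and the power with exponent `D` of the last one, in
terms of the powers of the last variable. -/
theorem exists_toLEX (ω c : ℝ) (S : Finset (Fin (n + 1) →₀ ℕ)) (D : ℕ) (t : Fin D → K) :
    ∃ tree : CompTree K (Fin (n + 1) × Fin D) (S × standardMonomials S),
      2 ≤ ω → MatrixMultiplicationCost K ω c → ∀ (hD : 0 < D)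
      (hcard : Nat.card (standardMonomials S) = D), 0 ∈ standardMonomials S →
      ∀ env : S × standardMonomials S → K,
      (tree.cost env : ℝ) ≤ 2 ^ ω * (12 * c + 1) *
        (Real.logb 2 D * (max (n + 1 : ℝ) D * (D : ℝ) ^ (ω - 1))) ∧
      ∀ (A : Type u) [CommRing A] [Algebra K A] (y : Fin (n + 1) → A),
      (∀ b, evalMonomial y ((enumeration _ hD hcard b : Fin (n + 1) →₀ ℕ) +
          Finsupp.single (Fin.last n) 1) =
        ∑ a, normalFormCoord S ((enumeration _ hD hcard b : Fin (n + 1) →₀ ℕ) +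
          Finsupp.single (Fin.last n) 1) (enumeration _ hD hcard a) env •
            evalMonomial y (enumeration _ hD hcard a : Fin (n + 1) →₀ ℕ)) →
      (∀ i, y i = ∑ a, normalFormCoord S (Finsupp.single i 1) (enumeration _ hD hcard a) env •
            evalMonomial y (enumeration _ hD hcard a : Fin (n + 1) →₀ ℕ)) →
      (∀ P : Matrix (Fin D) (Fin D) K, (∀ j : Fin D, y (Fin.last n) ^ (j : ℕ) =
          ∑ a, P a j • evalMonomial y (enumeration _ hD hcard a : Fin (n + 1) →₀ ℕ)) →
        ∀ k (hk : k ≤ D),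
          ((P * vandermonde t).submatrix (Fin.castLE hk) (Fin.castLE hk)).det ≠ 0) →
      ∀ i, ∑ k : Fin D, tree.value env (i, k) • y (Fin.last n) ^ (k : ℕ) =
        if i = Fin.last n then y (Fin.last n) ^ D else y i := by
  -- The tree must exist before the hypotheses are known; if one of them fails, any tree will do.
  by_cases h : 2 ≤ ω ∧ MatrixMultiplicationCost K ω c ∧ 0 < D ∧
    Nat.card (standardMonomials S) = D ∧ 0 ∈ standardMonomials S
  swap
  · exact ⟨.const 0 (.output fun _ => none), fun h1 h2 h3 h4 h5 => absurd ⟨h1, h2, h3, h4, h5⟩ h⟩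
  obtain ⟨hω, hc, hD, hcard, h0⟩ := h
  set ε := enumeration (standardMonomials S) hD hcard with hε
  have hW : ∀ i j, Computes (K := K) 0 fun e (_ : Unit) => (of fun a (i : Fin (n + 1)) =>
      normalFormCoord S (Finsupp.single i 1) (ε a) e : Matrix (Fin D) (Fin (n + 1)) K) i j :=
    fun a i => computes_normalFormCoord _ _
  -- For `D = 1` the bound is `0`, since `log 1 = 0`. Then `1` is the only standard monomial and the
  -- variables are constants read off the basis.
  rcases (by omega : D = 1 ∨ 2 ≤ D) with rfl | hD2
  · obtain ⟨tree, htree⟩ := Computes.pi_free (K := K) (f := fun e (ik : Fin (n + 1) × Fin 1) =>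
      normalFormCoord S (Finsupp.single ik.1 1) (ε ik.2) e) fun ik => hW ik.2 ik.1
    refine ⟨tree, fun _ _ _ _ _ env => ⟨?_, fun A _ _ y _ hy _ i => ?_⟩⟩
    · simpa using (htree env).2
    · have h2 : (ε 0 : Fin (n + 1) →₀ ℕ) = 0 := by
        obtain ⟨j, hj⟩ := ε.surjective ⟨0, h0⟩
        rw [Subsingleton.elim 0 j, hj]
      have h3 := hy i
      rw [Fin.sum_univ_one] at h3
      change y i = _ • evalMonomial y (ε 0 : Fin (n + 1) →₀ ℕ) at h3
      rw [h2] at h3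
      have h4 : evalMonomial y (0 : Fin (n + 1) →₀ ℕ) = 1 := by simp [evalMonomial]
      rw [h4] at h3
      rw [Fin.sum_univ_one, (htree env).1]
      simp only [Fin.val_zero, pow_zero, pow_one]
      split_ifs with hi
      · rw [← hi]
        exact h3.symm
      · exact h3.symm
  · have hl : D ≤ 2 ^ Nat.clog 2 D := Nat.le_pow_clog (by norm_num) D
    -- The start vector is the unit vector at the position of the monomial `1`. The matrices for `T`
    -- and the variables are read off the basis for free, and `R` is constant.
    obtain ⟨inv, hinv, tree, htree⟩ := exists_computes_krylovSolution_le hω hc hD2 hl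
      (fun a => if (a : ℕ) = ε.symm ⟨0, h0⟩ then (1 : K) else 0) (padMatrix _ (vandermonde t))
      (fun e => padMatrix _ (of fun a b => normalFormCoord S ((ε b : Fin (n + 1) →₀ ℕ) +
          Finsupp.single (Fin.last n) 1) (ε a) e))
      (computes_padMatrix fun a b => computes_normalFormCoord _ _)
      (fun e => padRows _ (of fun a (i : Fin (n + 1)) =>
        normalFormCoord S (Finsupp.single i 1) (ε a) e)) (computes_padRows hW)
    refine ⟨tree, fun _ _ _ _ _ env => ⟨(htree env).2, fun A _ _ y hT hy hminor i => ?_⟩⟩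
    rw [(htree env).1, krylovSolution_spec hl (z := y (Fin.last n))
      (u := fun a => evalMonomial y (ε a : Fin (n + 1) →₀ ℕ)) ?_ ?_ hminor hinv]
    · refine if_congr Iff.rfl rfl ?_
      exact (hy i).symm
    · intro b
      refine Eq.trans ?_ (hT b)
      change y (Fin.last n) * evalMonomial y (ε b : Fin (n + 1) →₀ ℕ) = evalMonomial y
        ((ε b : Fin (n + 1) →₀ ℕ) + Finsupp.single (Fin.last n) 1)
      rw [evalMonomial_add, evalMonomial_single, pow_one, mul_comm]
    · simp [evalMonomial]

end Trees

/-! ### Ideals in shape position -/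

section Shape

variable {K : Type u} [Field K] {A : Type u} [CommRing A] [Algebra K A] {n D : ℕ}

/-- The last relation is monic of degree `D` in `z`, so the powers below `D` span `K[z]`. By the
other relations `K[z]` contains all generators, hence is the whole algebra, and `D` spanning
elements in dimension `D` are independent. -/
theorem linearIndependent_powers_of_span {y : Fin (n + 1) → A}
    (hy : Algebra.adjoin K (Set.range y) = ⊤) (hD : D = Module.finrank K A)
    {a : Fin (n + 1) × Fin D → K}
    (ha : ∀ i, i ≠ Fin.last n → y i = ∑ k : Fin D, a (i, k) • y (Fin.last n) ^ (k : ℕ))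
    (hlast : y (Fin.last n) ^ D = ∑ k : Fin D, a (Fin.last n, k) • y (Fin.last n) ^ (k : ℕ)) :
    LinearIndependent K fun j : Fin D => y (Fin.last n) ^ (j : ℕ) := by
  classical
  refine linearIndependent_of_top_le_span_of_card_eq_finrank ?_ (by simpa using hD)
  set z := y (Fin.last n) with hz
  set q : Polynomial K := ∑ k : Fin D, Polynomial.C (a (Fin.last n, k)) * Polynomial.X ^ (k : ℕ)
  have hq : q.degree < D := Polynomial.degree_sum_fin_lt _
  have hmonic : (Polynomial.X ^ D - q).Monic := Polynomial.monic_X_pow_sub hq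
  have hdeg : (Polynomial.X ^ D - q).natDegree = D := by
    apply Polynomial.natDegree_eq_of_degree_eq_some
    rw [Polynomial.degree_sub_eq_left_of_degree_lt (by rwa [Polynomial.degree_X_pow]),
      Polynomial.degree_X_pow]
  have hroot : Polynomial.aeval z (Polynomial.X ^ D - q) = 0 := by
    simp only [q, map_sub, map_pow, Polynomial.aeval_X, map_sum, map_mul, Polynomial.aeval_C,
      hlast, ← Algebra.smul_def, sub_self]
  have h1 := Submodule.span_range_natDegree_eq_adjoin hmonic hroot
  rw [hdeg] at h1
  have h2 : (Finset.image (fun x => z ^ x) (Finset.range D) : Set A) =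
      Set.range fun j : Fin D => z ^ (j : ℕ) := by
    ext w
    simp only [Finset.coe_image, Finset.coe_range, Set.mem_image, Set.mem_Iio, Set.mem_range]
    exact ⟨fun ⟨k, hk, h⟩ => ⟨⟨k, hk⟩, h⟩, fun ⟨k, h⟩ => ⟨k, k.2, h⟩⟩
  rw [← h2]
  have h3 : Algebra.adjoin K {z} = ⊤ := by
    rw [eq_top_iff, ← hy]
    refine Algebra.adjoin_le ?_
    have hmem : z ∈ Algebra.adjoin K {z} := Algebra.self_mem_adjoin_singleton K z
    rintro _ ⟨i, rfl⟩
    by_cases hi : i = Fin.last n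
    · rw [hi]
      exact hmem
    · rw [SetLike.mem_coe, ha i hi]
      exact Subalgebra.sum_mem _ fun k _ => Subalgebra.smul_mem _
        (Subalgebra.pow_mem _ hmem _) _
  intro w _
  have h4 : w ∈ Subalgebra.toSubmodule (Algebra.adjoin K {z}) := by
    rw [h3]
    exact (Algebra.mem_top : w ∈ (⊤ : Subalgebra K A))
  rwa [← h1] at h4

/-- The exponent of the leading monomial of an element of a basis in shape position. -/
def shapeExponent (D : ℕ) (i : Fin (n + 1)) : ℕ := if i = Fin.last n then D else 1

/-- The elements of `shapeBasis`. -/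
def shapePoly (c : Fin (n + 1) × Fin D → K) (i : Fin (n + 1)) : MvPolynomial (Fin (n + 1)) K :=
  monomial (Finsupp.single i (shapeExponent D i)) 1 -
    ∑ k : Fin D, monomial (Finsupp.single (Fin.last n) (k : ℕ)) (c (i, k))

theorem shapeBasis_eq_range (c : Fin (n + 1) × Fin D → K) :
    shapeBasis D c = Set.range (shapePoly c) := by
  have h1 : ∀ i, ∑ k : Fin D, monomial (Finsupp.single (Fin.last n) (k : ℕ)) (c (i, k)) =
      ∑ k : Fin D, C (c (i, k)) * X (Fin.last n) ^ (k : ℕ) := fun i =>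
    Finset.sum_congr rfl fun k _ => by rw [X_pow_eq_monomial, C_mul_monomial, mul_one]
  have h2 : ∀ i, i ≠ Fin.last n → shapePoly c i =
      X i - ∑ k : Fin D, C (c (i, k)) * X (Fin.last n) ^ (k : ℕ) := fun i hi => by
    rw [shapePoly, h1, shapeExponent, if_neg hi]
    rfl
  have h3 : shapePoly c (Fin.last n) = X (Fin.last n) ^ D -
      ∑ k : Fin D, C (c (Fin.last n, k)) * X (Fin.last n) ^ (k : ℕ) := by
    rw [shapePoly, h1, shapeExponent, if_pos rfl, X_pow_eq_monomial]
  ext f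
  constructor
  · rintro (⟨i, hi, rfl⟩ | rfl)
    · exact ⟨i, h2 i hi⟩
    · exact ⟨_, h3⟩
  · rintro ⟨i, rfl⟩
    by_cases hi : i = Fin.last n
    · rw [hi]
      exact Or.inr h3
    · exact Or.inl ⟨i, hi, h2 i hi⟩

theorem aeval_shapePoly (c : Fin (n + 1) × Fin D → K) (y : Fin (n + 1) → A) (i : Fin (n + 1)) :
    aeval y (shapePoly c i) = y i ^ shapeExponent D i -
      ∑ k : Fin D, c (i, k) • y (Fin.last n) ^ (k : ℕ) := by
  simp [shapePoly, aeval_monomial, Algebra.smul_def]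

theorem single_lex_lt (i : Fin (n + 1)) (k : Fin D) :
    Finsupp.single (Fin.last n) (k : ℕ) ≺[MonomialOrder.lex]
      Finsupp.single i (shapeExponent D i) := by
  rw [MonomialOrder.lex_lt_iff, Finsupp.Lex.lt_iff]
  refine ⟨i, fun j hj => ?_, ?_⟩
  · have h1 : Fin.last n ≠ j := fun h => absurd (Fin.le_last i) (not_le.2 (h ▸ hj))
    simp [h1, hj.ne']
  · by_cases hi : i = Fin.last n
    · subst hi
      simp [shapeExponent]
    · simp [shapeExponent, hi]

/-- The last variable is the LEX-smallest, and only its lower powers lie below one of its powers. -/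
theorem eq_single_of_lex_le {m : Fin (n + 1) →₀ ℕ} {j : ℕ}
    (h : m ≼[MonomialOrder.lex] Finsupp.single (Fin.last n) j) :
    ∃ k ≤ j, m = Finsupp.single (Fin.last n) k := by
  rcases h.eq_or_lt with h | h
  · exact ⟨j, le_rfl, MonomialOrder.lex.toSyn.injective h⟩
  · rw [MonomialOrder.lex_lt_iff, Finsupp.Lex.lt_iff] at h
    obtain ⟨i, h1, h2⟩ := h
    have hi : i = Fin.last n := by
      by_contra hi
      simp [Ne.symm hi] at h2
    subst hi
    refine ⟨m (Fin.last n), by simpa using h2.le, ?_⟩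
    ext k
    by_cases hk : k = Fin.last n
    · subst hk
      simp
    · have h3 := h1 k (lt_of_le_of_ne (Fin.le_last k) hk)
      simpa [Finsupp.single_apply, Ne.symm hk] using h3

theorem coeff_shapePoly_self (c : Fin (n + 1) × Fin D → K) (i : Fin (n + 1)) :
    coeff (Finsupp.single i (shapeExponent D i)) (shapePoly c i) = 1 := by
  classical
  rw [shapePoly, coeff_sub, coeff_sum, Finset.sum_eq_zero, coeff_monomial, if_pos rfl, sub_zero]
  intro k _
  rw [coeff_monomial, if_neg]
  intro h
  have h1 := single_lex_lt i k
  rw [h] at h1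
  exact lt_irrefl _ h1

theorem mem_support_shapePoly {c : Fin (n + 1) × Fin D → K} {i : Fin (n + 1)}
    {m : Fin (n + 1) →₀ ℕ} (hm : m ∈ (shapePoly c i).support) :
    m = Finsupp.single i (shapeExponent D i) ∨
      ∃ k : Fin D, m = Finsupp.single (Fin.last n) (k : ℕ) := by
  classical
  by_contra! h
  refine mem_support_iff.1 hm ?_
  rw [shapePoly, coeff_sub, coeff_sum, Finset.sum_eq_zero, coeff_monomial, if_neg h.1.symm, sub_zero]
  intro k _
  rw [coeff_monomial, if_neg (h.2 k).symm]

theorem degree_shapePoly (c : Fin (n + 1) × Fin D → K) (i : Fin (n + 1)) :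
    MonomialOrder.lex.degree (shapePoly c i) = Finsupp.single i (shapeExponent D i) := by
  apply MonomialOrder.lex.toSyn.injective
  apply le_antisymm
  · rw [MonomialOrder.degree_le_iff]
    intro m hm
    rcases mem_support_shapePoly hm with rfl | ⟨k, rfl⟩
    · exact le_rfl
    · exact (single_lex_lt i k).le
  · refine MonomialOrder.lex.le_degree (mem_support_iff.2 ?_)
    rw [coeff_shapePoly_self]
    exact one_ne_zero

theorem not_single_le_of_mem_support {c : Fin (n + 1) × Fin D → K} (hD : 0 < D) {i i' : Fin (n + 1)}
    (hi : i' ≠ i) {m : Fin (n + 1) →₀ ℕ} (hm : m ∈ (shapePoly c i).support) :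
    ¬ Finsupp.single i' (shapeExponent D i') ≤ m := by
  intro hle
  have h1 := hle i'
  rw [Finsupp.single_eq_same, shapeExponent] at h1
  rcases mem_support_shapePoly hm with rfl | ⟨k, rfl⟩
  · rw [Finsupp.single_apply, if_neg hi.symm] at h1
    split_ifs at h1
    all_goals omega
  · rw [Finsupp.single_apply] at h1
    have := k.2
    split_ifs at h1 with h2 h3
    all_goals omega

/-- An element of `J` whose leading monomial is divisible by none of the given ones has a leading
monomial `xₙ ^ j` with `j < D`. By the LEX order it is then a polynomial in `xₙ` alone of degree
less than `D`, and a nonzero one contradicts the independence of the powers. -/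
theorem isReducedGroebnerBasis_shapeBasis {J : Ideal (MvPolynomial (Fin (n + 1)) K)}
    {y : Fin (n + 1) → A} (hy : ∀ f : MvPolynomial (Fin (n + 1)) K, f ∈ J ↔ aeval y f = 0)
    (hD : 0 < D) (hli : LinearIndependent K fun j : Fin D => y (Fin.last n) ^ (j : ℕ))
    {c : Fin (n + 1) × Fin D → K}
    (hc : ∀ i, ∑ k : Fin D, c (i, k) • y (Fin.last n) ^ (k : ℕ) =
      if i = Fin.last n then y (Fin.last n) ^ D else y i) :
    IsReducedGroebnerBasis MonomialOrder.lex J (shapeBasis D c) := by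
  have hmonic : ∀ i, MonomialOrder.lex.Monic (shapePoly c i) := fun i => by
    rw [MonomialOrder.Monic, MonomialOrder.leadingCoeff, degree_shapePoly, coeff_shapePoly_self]
  have hsub : Set.range (shapePoly c) ⊆ J := by
    rintro _ ⟨i, rfl⟩
    rw [SetLike.mem_coe, hy, aeval_shapePoly, hc, shapeExponent, sub_eq_zero]
    split_ifs with hi
    · rw [hi]
    · rw [pow_one]
  rw [shapeBasis_eq_range]
  refine ⟨Set.finite_range _, hsub, le_antisymm (Ideal.span_mono (Set.image_mono hsub)) ?_, ?_, ?_⟩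
  · rw [Ideal.span_le]
    rintro _ ⟨f, hf, rfl⟩
    by_cases hf0 : f = 0
    · rw [hf0, MonomialOrder.leadingTerm_zero]
      exact Ideal.zero_mem _
    by_cases hdiv : ∃ i, Finsupp.single i (shapeExponent D i) ≤ MonomialOrder.lex.degree f
    · obtain ⟨i, hi⟩ := hdiv
      have h1 : MonomialOrder.lex.leadingTerm f = monomial (MonomialOrder.lex.degree f -
          Finsupp.single i (shapeExponent D i)) (MonomialOrder.lex.leadingCoeff f) *
          MonomialOrder.lex.leadingTerm (shapePoly c i) := by
        rw [MonomialOrder.leadingTerm, MonomialOrder.leadingTerm, degree_shapePoly,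
          (hmonic i).leadingCoeff_eq_one, monomial_mul, mul_one, tsub_add_cancel_of_le hi]
      rw [SetLike.mem_coe, h1]
      exact Ideal.mul_mem_left _ _ (Ideal.subset_span ⟨_, ⟨i, rfl⟩, rfl⟩)
    · exfalso
      push Not at hdiv
      set m := MonomialOrder.lex.degree f with hm
      have hmi : ∀ i, m i < shapeExponent D i := by
        intro i
        by_contra h
        exact hdiv i (Finsupp.single_le_iff.2 (not_lt.1 h))
      have hmlast : m = Finsupp.single (Fin.last n) (m (Fin.last n)) := by
        ext i
        by_cases hi : i = Fin.last n
        · rw [hi, Finsupp.single_eq_same]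
        · have h1 := hmi i
          rw [shapeExponent, if_neg hi] at h1
          rw [Finsupp.single_apply, if_neg (Ne.symm hi)]
          omega
      have hjD : m (Fin.last n) < D := by
        have h1 := hmi (Fin.last n)
        rwa [shapeExponent, if_pos rfl] at h1
      have hsupp : ∀ a ∈ f.support, ∃ k : Fin D, a = Finsupp.single (Fin.last n) (k : ℕ) := by
        intro a ha
        have h1 : a ≼[MonomialOrder.lex] m := MonomialOrder.lex.le_degree ha
        rw [hmlast] at h1
        obtain ⟨k, hk, rfl⟩ := eq_single_of_lex_le h1
        exact ⟨⟨k, lt_of_le_of_lt hk hjD⟩, rfl⟩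
      have h0 : ∑ k : Fin D, coeff (Finsupp.single (Fin.last n) (k : ℕ)) f •
          y (Fin.last n) ^ (k : ℕ) = 0 := by
        rw [← (hy f).1 hf, aeval_eq_sum_evalMonomial]
        refine Finset.sum_bij_ne_zero (fun k _ _ => Finsupp.single (Fin.last n) (k : ℕ))
          (fun k _ hk => mem_support_iff.2 fun h => hk (by rw [h, zero_smul]))
          (fun k _ _ k' _ _ h => Fin.ext (Finsupp.single_injective _ h)) (fun a ha ha0 => ?_)
          (fun k _ _ => by rw [evalMonomial_single])
        obtain ⟨k, rfl⟩ := hsupp a ha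
        exact ⟨k, Finset.mem_univ _, by rwa [evalMonomial_single] at ha0, rfl⟩
      have h1 := Fintype.linearIndependent_iff.1 hli _ h0 ⟨_, hjD⟩
      rw [← hmlast] at h1
      exact mem_support_iff.1 (MonomialOrder.lex.degree_mem_support hf0) h1
  · rintro _ ⟨i, rfl⟩
    exact hmonic i
  · rintro _ ⟨i, rfl⟩ _ ⟨i', rfl⟩ hne m hm
    rw [degree_shapePoly]
    exact not_single_le_of_mem_support hD (fun h => hne (by rw [h])) hm

end Shape

/-! ### The open set of changes of variables -/

section Main

open Matrix

/-- Otherwise some `e` in `S` properly divides `b * x l`. As `e` does not divide `b`, it has the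
same degree in `x l` as `b * x l`, so some other variable `x k` has smaller degree in `e` than in
`b`. Then `(e / x l) * x k` divides `b` and is standard, against the exchange property. -/
theorem add_single_mem_standardMonomials_or {σ : Type} {S : Finset (σ →₀ ℕ)} {l : σ}
    (hex : ∀ k, k ≠ l → ∀ m, m + Finsupp.single l 1 ∈ S →
      m + Finsupp.single k 1 ∉ standardMonomials S) {b : σ →₀ ℕ} (hb : b ∈ standardMonomials S) :
    b + Finsupp.single l 1 ∈ standardMonomials S ∨ b + Finsupp.single l 1 ∈ S := by
  classical
  by_contra! h
  obtain ⟨h1, h2⟩ := h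
  have h3 : ∃ e ∈ S, e ≤ b + Finsupp.single l 1 := by
    by_contra! h3
    exact h1 h3
  obtain ⟨e, heS, hle⟩ := h3
  have hb' : ∀ k, k ≠ l → (b + Finsupp.single l 1 : σ →₀ ℕ) k = b k := fun k hk => by
    simp [Ne.symm hk]
  have hbl : (b + Finsupp.single l 1 : σ →₀ ℕ) l = b l + 1 := by simp
  have hel : e l = b l + 1 := by
    by_contra hel
    refine hb e heS fun k => ?_
    have h4 := hle k
    by_cases hk : k = l
    · subst hk
      omega
    · rwa [hb' k hk] at h4
  obtain ⟨k, hk⟩ : ∃ k, e k ≠ (b + Finsupp.single l 1 : σ →₀ ℕ) k := by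
    by_contra! h4
    exact h2 (Finsupp.ext h4 ▸ heS)
  have hkl : k ≠ l := fun h => hk (by rw [h, hel, hbl])
  have hkb : e k < b k := by
    have h4 := hle k
    rw [hb' k hkl] at hk h4
    omega
  have he : e - Finsupp.single l 1 + Finsupp.single l 1 = e :=
    tsub_add_cancel_of_le (Finsupp.single_le_iff.2 (by omega))
  refine hex k hkl (e - Finsupp.single l 1) (by rwa [he]) (standardMonomials_of_le hb fun j => ?_)
  have h4 := hle j
  rw [Finsupp.add_apply, Finsupp.tsub_apply]
  by_cases hj : j = l
  · subst hj
    simp [hkl, hel]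
  · rw [hb' j hj] at h4
    by_cases hjk : j = k
    · subst hjk
      simp [Ne.symm hj]
      omega
    · simp [Ne.symm hj, Ne.symm hjk, h4]

theorem single_mem_standardMonomials_or {σ : Type} {S : Finset (σ →₀ ℕ)}
    (h0 : 0 ∈ standardMonomials S) (i : σ) :
    Finsupp.single i 1 ∈ standardMonomials S ∨ Finsupp.single i 1 ∈ S := by
  classical
  by_contra! h
  obtain ⟨h1, h2⟩ := h
  have h3 : ∃ e ∈ S, e ≤ Finsupp.single i 1 := by
    by_contra! h3
    exact h1 h3
  obtain ⟨e, heS, hle⟩ := h3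
  by_cases hei : e i = 0
  · refine h0 e heS fun k => ?_
    by_cases hk : k = i
    · rw [hk, hei]
      exact Nat.zero_le _
    · simpa [Finsupp.single_apply, Ne.symm hk] using hle k
  · refine h2 (le_antisymm hle (Finsupp.single_le_iff.2 (by omega)) ▸ heS)

theorem drl_single_lt {n : ℕ} {k : Fin (n + 1)} (hk : k ≠ Fin.last n) :
    Finsupp.single (Fin.last n) 1 ≺[drl (n + 1)] Finsupp.single k 1 := by
  rw [drl_lt_iff]
  refine Or.inr ⟨by simp, Fin.last n, by simp [hk], fun j hj => ?_⟩
  exact absurd (Fin.le_last j) (not_le.2 hj)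

variable {K : Type u} [Field K] {A : Type u} [CommRing A] [Algebra K A] {n : ℕ}

/-- The open set is the nonvanishing locus, at `g⁻¹`, of the determinant of the generic standard
monomials times all Krylov minors. -/
theorem exists_zariskiOpen [Infinite K] {D : ℕ} (hD : 0 < D) (β : Module.Basis (Fin D) K A)
    {x : Fin (n + 1) → A} (hx : Algebra.adjoin K (Set.range x) = ⊤) {t : Fin D → K}
    (ht : Function.Injective t) :
    ∃ (B : Set (Fin (n + 1) →₀ ℕ)) (hB : Nat.card B = D) (U : Set (GL (Fin (n + 1)) K)),
      U.Nonempty ∧ IsZariskiOpenGL U ∧ ∀ g ∈ U,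
      B = {m | (drl (n + 1)).toSyn m ∈ minimalIndices K fun s =>
        evalMonomial (linearForms x (g⁻¹).val) ((drl (n + 1)).toSyn.symm s)} ∧
      (∀ k, k ≠ Fin.last n → ∀ m : Fin (n + 1) →₀ ℕ, ((m (Fin.last n) + 1 : ℕ) : K) ≠ 0 →
        m + Finsupp.single (Fin.last n) 1 ∉ B → m + Finsupp.single k 1 ∉ B) ∧
      ((∃ h : Matrix (Fin (n + 1)) (Fin (n + 1)) K, LinearIndependent K fun j : Fin D =>
          linearForms x h (Fin.last n) ^ (j : ℕ)) →
        ∀ P : Matrix (Fin D) (Fin D) K,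
        (∀ j : Fin D, linearForms x (g⁻¹).val (Fin.last n) ^ (j : ℕ) =
          ∑ a, P a j • evalMonomial (linearForms x (g⁻¹).val)
            (enumeration B hD hB a : Fin (n + 1) →₀ ℕ)) →
        ∀ k (hk : k ≤ D),
          ((P * vandermonde t).submatrix (Fin.castLE hk) (Fin.castLE hk)).det ≠ 0) := by
  classical
  obtain ⟨⟨e⟩, hspec⟩ := genericStandard_spec β x (drl (n + 1)) hx
  set B := genericStandard β x (drl (n + 1)) with hBdef
  have hB : Nat.card B = D := by rw [← Nat.card_congr e, Nat.card_eq_fintype_card, Fintype.card_fin]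
  set ε := enumeration B hD hB with hε
  have hdet := (hspec ε).1
  set d := (genericMatrix β x fun j => (ε j : Fin (n + 1) →₀ ℕ)).det with hd
  -- Without a form with independent powers the minors could vanish identically; they are then left
  -- out, so that the open set stays non-empty and the first two claims hold for every `I`.
  by_cases hpow : ∃ h : Matrix (Fin (n + 1)) (Fin (n + 1)) K, LinearIndependent K fun j : Fin D =>
          linearForms x h (Fin.last n) ^ (j : ℕ)
  · set q := ∏ k : Fin (D + 1), krylovMinor β x (fun j => (ε j : Fin (n + 1) →₀ ℕ)) (Fin.last n) t
      (Nat.le_of_lt_succ k.2) with hq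
    have hq0 : q ≠ 0 := by
      obtain ⟨h, hh⟩ := hpow
      exact Finset.prod_ne_zero_iff.2 fun k _ => krylovMinor_ne_zero β x _ hdet _ ht hh _
    obtain ⟨hne, hopen⟩ := zariskiOpen_inv (d * q) (mul_ne_zero hdet hq0)
    refine ⟨B, hB, _, hne, hopen, fun g hg => ?_⟩
    rw [Set.mem_ofPred_eq, map_mul] at hg
    have hgd := left_ne_zero_of_mul hg
    have hgq := right_ne_zero_of_mul hg
    refine ⟨genericStandard_eq β x _ hx ε hgd, fun k hk m hm hmB =>
      mem_genericStandard_exchange β x _ hx ε hgd (drl_single_lt hk) hm hmB, ?_⟩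
    intro _ P hP k hk h0
    rw [hq, map_prod] at hgq
    refine Finset.prod_ne_zero_iff.1 hgq ⟨k, Nat.lt_succ_of_le hk⟩ (Finset.mem_univ _) ?_
    rw [eval_krylovMinor β x _ _ t hk _ P hP, h0, mul_zero]
  · obtain ⟨hne, hopen⟩ := zariskiOpen_inv d hdet
    exact ⟨B, hB, _, hne, hopen, fun g hg => ⟨genericStandard_eq β x _ hx ε hg,
      fun k hk m hm hmB => mem_genericStandard_exchange β x _ hx ε hg (drl_single_lt hk) hm hmB,
      fun h => absurd h hpow⟩⟩

theorem adjoin_linearForms {x : Fin n → A} (hx : Algebra.adjoin K (Set.range x) = ⊤)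
    (g : GL (Fin n) K) : Algebra.adjoin K (Set.range (linearForms x g.val)) = ⊤ := by
  rw [eq_top_iff, ← hx]
  refine Algebra.adjoin_le ?_
  rintro _ ⟨i, rfl⟩
  have h1 : x i = ∑ j, (g⁻¹).val i j • linearForms x g.val j := by
    simp only [linearForms, Finset.smul_sum, smul_smul]
    rw [Finset.sum_comm]
    simp only [← Finset.sum_smul, ← mul_apply, ← Units.val_mul, inv_mul_cancel]
    simp [one_apply]
  rw [SetLike.mem_coe, h1]
  exact Subalgebra.sum_mem _ fun j _ => Subalgebra.smul_mem _ (Algebra.subset_adjoin (Set.mem_range_self j)) _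

theorem exists_linearIndependent_powers_of_shape {I : Ideal (MvPolynomial (Fin (n + 1)) K)} {D : ℕ}
    (hD : D = Module.finrank K (MvPolynomial (Fin (n + 1)) K ⧸ I)) {h : GL (Fin (n + 1)) K}
    {a : Fin (n + 1) × Fin D → K}
    (hG : IsReducedGroebnerBasis MonomialOrder.lex (linearChange h I) (shapeBasis D a)) :
    LinearIndependent K fun j : Fin D => linearForms (fun i => Ideal.Quotient.mk I (X i)) (h⁻¹).val
      (Fin.last n) ^ (j : ℕ) := by
  have hsub := hG.subset
  rw [shapeBasis_eq_range] at hsub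
  have h1 : ∀ i, linearForms (fun i => Ideal.Quotient.mk I (X i)) (h⁻¹).val i ^ shapeExponent D i =
      ∑ k : Fin D, a (i, k) • linearForms (fun i => Ideal.Quotient.mk I (X i)) (h⁻¹).val
        (Fin.last n) ^ (k : ℕ) := fun i => by
    rw [← sub_eq_zero, ← aeval_shapePoly]
    exact (mem_linearChange h I _).1 (hsub ⟨i, rfl⟩)
  refine linearIndependent_powers_of_span (adjoin_linearForms (adjoin_mk_X I) h⁻¹) hD
    (a := a) (fun i hi => ?_) ?_
  · have h2 := h1 i
    rwa [shapeExponent, if_neg hi, pow_one] at h2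
  · have h2 := h1 (Fin.last n)
    rwa [shapeExponent, if_pos rfl] at h2

end Main

end

/-! ### Assembly of the main theorem -/

theorem mainTheorem4 :
    ∃ C : ℝ → ℝ → ℝ,
    ∀ (K : Type u) [Field K] [Infinite K] (p : ℕ) [CharP K p] (n : ℕ),
    ∃ (readT : ∀ S : Finset (Fin (n + 1) →₀ ℕ),
        CompTree K (standardMonomials S × standardMonomials S) (S × standardMonomials S))
      (toLEX : ∀ (_ω _c : ℝ) (S : Finset (Fin (n + 1) →₀ ℕ)) (D : ℕ),
        CompTree K (Fin (n + 1) × Fin D) (S × standardMonomials S)),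
    ∀ I : Ideal (MvPolynomial (Fin (n + 1)) K), I.IsRadical → I ≠ ⊤ →
      Module.Finite K (MvPolynomial (Fin (n + 1)) K ⧸ I) →
    ∃ U : Set (GL (Fin (n + 1)) K), U.Nonempty ∧ IsZariskiOpenGL U ∧
    ∀ g ∈ U, ∀ (S : Finset (Fin (n + 1) →₀ ℕ)) (G : S → MvPolynomial (Fin (n + 1)) K),
      IsReducedGroebnerBasis (drl (n + 1)) (linearChange g I) (Set.range G) →
      (∀ e : S, (drl (n + 1)).degree (G e) = e) →
      (0 < p → ∀ e ∈ S, 0 < e (Fin.last n) → ¬ p ∣ e (Fin.last n)) →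
      (IsMultiplicationMatrix (linearChange g I) S (Fin.last n)
          (Matrix.of fun b' b => (readT S).value (groebnerCoeffs G) (b', b)) ∧
        (readT S).cost (groebnerCoeffs G) = 0) ∧
      (∀ D : ℕ, D = Module.finrank K (MvPolynomial (Fin (n + 1)) K ⧸ I) →
        (PerfectField K ∨
          Algebra.IsGeometricallyReduced K (MvPolynomial (Fin (n + 1)) K ⧸ I) ∨
          ∃ (h : GL (Fin (n + 1)) K) (a : Fin (n + 1) × Fin D → K),
            IsReducedGroebnerBasis MonomialOrder.lex (linearChange h I) (shapeBasis D a)) →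
        ∀ ω c : ℝ, 2 ≤ ω → MatrixMultiplicationCost K ω c →
          IsReducedGroebnerBasis MonomialOrder.lex (linearChange g I)
            (shapeBasis D ((toLEX ω c S D).value (groebnerCoeffs G))) ∧
          (n + 1 ≤ D →
            ((toLEX ω c S D).cost (groebnerCoeffs G) : ℝ) ≤
              C ω c * (Real.logb 2 D *
                ((D : ℝ) ^ ω + (n + 1 : ℝ) * Real.logb 2 D * D))) ∧
          ((toLEX ω c S D).cost (groebnerCoeffs G) : ℝ) ≤
            C ω c * (Real.logb 2 D *
              (max (n + 1 : ℝ) D * (D : ℝ) ^ (ω - 1) + (n + 1 : ℝ) * Real.logb 2 D * D))) := by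
  refine ⟨fun ω c => 2 ^ ω * (12 * c + 1), fun K _ _ p _ n => ?_⟩
  choose readT hreadT using exists_readT (K := K) (Fin.last n)
  -- The Vandermonde nodes are distinct elements of `K` fixed once and for all, so the tree does not
  -- depend on `I` or `g`.
  choose toLEX htoLEX using fun (ω c : ℝ) (S : Finset (Fin (n + 1) →₀ ℕ)) (D : ℕ) =>
    exists_toLEX (K := K) (n := n) ω c S D fun j => Infinite.natEmbedding K j
  refine ⟨readT, toLEX, fun I hI hItop hfin => ?_⟩
  set x : Fin (n + 1) → MvPolynomial (Fin (n + 1)) K ⧸ I := fun i => Ideal.Quotient.mk I (X i)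
    with hxdef
  have hx : Algebra.adjoin K (Set.range x) = ⊤ := adjoin_mk_X I
  have : Nontrivial (MvPolynomial (Fin (n + 1)) K ⧸ I) := Ideal.Quotient.nontrivial_iff.2 hItop
  have hD0 : 0 < Module.finrank K (MvPolynomial (Fin (n + 1)) K ⧸ I) := Module.finrank_pos
  obtain ⟨B, hB, U, hUne, hUopen, hU⟩ := exists_zariskiOpen hD0
    (Module.finBasis K (MvPolynomial (Fin (n + 1)) K ⧸ I)) hx
    (t := fun j => Infinite.natEmbedding K j) fun i j hij =>
      Fin.ext ((Infinite.natEmbedding K).injective hij)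
  refine ⟨U, hUne, hUopen, fun g hg S G hG hdeg hp => ?_⟩
  obtain ⟨hBmin, hexch, hminor⟩ := hU g hg
  have hy := mem_linearChange g I
  set y := linearForms x (g⁻¹).val with hydef
  have hSB : B = standardMonomials S := by rw [hG.standardMonomials_eq hdeg hy, hBmin]
  subst hSB
  have hfinB : Finite (standardMonomials S) := Nat.finite_of_card_ne_zero (by omega)
  have h0 : 0 ∈ standardMonomials S := by
    obtain ⟨b⟩ : Nonempty (standardMonomials S) := ⟨enumeration _ hD0 hB ⟨0, hD0⟩⟩
    exact standardMonomials_of_le b.2 zero_le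
  have hshift : ∀ b ∈ standardMonomials S, b + Finsupp.single (Fin.last n) 1 ∈ standardMonomials S ∨
      b + Finsupp.single (Fin.last n) 1 ∈ S := by
    intro b hb
    -- For a leading monomial `m * xₙ` the factor in the exchange property is its degree in `xₙ`,
    -- which by hypothesis is not divisible by the characteristic.
    refine add_single_mem_standardMonomials_or (fun k hk m hm => hexch k hk m ?_ ?_) hb
    · rw [Ne, CharP.cast_eq_zero_iff K p]
      rcases Nat.eq_zero_or_pos p with rfl | hp0
      · simp
      · simpa using hp hp0 _ hm (by simp)
    · exact fun h => h _ hm le_rfl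
  refine ⟨⟨fun b => ?_, (hreadT S hfinB _).1⟩, fun D hD hshape ω c hω hc => ?_⟩
  · obtain ⟨r, hr, hrc⟩ := hG.exists_normalForm hdeg (hshift b b.2)
    refine ⟨r, ?_, fun b' => ?_⟩
    · rwa [X, monomial_mul, mul_one, add_comm (Finsupp.single _ _)]
    · rw [Matrix.of_apply, (hreadT S hfinB _).2, hrc]
  subst hD
  obtain ⟨hcost, hval⟩ := htoLEX ω c S _ hω hc hD0 hB h0 (groebnerCoeffs G)
  have hpow : ∃ h : Matrix (Fin (n + 1)) (Fin (n + 1)) K, LinearIndependent K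
      fun j : Fin (Module.finrank K (MvPolynomial (Fin (n + 1)) K ⧸ I)) =>
        linearForms x h (Fin.last n) ^ (j : ℕ) := by
    have hred := (Ideal.isRadical_iff_quotient_reduced I).1 hI
    rcases hshape with h | h | ⟨h, a, hGh⟩
    · obtain ⟨a, ha⟩ := exists_linearIndependent_powers hx (Or.inl ⟨h, hred⟩)
      exact ⟨Matrix.of fun _ j => a j, ha⟩
    · obtain ⟨a, ha⟩ := exists_linearIndependent_powers hx (Or.inr h)
      exact ⟨Matrix.of fun _ j => a j, ha⟩
    · exact ⟨(h⁻¹).val, exists_linearIndependent_powers_of_shape rfl hGh⟩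
  have hsol := hval _ y
    (fun b => hG.evalMonomial_eq_sum hdeg hy (hshift _ (enumeration _ hD0 hB b).2) _)
    (fun i => by
      have h1 := hG.evalMonomial_eq_sum hdeg hy (single_mem_standardMonomials_or h0 i)
        (enumeration _ hD0 hB)
      rwa [evalMonomial_single, pow_one] at h1)
    (hminor hpow)
  -- Independence of the powers of the last form at this `g` is read off the solved systems: they
  -- express every `y i` and the power `D` by lower powers of the last form.
  have hli := linearIndependent_powers_of_span (adjoin_linearForms hx g⁻¹) rfl
    (a := (toLEX ω c S _).value (groebnerCoeffs G))
    (fun i hi => by rw [hsol, if_neg hi]) (by rw [hsol, if_pos rfl])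
  have hC : (0 : ℝ) ≤ 2 ^ ω * (12 * c + 1) := by
    have := hc.nonneg
    positivity
  have hD1 : (1 : ℝ) ≤ Module.finrank K (MvPolynomial (Fin (n + 1)) K ⧸ I) := by
    exact_mod_cast hD0
  have hlog := Real.logb_nonneg one_lt_two hD1
  -- The computation stays within the first summand of the bound; the second one is nonnegative and
  -- only weakens it.
  have hextra : (0 : ℝ) ≤ (n + 1 : ℝ) *
      Real.logb 2 (Module.finrank K (MvPolynomial (Fin (n + 1)) K ⧸ I)) *
        Module.finrank K (MvPolynomial (Fin (n + 1)) K ⧸ I) := by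
    positivity
  refine ⟨isReducedGroebnerBasis_shapeBasis hy hD0 hli hsol, fun hnD => hcost.trans ?_,
    hcost.trans ?_⟩
  · rw [max_eq_right (by exact_mod_cast hnD), Real.rpow_sub_one (by positivity),
      mul_div_cancel₀ _ (by positivity)]
    gcongr
    linarith
  · gcongr
    linarith
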